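/- **Setting.** Let $k$ be a field, $n\in\mathbb N$, $I=\{1,\dots,n\}$, and let $\chi:\mathbb Z^n\times\mathbb Z^n\to k^\times$ be a bicharacter for which the matrix $q_{ij}=\chi(\alpha_i,\alpha_j)$ is symmetric, where $(\alpha_i)$ is the standard basis of $\mathbb Z^n$. Let $T=k\langle E_1,\dots,E_n\rangle$ be the tensor algebra of the braided vector space with basis $E_1,\dots,E_n$ and braiding $E_i\otimes E_j\mapsto q_{ij}E_j\otimes E_i$; it is a braided bialgebra with primitive generators $E_i$. Let $\mathcal I\subseteq\bigoplus_{m\ge2}T_m$ be a $\mathbb Z^n$-graded biideal of $T$. Let $\tau:I\to I$ be a bijection with $\tau^2=\mathrm{id}$, $q_{\tau(i)\tau(j)}=q_{ij}$ for all $i,j$, and $\tau(\mathcal I)=\mathcal I$ (where $\tau(E_i)=E_{\tau(i)}$). Let $U(\chi)$ be the $k$-algebra generated by $E_i,F_i,K_i^{\pm1}$ ($i\in I$) with $K_iK_i^{-1}=K_i^{-1}K_i=1$, $K_iK_j=K_jK_i$, $K_iE_j=q_{ij}E_jK_i$, $K_iF_j=q_{ij}^{-1}F_jK_i$, $E_iF_j-F_jE_i=\delta_{ij}(K_i-K_i^{-1})$,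 and $p(E_1,\dots,E_n)=0=p(F_1,\dots,F_n)$ for all $p\in\mathcal I$. Let $H$, $U^+$, $U^-$, $G^-$ be the subalgebras of $U(\chi)$ generated by the $K_i^{\pm1}$, the $E_i$, the $F_i$, the $F_iK_i$, respectively, and for $\alpha,\beta\in\mathbb N^n$ let $U^+_\alpha$, $U^-_{-\beta}$ be the components with respect to $\deg E_i=\alpha_i$, $\deg F_i=-\alpha_i$. Write $K_\lambda=\prod_iK_i^{\lambda_i}$ for $\lambda\in\mathbb Z^n$. Let $P_\lambda$ and $\pi_{\alpha,\beta}$ be the projections of $U(\chi)$ onto $U^+K_\lambda G^-$ and $U^+_\alpha HU^-_{-\beta}$ with respect to the direct sum decompositions $U(\chi)=\bigoplus_{\lambda\in\mathbb Z^n}U^+K_\lambda G^-=\bigoplus_{\alpha,\beta\in\mathbb N^n}U^+_\alpha HU^-_{-\beta}$. Let $\partial_i^L,\partial_i^R:U^-\to U^-$ be the unique linear maps with $E_if-fE_i=K_i\partial_i^L(f)-\partial_i^R(f)K_i^{-1}$ for all $f\in U^-$. Let $H_\theta$ be the subalgebra generated by the $K_iK_{\tau(i)}^{-1}$, and let $H_\theta\ltimes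 U^-$ be the subalgebra of $U(\chi)$ generated by $H_\theta$ and $U^-$, with the $\mathbb N$-grading $\deg h=0$ ($h\in H_\theta$), $\deg F_i=1$. For $\mathbf c=(c_i)\in k^n$ let $B_{\mathbf c}$ be the subalgebra generated by $H_\theta$ and $B_i=F_i+c_iE_{\tau(i)}K_i^{-1}$ ($i\in I$). Let $U(\chi)^{\mathrm{poly}}$ be the subalgebra generated by all $F_i$, $E_iK_i^{-1}$, $K_i^{-1}$, $K_iK_{\tau(i)}^{-1}$; it contains $B_{\mathbf c}$ and $H_\theta\ltimes U^-$. Let $\psi:U(\chi)^{\mathrm{poly}}\to H_\theta\ltimes U^-$ be the linear projection along the left ideal of $U(\chi)^{\mathrm{poly}}$ generated by all $E_iK_i^{-1}$ and $K_i^{-1}$; this left ideal is a linear complement of $H_\theta\ltimes U^-$. A *star product* on an $\mathbb N$-graded algebra $A=\bigoplus_jA_j$ is an associative bilinear operation $*$ on $A$ with $a*b-ab\in\bigoplus_{l<i+j}A_l$ for all $a\in A_i$, $b\in A_j$; it is *$0$-equivariant* if $a*h=ah$ and $h*a=ha$ for all $h\in A_0$, $a\in A$. **Theorem.** In this setting,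 assume (**c**) the ideal $\mathcal I$ of $T$ is generated by a family of noncommutative polynomials $p_j(E_1,\dots,E_n)$, homogeneous of degree $\lambda_j\in\mathbb N^n$, with $\pi_{0,0}\big(P_{-\lambda_j}(p_j(B_1,\dots,B_n))\big)=0$ for all $j$. Then the following hold. 0. The objects above are well defined: for every noncommutative polynomial $p$ one has $p(F_1,\dots,F_n)=0$ if and only if $p\in\mathcal I$; the two decompositions of $U(\chi)$, the decomposition of $U(\chi)^{\mathrm{poly}}$ defining $\psi$ and the grading of $H_\theta\ltimes U^-$ are direct; and the maps $\partial_i^L,\partial_i^R$ exist and are unique. 1. $\psi$ restricts to a linear isomorphism $\psi:B_{\mathbf c}\to H_\theta\ltimes U^-$. 2. The operation $a*b=\psi\big(\psi^{-1}(a)\,\psi^{-1}(b)\big)$ is a $0$-equivariant star product on $H_\theta\ltimes U^-$. 3. For all $i\in I$ and $u\in U^-$, $$F_i*u=F_iu+c_i\,q_{i\tau(i)}\,K_{\tau(i)}K_i^{-1}\,\partial^L_{\tau(i)}(u).$$ 4. The operation $*$ is the only $0$-equivariant star product on $H_\theta\ltimes U^-$ that satisfies the formula in 3. -/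

import Mathlib

namespace PreNichols

/-! ## Graded algebras and star products -/

section General

variable {k : Type*} [Field k]

/-- The canonical projection of `M` onto the summand `W i` of a direct sum decomposition
`M = ⨁ i, W i`, regarded as an endomorphism of `M`.  (It is only meaningful if the family `W` is
an internal direct sum decomposition; otherwise it is set to zero.) -/
noncomputable def summandProj {ι M : Type*} [DecidableEq ι] [AddCommGroup M] [Module k M]
    (W : ι → Submodule k M) (i : ι) : M →ₗ[k] M := by
  classical
  exact if h : DirectSum.IsInternal W then
    (W i).subtype ∘ₗ DirectSum.component k ι (fun j => W j) i ∘ₗ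
      (LinearEquiv.ofBijective (DirectSum.coeLinearMap W) h).symm.toLinearMap
  else 0

/-- An associative bilinear operation `m` on an `ℕ`-graded algebra `A = ⨁ j, 𝒜 j` is a star
product if `m a b - a b` lies in `⨁ l < i + j, 𝒜 l` for all `a ∈ 𝒜 i`, `b ∈ 𝒜 j`. -/
structure IsStarProduct {A : Type*} [Ring A] [Algebra k A] (𝒜 : ℕ → Submodule k A)
    (m : A →ₗ[k] A →ₗ[k] A) : Prop where
  assoc : ∀ a b c : A, m (m a b) c = m a (m b c)
  sub_mem : ∀ i j : ℕ, ∀ a ∈ 𝒜 i, ∀ b ∈ 𝒜 j, m a b - a * b ∈ ⨆ l : Fin (i + j), 𝒜 l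

/-- `0`-equivariance: multiplying with elements of degree `0` is the original multiplication. -/
def IsZeroEquivariant {A : Type*} [Ring A] [Algebra k A] (𝒜 : ℕ → Submodule k A)
    (m : A →ₗ[k] A →ₗ[k] A) : Prop :=
  ∀ h ∈ 𝒜 0, ∀ a : A, m a h = a * h ∧ m h a = h * a

/-- The product on `A` obtained from the product of `B` by transport along a linear isomorphism
`e : B ≃ A`, that is `a * b = e (e⁻¹ a · e⁻¹ b)`. -/
noncomputable def transportMul {A B : Type*} [Ring A] [Algebra k A] [Ring B] [Algebra k B]
    (e : B ≃ₗ[k] A) : A →ₗ[k] A →ₗ[k] A :=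
  ((LinearMap.mul k B).compl₁₂ e.symm.toLinearMap e.symm.toLinearMap).compr₂ e.toLinearMap

theorem transportMul_apply {A B : Type*} [Ring A] [Algebra k A] [Ring B] [Algebra k B]
    (e : B ≃ₗ[k] A) (a b : A) : transportMul e a b = e (e.symm a * e.symm b) := rfl

end General

/-! ## Bicharacters and the braided tensor algebra -/

/-- A bicharacter `χ : ℤⁿ × ℤⁿ → kˣ` for which the matrix `χ(αᵢ, αⱼ)` is symmetric. -/
structure SymmBicharacter (k : Type*) [Field k] (n : ℕ) where
  toFun : (Fin n → ℤ) → (Fin n → ℤ) → kˣ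
  map_add_left : ∀ a b c, toFun (a + b) c = toFun a c * toFun b c
  map_add_right : ∀ a b c, toFun a (b + c) = toFun a b * toFun a c
  symm : ∀ i j : Fin n,
    toFun (Pi.single i 1) (Pi.single j 1) = toFun (Pi.single j 1) (Pi.single i 1)

section TensorAlgebra

variable {k : Type*} [Field k] {n : ℕ}

/-- `q i j = χ(αᵢ, αⱼ)`. -/
def SymmBicharacter.q (χ : SymmBicharacter k n) (i j : Fin n) : kˣ :=
  χ.toFun (Pi.single i 1) (Pi.single j 1)

/-- The tensor algebra `T(V⁺(χ))`, i.e. the algebra of noncommutative polynomials in `n`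
variables; the `i`-th variable corresponds to the basis vector `Eᵢ` of `V⁺(χ)`. -/
abbrev NCPoly (k : Type*) [Field k] (n : ℕ) : Type _ := FreeAlgebra k (Fin n)

/-- The monomial `x_{j₁} ⋯ x_{jₘ}` of a multi-index. -/
def NCPoly.monomial (J : List (Fin n)) : NCPoly k n := (J.map (FreeAlgebra.ι k)).prod

/-- Noncommutative polynomials that are homogeneous of degree `l ∈ ℕⁿ`. -/
def NCPoly.homog (l : Fin n → ℕ) : Submodule k (NCPoly k n) :=
  Submodule.span k {p | ∃ J : List (Fin n), (∀ i, J.count i = l i) ∧ p = NCPoly.monomial J}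

/-- The subspace `⨁_{m ≥ 2} T(V⁺(χ))_m`. -/
def NCPoly.degGeTwo : Submodule k (NCPoly k n) :=
  Submodule.span k {p | ∃ J : List (Fin n), 2 ≤ J.length ∧ p = NCPoly.monomial J}

/-- The algebra automorphism of the tensor algebra that permutes the variables by `τ`. -/
def NCPoly.perm (τ : Equiv.Perm (Fin n)) : NCPoly k n →ₐ[k] NCPoly k n :=
  FreeAlgebra.lift k fun i => FreeAlgebra.ι k (τ i)

/-- A two-sided ideal of the tensor algebra as a linear subspace. -/
def idealSubmodule (I : TwoSidedIdeal (NCPoly k n)) : Submodule k (NCPoly k n) :=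
  (TwoSidedIdeal.asIdeal I).restrictScalars k

namespace SymmBicharacter

variable (χ : SymmBicharacter k n)

/-- The action of `Kᵢ` on the tensor algebra: `Kᵢ · Eⱼ = q i j Eⱼ`, extended multiplicatively. -/
def act (i : Fin n) : NCPoly k n →ₐ[k] NCPoly k n :=
  FreeAlgebra.lift k fun j => (χ.q i j : k) • FreeAlgebra.ι k j

/-- Left multiplication by `Eᵢ ⊗ 1 + 1 ⊗ Eᵢ` in the braided tensor product of two copies of the
tensor algebra.  The multiplication there is `(a ⊗ b)(c ⊗ d) = a c(b ⊗ c) d` with the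
Yetter-Drinfeld braiding, so `(Eᵢ ⊗ 1)(a ⊗ b) = Eᵢ a ⊗ b` and
`(1 ⊗ Eᵢ)(a ⊗ b) = (Kᵢ · a) ⊗ Eᵢ b`. -/
noncomputable def primitiveMul (i : Fin n) :
    Module.End k (TensorProduct k (NCPoly k n) (NCPoly k n)) :=
  TensorProduct.map (LinearMap.mulLeft k (FreeAlgebra.ι k i)) LinearMap.id +
    TensorProduct.map (χ.act i).toLinearMap (LinearMap.mulLeft k (FreeAlgebra.ι k i))

/-- The braided coproduct of `T(V⁺(χ))`: the algebra homomorphism into the braided tensor product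
for which every `Eᵢ` is primitive.  On a monomial it is
`(E_{j₁} ⊗ 1 + 1 ⊗ E_{j₁}) ⋯ (E_{jₘ} ⊗ 1 + 1 ⊗ E_{jₘ})`. -/
noncomputable def coproduct :
    NCPoly k n →ₗ[k] TensorProduct k (NCPoly k n) (NCPoly k n) :=
  LinearMap.applyₗ (TensorProduct.tmul k (1 : NCPoly k n) (1 : NCPoly k n)) ∘ₗ
    (FreeAlgebra.lift k χ.primitiveMul).toLinearMap

/-- `I` is a `ℤⁿ`-graded biideal of the braided bialgebra `T(V⁺(χ))` contained in
`⨁_{m ≥ 2} T(V⁺(χ))_m`, so that `T(V⁺(χ)) / I` is a pre-Nichols algebra of diagonal type. -/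
structure IsPreNicholsIdeal (I : TwoSidedIdeal (NCPoly k n)) : Prop where
  deg_ge_two : idealSubmodule I ≤ NCPoly.degGeTwo
  graded : idealSubmodule I ≤ ⨆ l : Fin n → ℕ, idealSubmodule I ⊓ NCPoly.homog l
  coideal : ∀ p ∈ I, χ.coproduct p ∈
    LinearMap.range (TensorProduct.map (idealSubmodule I).subtype
      (LinearMap.id : NCPoly k n →ₗ[k] NCPoly k n)) ⊔
    LinearMap.range (TensorProduct.map (LinearMap.id : NCPoly k n →ₗ[k] NCPoly k n)
      (idealSubmodule I).subtype)

end SymmBicharacter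

end TensorAlgebra

/-! ## The Drinfeld double of a pre-Nichols algebra -/

/-- A symmetric bicharacter `χ`, an ideal `I` defining a pre-Nichols algebra
`U⁺ = T(V⁺(χ)) / I`, and a diagram involution `τ` compatible with both. -/
structure Datum (k : Type*) [Field k] (n : ℕ) where
  χ : SymmBicharacter k n
  I : TwoSidedIdeal (NCPoly k n)
  isPreNichols : χ.IsPreNicholsIdeal I
  τ : Equiv.Perm (Fin n)
  τ_invol : ∀ i, τ (τ i) = i
  q_τ : ∀ i j, χ.q (τ i) (τ j) = χ.q i j
  I_τ : ∀ p, NCPoly.perm τ p ∈ I ↔ p ∈ I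

/-- Names of the generators `Eᵢ`, `Fᵢ`, `Kᵢ`, `Lᵢ = Kᵢ⁻¹`. -/
inductive Gen (n : ℕ) : Type
  | e (i : Fin n)
  | f (i : Fin n)
  | K (i : Fin n)
  | L (i : Fin n)

namespace Datum

section

variable {k : Type*} [Field k] {n : ℕ} (D : Datum k n)

/-- The free algebra on the generators. -/
abbrev Free (k : Type*) [Field k] (n : ℕ) : Type _ := FreeAlgebra k (Gen n)

/-- A generator as an element of the free algebra. -/
abbrev gen (g : Gen n) : Free k n := FreeAlgebra.ι k g

/-- The defining relations of `U(χ) = Ũ(χ) / (I, ω(I))`. -/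
inductive Rel : Free k n → Free k n → Prop
  | KL (i : Fin n) : Rel (gen (.K i) * gen (.L i)) 1
  | LK (i : Fin n) : Rel (gen (.L i) * gen (.K i)) 1
  | KK (i j : Fin n) : Rel (gen (.K i) * gen (.K j)) (gen (.K j) * gen (.K i))
  | KE (i j : Fin n) :
      Rel (gen (.K i) * gen (.e j)) ((D.χ.q i j : k) • (gen (.e j) * gen (.K i)))
  | KF (i j : Fin n) :
      Rel (gen (.K i) * gen (.f j)) ((((D.χ.q i j)⁻¹ : kˣ) : k) • (gen (.f j) * gen (.K i)))
  | EF (i j : Fin n) :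
      Rel (gen (.e i) * gen (.f j) - gen (.f j) * gen (.e i))
        (if i = j then gen (.K i) - gen (.L i) else 0)
  | IE (p : NCPoly k n) (hp : p ∈ D.I) : Rel (FreeAlgebra.lift k (fun i => gen (.e i)) p) 0
  | IF (p : NCPoly k n) (hp : p ∈ D.I) : Rel (FreeAlgebra.lift k (fun i => gen (.f i)) p) 0

/-- The algebra `U(χ)`, the Drinfeld double of the pre-Nichols algebra `U⁺`. -/
def U : Type _ := RingQuot D.Rel

noncomputable instance : Ring D.U := inferInstanceAs (Ring (RingQuot D.Rel))

noncomputable instance : Algebra k D.U := inferInstanceAs (Algebra k (RingQuot D.Rel))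

/-- The quotient map from the free algebra on the generators to `U(χ)`. -/
noncomputable def toU : Free k n →ₐ[k] D.U := RingQuot.mkAlgHom k D.Rel

/-- Related elements of the free algebra agree in `U(χ)`. -/
theorem toU_rel {x y : Free k n} (h : D.Rel x y) : D.toU x = D.toU y :=
  RingQuot.mkAlgHom_rel k h

/-- The generators of `U(χ)`. -/
noncomputable def E (i : Fin n) : D.U := D.toU (gen (.e i))

noncomputable def F (i : Fin n) : D.U := D.toU (gen (.f i))

noncomputable def K (i : Fin n) : D.U := D.toU (gen (.K i))

/-- `Kinv i = Kᵢ⁻¹`. -/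
noncomputable def Kinv (i : Fin n) : D.U := D.toU (gen (.L i))

theorem K_mul_Kinv (i : Fin n) : D.K i * D.Kinv i = 1 := by
  have h := D.toU_rel (Rel.KL i)
  rwa [map_mul, map_one] at h

theorem Kinv_mul_K (i : Fin n) : D.Kinv i * D.K i = 1 := by
  have h := D.toU_rel (Rel.LK i)
  rwa [map_mul, map_one] at h

/-- `Kᵢ` as a unit. -/
noncomputable def Kunit (i : Fin n) : D.Uˣ :=
  ⟨D.K i, D.Kinv i, D.K_mul_Kinv i, D.Kinv_mul_K i⟩

/-- `K_l = K₁^{l₁} ⋯ Kₙ^{lₙ}` for `l ∈ ℤⁿ`. -/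
noncomputable def Kpow (l : Fin n → ℤ) : D.U :=
  ((List.ofFn fun i => D.Kunit i ^ l i).prod : D.Uˣ)

/-- The subalgebra `H = k[Kᵢ, Kᵢ⁻¹]`. -/
noncomputable def H : Subalgebra k D.U :=
  Algebra.adjoin k (Set.range D.K ∪ Set.range D.Kinv)

/-- The subalgebra `U⁺` generated by the `Eᵢ`. -/
noncomputable def Uplus : Subalgebra k D.U := Algebra.adjoin k (Set.range D.E)

/-- The subalgebra `U⁻` generated by the `Fᵢ`. -/
noncomputable def Uminus : Subalgebra k D.U := Algebra.adjoin k (Set.range D.F)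

/-- The subalgebra `G⁻` generated by the `Fᵢ Kᵢ`. -/
noncomputable def Gminus : Subalgebra k D.U :=
  Algebra.adjoin k (Set.range fun i => D.F i * D.K i)

/-- The homogeneous component `U⁺_a`, for `a ∈ ℕⁿ`. -/
noncomputable def UplusHomog (a : Fin n → ℕ) : Submodule k D.U :=
  Submodule.span k {x | ∃ J : List (Fin n), (∀ i, J.count i = a i) ∧ x = (J.map D.E).prod}

/-- The homogeneous component `U⁻_{-b}`, for `b ∈ ℕⁿ`. -/
noncomputable def UminusHomog (b : Fin n → ℕ) : Submodule k D.U :=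
  Submodule.span k {x | ∃ J : List (Fin n), (∀ i, J.count i = b i) ∧ x = (J.map D.F).prod}

/-- The subspace `U⁺ K_l G⁻`. -/
noncomputable def UKG (l : Fin n → ℤ) : Submodule k D.U :=
  Subalgebra.toSubmodule D.Uplus * Submodule.span k {D.Kpow l} * Subalgebra.toSubmodule D.Gminus

/-- The subspace `U⁺_a H U⁻_{-b}`. -/
noncomputable def UHU (ab : (Fin n → ℕ) × (Fin n → ℕ)) : Submodule k D.U :=
  D.UplusHomog ab.1 * Subalgebra.toSubmodule D.H * D.UminusHomog ab.2

/-- The projection `P_l : U(χ) → U⁺ K_l G⁻` with respect to `U(χ) = ⨁_l U⁺ K_l G⁻`. -/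
noncomputable def P (l : Fin n → ℤ) : D.U →ₗ[k] D.U := summandProj D.UKG l

/-- The projection `π_{a,b} : U(χ) → U⁺_a H U⁻_{-b}` with respect to
`U(χ) = ⨁_{a,b} U⁺_a H U⁻_{-b}`. -/
noncomputable def proj (a b : Fin n → ℕ) : D.U →ₗ[k] D.U := summandProj D.UHU (a, b)

/-! ### The partial bosonization and the coideal subalgebra -/

/-- The subalgebra `H_θ` generated by the elements `Kᵢ K_{τ(i)}⁻¹`. -/
noncomputable def Htheta : Subalgebra k D.U :=
  Algebra.adjoin k (Set.range fun i => D.K i * D.Kinv (D.τ i))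

/-- The partial bosonization `H_θ ⋉ U⁻`: the subalgebra generated by `H_θ` and `U⁻`. -/
noncomputable def partialBos : Subalgebra k D.U := D.Htheta ⊔ D.Uminus

/-- The `ℕ`-grading of `H_θ ⋉ U⁻` with `deg h = 0` for `h ∈ H_θ` and `deg Fᵢ = 1`; the component
of degree `m` is spanned by the products `h F_{j₁} ⋯ F_{jₘ}`. -/
noncomputable def bosGrading (m : ℕ) : Submodule k D.partialBos :=
  (Subalgebra.toSubmodule D.Htheta *
    Submodule.span k {x | ∃ J : List (Fin n), J.length = m ∧ x = (J.map D.F).prod}).comap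
    D.partialBos.val.toLinearMap

/-- `Bᵢ = Fᵢ + cᵢ E_{τ(i)} Kᵢ⁻¹`. -/
noncomputable def Bgen (c : Fin n → k) (i : Fin n) : D.U :=
  D.F i + c i • (D.E (D.τ i) * D.Kinv i)

/-- The coideal subalgebra `B_c` generated by `H_θ` and the elements `Bᵢ`. -/
noncomputable def B (c : Fin n → k) : Subalgebra k D.U :=
  D.Htheta ⊔ Algebra.adjoin k (Set.range (D.Bgen c))

/-- Condition (c): the ideal `I` is generated by homogeneous noncommutative polynomials `p`, of
degree `l ∈ ℕⁿ`, such that `π_{0,0} (P_{-l} (p(B₁, …, Bₙ))) = 0`. -/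
def ConditionC (c : Fin n → k) : Prop :=
  ∃ S : Set (NCPoly k n), TwoSidedIdeal.span S = D.I ∧
    ∀ p ∈ S, ∃ l : Fin n → ℕ, p ∈ NCPoly.homog l ∧
      D.proj 0 0 (D.P (fun i => -(l i : ℤ)) (FreeAlgebra.lift k (D.Bgen c) p)) = 0

/-- The subalgebra `U(χ)^poly` generated by `Fᵢ`, `Eᵢ Kᵢ⁻¹`, `Kᵢ⁻¹`, `Kᵢ K_{τ(i)}⁻¹`. -/
noncomputable def Upoly : Subalgebra k D.U :=
  Algebra.adjoin k (Set.range D.F ∪ (Set.range fun i => D.E i * D.Kinv i) ∪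
    Set.range D.Kinv ∪ Set.range fun i => D.K i * D.Kinv (D.τ i))

theorem F_mem_Upoly (i : Fin n) : D.F i ∈ D.Upoly :=
  Algebra.subset_adjoin (Or.inl (Or.inl (Or.inl ⟨i, rfl⟩)))

theorem EKinv_mem_Upoly (i : Fin n) : D.E i * D.Kinv i ∈ D.Upoly :=
  Algebra.subset_adjoin (Or.inl (Or.inl (Or.inr ⟨i, rfl⟩)))

theorem Kinv_mem_Upoly (i : Fin n) : D.Kinv i ∈ D.Upoly :=
  Algebra.subset_adjoin (Or.inl (Or.inr ⟨i, rfl⟩))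

theorem Htheta_le_Upoly : D.Htheta ≤ D.Upoly :=
  Algebra.adjoin_mono Set.subset_union_right

theorem KKinv_mem_Htheta (i j : Fin n) (h : D.τ j = i ∨ D.τ i = j) :
    D.K i * D.Kinv j ∈ D.Htheta := by
  have hij : D.τ i = j := h.elim (fun h => by rw [← h, D.τ_invol]) id
  exact Algebra.subset_adjoin ⟨i, by simp only [hij]⟩

theorem partialBos_le_Upoly : D.partialBos ≤ D.Upoly := by
  refine sup_le D.Htheta_le_Upoly (Algebra.adjoin_le ?_)
  rintro _ ⟨i, rfl⟩
  exact D.F_mem_Upoly i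

theorem B_le_Upoly (c : Fin n → k) : D.B c ≤ D.Upoly := by
  refine sup_le D.Htheta_le_Upoly (Algebra.adjoin_le ?_)
  rintro _ ⟨i, rfl⟩
  refine add_mem (D.F_mem_Upoly i) (Subalgebra.smul_mem _ ?_ _)
  have h : D.E (D.τ i) * D.Kinv i =
      D.E (D.τ i) * D.Kinv (D.τ i) * (D.K (D.τ i) * D.Kinv i) := by
    calc D.E (D.τ i) * D.Kinv i
        = D.E (D.τ i) * (D.Kinv (D.τ i) * D.K (D.τ i)) * D.Kinv i := by
          rw [Kinv_mul_K, mul_one]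
      _ = _ := by simp only [mul_assoc]
  rw [h]
  exact mul_mem (D.EKinv_mem_Upoly _)
    (D.Htheta_le_Upoly (D.KKinv_mem_Htheta _ _ (Or.inl rfl)))

/-- The inclusion `H_θ ⋉ U⁻ → U(χ)^poly`. -/
noncomputable def bosIncl : D.partialBos →ₗ[k] D.Upoly :=
  (Subalgebra.inclusion D.partialBos_le_Upoly).toLinearMap

theorem bosIncl_injective : Function.Injective D.bosIncl :=
  Subalgebra.inclusion_injective D.partialBos_le_Upoly

/-- The left ideal of `U(χ)^poly` generated by all `Eᵢ Kᵢ⁻¹` and `Kᵢ⁻¹`, as a subspace. -/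
noncomputable def psiKer : Submodule k D.Upoly :=
  (Ideal.span ((Set.range fun i => (⟨D.E i * D.Kinv i, D.EKinv_mem_Upoly i⟩ : D.Upoly)) ∪
    Set.range fun i => (⟨D.Kinv i, D.Kinv_mem_Upoly i⟩ : D.Upoly))).restrictScalars k

/-- The linear projection `ψ : U(χ)^poly → H_θ ⋉ U⁻` with respect to the decomposition of
`U(χ)^poly` as the direct sum of `H_θ ⋉ U⁻` and the left ideal generated by all `Eᵢ Kᵢ⁻¹`, `Kᵢ⁻¹`.
(It is set to zero if these two are not complementary.) -/
noncomputable def psi : D.Upoly →ₗ[k] D.partialBos := by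
  classical
  exact if h : IsCompl (LinearMap.range D.bosIncl) D.psiKer then
    LinearMap.linearProjOfIsCompl D.psiKer D.bosIncl D.bosIncl_injective h
  else 0

/-- The restriction `ψ : B_c → H_θ ⋉ U⁻`. -/
noncomputable def psiB (c : Fin n → k) : D.B c →ₗ[k] D.partialBos :=
  D.psi ∘ₗ (Subalgebra.inclusion (D.B_le_Upoly c)).toLinearMap

/-! ### Skew derivations -/

/-- The pair `(∂ᵢᴸ, ∂ᵢᴿ)` of linear endomorphisms of `U⁻` is characterized by
`Eᵢ f - f Eᵢ = Kᵢ ∂ᵢᴸ(f) - ∂ᵢᴿ(f) Kᵢ⁻¹` for all `f ∈ U⁻`. -/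
def IsSkewPair (i : Fin n)
    (d : (D.Uminus →ₗ[k] D.Uminus) × (D.Uminus →ₗ[k] D.Uminus)) : Prop :=
  ∀ f : D.Uminus,
    D.E i * (f : D.U) - (f : D.U) * D.E i = D.K i * (d.1 f : D.U) - (d.2 f : D.U) * D.Kinv i

/-- The skew derivation `∂ᵢᴸ : U⁻ → U⁻`. -/
noncomputable def skewL (i : Fin n) : D.Uminus →ₗ[k] D.Uminus :=
  (Classical.epsilon (D.IsSkewPair i)).1

/-! ### Elements of the partial bosonization -/

/-- The inclusion `U⁻ → H_θ ⋉ U⁻`. -/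
noncomputable def minusIncl : D.Uminus →ₐ[k] D.partialBos :=
  Subalgebra.inclusion le_sup_right

/-- `Fᵢ` as an element of `U⁻`. -/
noncomputable def Fminus (i : Fin n) : D.Uminus :=
  ⟨D.F i, Algebra.subset_adjoin ⟨i, rfl⟩⟩

/-- `K_{τ(i)} Kᵢ⁻¹` as an element of `H_θ ⋉ U⁻`. -/
noncomputable def KKbos (i : Fin n) : D.partialBos :=
  ⟨D.K (D.τ i) * D.Kinv i,
    (le_sup_left : D.Htheta ≤ D.partialBos) (D.KKinv_mem_Htheta _ _ (Or.inl rfl))⟩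

/-- The product `m` on `H_θ ⋉ U⁻` satisfies
`m(Fᵢ, u) = Fᵢ u + cᵢ q_{iτ(i)} K_{τ(i)} Kᵢ⁻¹ ∂_{τ(i)}ᴸ(u)` for all `i` and `u ∈ U⁻`. -/
def HasFirstOrderFormula (c : Fin n → k)
    (m : D.partialBos →ₗ[k] D.partialBos →ₗ[k] D.partialBos) : Prop :=
  ∀ (i : Fin n) (u : D.Uminus),
    m (D.minusIncl (D.Fminus i)) (D.minusIncl u) =
      D.minusIncl (D.Fminus i) * D.minusIncl u +
        (c i * (D.χ.q i (D.τ i) : k)) • (D.KKbos i * D.minusIncl (D.skewL (D.τ i) u))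

end

end Datum

end PreNichols

namespace PreNichols

/-! ## Linear maps on the free algebra -/

open TensorProduct

section FreeAlg

variable {k : Type*} [Field k] {n : ℕ}

namespace NCPoly

/-! Let A = T/I. The triangular decomposition identifies U(χ) with the module A ⊗ N induced from N =
U⁻H, with cyclic vector v corresponding to 1 (`triEquiv`). It follows once the induced module
exists, and for that the decisive point is that I is stable under the skew derivations ∂ᴸ and ∂ᴿ, a
consequence of the biideal property (`dL_mem`, `dR_mem`, `commutator_lift`). A second induced
module, the Verma module, shows that the kernel of ψ meets H_θ ⋉ U⁻ trivially.

In the model A ⊗ N one has Bⱼ = bⱼ - ρⱼ. The main part bⱼ = 1 ⊗ Fⱼ + βⱼ ⊗ Kⱼ⁻¹ (`mainB`) lowers the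
torus degree, and ρⱼ = ∂ⱼᴿ ⊗ Kⱼ (`indRho`) raises it. Here βⱼ = ξⱼ + ηⱼ operates on A, with ξⱼ =
Kⱼ⁻¹∂ⱼᴸ and ηⱼ = cⱼE_{τ(j)}Kⱼ⁻¹.

The heart is that the bⱼ satisfy all relations in I, although the Bⱼ need not. The lowest torus
component of p(B)v is p(b)v, so condition (c) says that p(β)1 has no constant term for the
generators p of I (`counitA_lift_beta_eq_zero`). The braided binomial formula (`lift_add_eq`)
promotes this to p(β) = 0, by induction on the degree. The coproduct of A intertwines βⱼ with βⱼ ⊗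
Kⱼ⁻¹ + K_{τ(j)}Kⱼ⁻¹ ⊗ ηⱼ, and the ηⱼ satisfy the relations, so Δ(p(β)1) = p(β)1 ⊗ w for some w;
applying the counit to the left leg gives p(β)1 = 0. The multiplication of A intertwines 1 ⊗ ξⱼ + βⱼ
⊗ Kⱼ⁻¹ with βⱼ, and the ξⱼ satisfy the relations, so p(β)y = 0 for every y
(`lift_beta_eq_zero_of_counit`). One more binomial expansion gives p(b) = 0.

Hence y(F) ↦ y(b)v is well defined and extends to H_θ ⋉ U⁻. Since ρᵢbⱼ = qᵢⱼ⁻¹bⱼρᵢ +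
δ_{i,τ(j)}cⱼKᵢKⱼ⁻¹ and ρᵢv = 0, the span of the vectors K_μ b_J v, with μ in the lattice of H_θ, is
stable under B_c. As an element u is determined by uv, this yields a surjection from H_θ ⋉ U⁻ onto
B_c (`bosLift_surjective`). Its composition with ψ is the identity up to terms of lower degree, so ψ
is bijective on B_c (`psiB_bijective`).

For the star product, the kernel of ψ is a left ideal, whence ψ(u) * y = ψ(uy)
(`transportMul_eq_psi`). Modulo this kernel E_{τ(i)}Kᵢ⁻¹ acts on U⁻ as a multiple of
K_{τ(i)}Kᵢ⁻¹∂ᴸ_{τ(i)}, which lowers the degree by one; this gives both the formula and the star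
property. Uniqueness is an induction on the degree: Fᵢa equals Fᵢ * a up to lower terms, and
associativity does the rest. -/

theorem monomial_nil : (monomial [] : NCPoly k n) = 1 := by simp [monomial]

theorem monomial_cons (j : Fin n) (J : List (Fin n)) :
    (monomial (j :: J) : NCPoly k n) = FreeAlgebra.ι k j * monomial J := by simp [monomial]

theorem monomial_append (J J' : List (Fin n)) :
    (monomial (J ++ J') : NCPoly k n) = monomial J * monomial J' := by simp [monomial]

theorem lift_monomial {R : Type*} [Ring R] [Algebra k R] (x : Fin n → R) (J : List (Fin n)) :
    FreeAlgebra.lift k x (monomial J) = (J.map x).prod := by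
  simp [monomial, map_list_prod, Function.comp_def]

theorem span_range_monomial :
    Submodule.span k (Set.range (monomial : List (Fin n) → NCPoly k n)) = ⊤ := by
  rw [eq_top_iff]
  have key : ∀ p : NCPoly k n, ∀ x ∈ Submodule.span k (Set.range (monomial (k := k) (n := n))),
      p * x ∈ Submodule.span k (Set.range (monomial (k := k) (n := n))) := by
    intro p
    induction p using FreeAlgebra.induction with
    | grade0 r =>
      intro x hx
      rw [← Algebra.smul_def]
      exact Submodule.smul_mem _ _ hx
    | grade1 j =>
      intro x hx
      induction hx using Submodule.span_induction with
      | mem x hx =>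
        obtain ⟨J, rfl⟩ := hx
        exact Submodule.subset_span ⟨j :: J, monomial_cons j J⟩
      | zero => simp
      | add x y _ _ hx hy => rw [mul_add]; exact add_mem hx hy
      | smul a x _ hx => rw [mul_smul_comm]; exact Submodule.smul_mem _ _ hx
    | mul a b ha hb =>
      intro x hx
      rw [mul_assoc]
      exact ha _ (hb _ hx)
    | add a b ha hb =>
      intro x hx
      rw [add_mul]
      exact add_mem (ha _ hx) (hb _ hx)
  intro p _
  have := key p 1 (Submodule.subset_span ⟨[], monomial_nil⟩)
  rwa [mul_one] at this

theorem induction_monomial {P : NCPoly k n → Prop} (mon : ∀ J, P (monomial J)) (zero : P 0)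
    (add : ∀ x y, P x → P y → P (x + y)) (smul : ∀ (a : k) x, P x → P (a • x)) (p : NCPoly k n) :
    P p := by
  have hp : p ∈ Submodule.span k (Set.range (monomial (k := k) (n := n))) := by
    rw [span_range_monomial]; trivial
  induction hp using Submodule.span_induction with
  | mem x hx => obtain ⟨J, rfl⟩ := hx; exact mon J
  | zero => exact zero
  | add x y _ _ hx hy => exact add x y hx hy
  | smul a x _ hx => exact smul a x hx

/-- A property of noncommutative polynomials that is stable under linear combinations and under
left multiplication with the variables. -/
theorem induction_left {P : NCPoly k n → Prop} (one : P 1) (zero : P 0)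
    (add : ∀ x y, P x → P y → P (x + y)) (smul : ∀ (a : k) x, P x → P (a • x))
    (mul : ∀ j x, P x → P (FreeAlgebra.ι k j * x)) (p : NCPoly k n) : P p := by
  refine induction_monomial (fun J => ?_) zero add smul p
  induction J with
  | nil => rwa [monomial_nil]
  | cons j J ih => rw [monomial_cons]; exact mul j _ ih

theorem linearMap_ext_left {W : Type*} [AddCommGroup W] [Module k W] {f g : NCPoly k n →ₗ[k] W}
    (one : f 1 = g 1) (mul : ∀ j x, f x = g x → f (FreeAlgebra.ι k j * x) =
      g (FreeAlgebra.ι k j * x)) (p : NCPoly k n) : f p = g p :=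
  induction_left (P := fun p => f p = g p) one (by simp)
    (fun x y hx hy => by rw [map_add, map_add, hx, hy])
    (fun a x hx => by rw [map_smul, map_smul, hx]) mul p

/-! ### Weights -/

/-- The weight of a word in `ℤⁿ`. -/
def wt (J : List (Fin n)) : Fin n → ℤ := fun i => (J.count i : ℤ)

theorem wt_nil : wt ([] : List (Fin n)) = 0 := by ext; simp [wt]

theorem wt_cons (j : Fin n) (J : List (Fin n)) : wt (j :: J) = wt J + Pi.single j 1 := by
  ext i
  by_cases h : i = j
  · subst h; simp [wt]
  · simp [wt, h, Ne.symm h]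

theorem sum_wt (J : List (Fin n)) : ∑ i, wt J i = J.length := by
  induction J with
  | nil => simp [wt_nil]
  | cons j J ih => rw [wt_cons]; simp [Finset.sum_add_distrib, ih]

open Classical in
/-- The projection onto the span of the monomials whose weight satisfies `P`. -/
noncomputable def wtProj (P : (Fin n → ℤ) → Prop) : NCPoly k n →ₗ[k] NCPoly k n :=
  (FreeAlgebra.basisFreeMonoid k (Fin n)).constr k fun J =>
    if P (wt (FreeMonoid.toList J)) then monomial (FreeMonoid.toList J) else 0

theorem basisFreeMonoid_ofList (J : List (Fin n)) :
    FreeAlgebra.basisFreeMonoid k (Fin n) (FreeMonoid.ofList J) = monomial J := by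
  simp [FreeAlgebra.basisFreeMonoid, FreeAlgebra.equivMonoidAlgebraFreeMonoid, monomial,
    FreeMonoid.lift_ofList]

open Classical in
theorem wtProj_monomial (P : (Fin n → ℤ) → Prop) (J : List (Fin n)) :
    wtProj P (monomial J : NCPoly k n) = if P (wt J) then monomial J else 0 := by
  rw [wtProj, ← basisFreeMonoid_ofList, Module.Basis.constr_basis, basisFreeMonoid_ofList]
  rfl

theorem wtProj_ι_mul (P : (Fin n → ℤ) → Prop) (j : Fin n) (p : NCPoly k n) :
    wtProj P (FreeAlgebra.ι k j * p) =
      FreeAlgebra.ι k j * wtProj (fun w => P (w + Pi.single j 1)) p := by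
  induction p using induction_monomial with
  | mon J => classical rw [← monomial_cons, wtProj_monomial, wtProj_monomial, wt_cons, mul_ite,
      mul_zero, monomial_cons]
  | zero => simp
  | add x y hx hy => rw [mul_add, map_add, map_add, mul_add, hx, hy]
  | smul a x hx => rw [mul_smul_comm, map_smul, map_smul, mul_smul_comm, hx]

theorem homog_induction {l : Fin n → ℕ} {P : NCPoly k n → Prop} {p : NCPoly k n}
    (hp : p ∈ homog l) (mon : ∀ J, wt J = (fun i => (l i : ℤ)) → P (monomial J)) (zero : P 0)
    (add : ∀ x y, P x → P y → P (x + y)) (smul : ∀ (a : k) x, P x → P (a • x)) : P p := by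
  induction hp using Submodule.span_induction with
  | mem x hx =>
    obtain ⟨J, hJ, rfl⟩ := hx
    exact mon J (by ext i; simp [wt, hJ i])
  | zero => exact zero
  | add x y _ _ hx hy => exact add x y hx hy
  | smul a x _ hx => exact smul a x hx

theorem monomial_mem_homog (J : List (Fin n)) :
    (monomial J : NCPoly k n) ∈ homog fun i => J.count i :=
  Submodule.subset_span ⟨J, fun _ => rfl, rfl⟩

open Classical in
theorem wtProj_of_mem_homog (P : (Fin n → ℤ) → Prop) {l : Fin n → ℕ} {p : NCPoly k n}
    (hp : p ∈ homog l) : wtProj P p = if P (fun i => (l i : ℤ)) then p else 0 := by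
  refine homog_induction (P := fun p => wtProj P p = if P (fun i => (l i : ℤ)) then p else 0) hp
    (fun J hJ => ?_) (by simp) (fun x y hx hy => ?_) (fun a x hx => ?_)
  · rw [wtProj_monomial, hJ]
  · rw [map_add, hx, hy]; split_ifs <;> simp
  · rw [map_smul, hx]; split_ifs <;> simp

/-- The constant coefficient. -/
noncomputable def counit : NCPoly k n →ₐ[k] k := FreeAlgebra.lift k 0

theorem counit_ι (j : Fin n) : counit (FreeAlgebra.ι k j) = 0 := by simp [counit]

theorem counit_monomial (J : List (Fin n)) (hJ : J ≠ []) :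
    counit (monomial J : NCPoly k n) = 0 := by
  cases J with
  | nil => exact absurd rfl hJ
  | cons j J => rw [monomial_cons, map_mul, counit_ι, zero_mul]

/-- The coefficient of the `i`-th variable. -/
noncomputable def linCoeff (i : Fin n) : NCPoly k n →ₗ[k] k :=
  -- Evaluation in the dual numbers: the i-th variable becomes ε and the others 0, so words of
  -- length at least two vanish.
  (TrivSqZeroExt.sndHom k k) ∘ₗ
    (FreeAlgebra.lift k fun j => (TrivSqZeroExt.inr (if i = j then 1 else 0) :
      TrivSqZeroExt k k)).toLinearMap

theorem linCoeff_one (i : Fin n) : linCoeff i (1 : NCPoly k n) = 0 := by simp [linCoeff]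

theorem linCoeff_ι_mul (i j : Fin n) (p : NCPoly k n) :
    linCoeff i (FreeAlgebra.ι k j * p) = if i = j then counit p else 0 := by
  have h : ∀ p : NCPoly k n, TrivSqZeroExt.fst ((FreeAlgebra.lift k fun j =>
      (TrivSqZeroExt.inr (if i = j then 1 else 0) : TrivSqZeroExt k k)) p) = counit p := by
    intro p
    have : (TrivSqZeroExt.fstHom k k k).comp (FreeAlgebra.lift k fun j =>
      (TrivSqZeroExt.inr (if i = j then 1 else 0) : TrivSqZeroExt k k)) = counit := by
      ext j
      simp only [Function.comp_apply, AlgHom.comp_apply, FreeAlgebra.lift_ι_apply, counit_ι]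
      exact TrivSqZeroExt.fst_inr k (if i = j then (1 : k) else 0)
    exact DFunLike.congr_fun this p
  simp only [linCoeff, LinearMap.comp_apply, AlgHom.toLinearMap_apply, map_mul,
    FreeAlgebra.lift_ι_apply, TrivSqZeroExt.sndHom_apply, TrivSqZeroExt.snd_mul,
    TrivSqZeroExt.fst_inr, TrivSqZeroExt.snd_inr, zero_smul, zero_add, h]
  split_ifs <;> simp

theorem linCoeff_eq_zero_of_degGeTwo {p : NCPoly k n} (hp : p ∈ degGeTwo) (i : Fin n) :
    linCoeff i p = 0 := by
  induction hp using Submodule.span_induction with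
  | mem x hx =>
    obtain ⟨J, hJ, rfl⟩ := hx
    match J, hJ with
    | a :: b :: J, _ =>
      rw [monomial_cons, linCoeff_ι_mul, counit_monomial _ (by simp), ite_self]
  | zero => simp
  | add x y _ _ hx hy => rw [map_add, hx, hy, add_zero]
  | smul a x _ hx => rw [map_smul, hx, smul_zero]

theorem counit_eq_zero_of_degGeTwo {p : NCPoly k n} (hp : p ∈ degGeTwo) : counit p = 0 := by
  induction hp using Submodule.span_induction with
  | mem x hx =>
    obtain ⟨J, hJ, rfl⟩ := hx
    exact counit_monomial J (by rintro rfl; simp at hJ)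
  | zero => simp
  | add x y _ _ hx hy => rw [map_add, hx, hy, add_zero]
  | smul a x _ hx => rw [map_smul, hx, smul_zero]

end NCPoly

/-! ### Twists, coproduct and skew derivations -/

namespace SymmBicharacter

variable (χ : SymmBicharacter k n)

open NCPoly

theorem q_symm (i j : Fin n) : χ.q i j = χ.q j i := χ.symm i j

theorem toFun_zero_left (c : Fin n → ℤ) : χ.toFun 0 c = 1 := by
  have := χ.map_add_left 0 0 c
  simpa using this

theorem toFun_neg_left (a c : Fin n → ℤ) : χ.toFun (-a) c = (χ.toFun a c)⁻¹ := by
  rw [eq_inv_iff_mul_eq_one, ← χ.map_add_left, neg_add_cancel, toFun_zero_left]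

/-- The action of `K_a` on the tensor algebra. -/
noncomputable def tw (a : Fin n → ℤ) : NCPoly k n →ₐ[k] NCPoly k n :=
  FreeAlgebra.lift k fun j => (χ.toFun a (Pi.single j 1) : k) • FreeAlgebra.ι k j

theorem act_eq_tw (i : Fin n) : χ.act i = χ.tw (Pi.single i 1) := rfl

theorem tw_ι (a : Fin n → ℤ) (j : Fin n) :
    χ.tw a (FreeAlgebra.ι k j) = (χ.toFun a (Pi.single j 1) : k) • FreeAlgebra.ι k j := by
  simp [tw]

theorem tw_tw (a b : Fin n → ℤ) (p : NCPoly k n) : χ.tw a (χ.tw b p) = χ.tw (a + b) p := by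
  have : (χ.tw a).comp (χ.tw b) = χ.tw (a + b) := by
    ext j
    simp [tw, χ.map_add_left, smul_smul, mul_comm]
  exact DFunLike.congr_fun this p

theorem tw_zero (p : NCPoly k n) : χ.tw 0 p = p := by
  have : χ.tw 0 = AlgHom.id k _ := by
    ext j
    simp [tw, toFun_zero_left]
  exact DFunLike.congr_fun this p

/-- The scalar by which `K_a` acts on a word. -/
noncomputable def twScalar (a : Fin n → ℤ) (J : List (Fin n)) : kˣ :=
  (J.map fun j => χ.toFun a (Pi.single j 1)).prod

theorem tw_monomial (a : Fin n → ℤ) (J : List (Fin n)) :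
    χ.tw a (monomial J) = (χ.twScalar a J : k) • monomial J := by
  induction J with
  | nil => simp [monomial_nil, twScalar]
  | cons j J ih =>
    rw [monomial_cons, map_mul, ih, tw_ι, smul_mul_smul_comm]
    simp [twScalar]

theorem twScalar_perm (a : Fin n → ℤ) {J J' : List (Fin n)} (h : J.Perm J') :
    χ.twScalar a J = χ.twScalar a J' :=
  (h.map _).prod_eq

/-- Words of equal weight are permutations of each other, so `twScalar` is constant on a homogeneous
component. Every l is the weight of some word, but the case split makes it unnecessary to construct
one. -/
theorem exists_tw_eq_smul (a : Fin n → ℤ) (l : Fin n → ℕ) :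
    ∃ s : k, ∀ p : NCPoly k n, p ∈ homog l → χ.tw a p = s • p := by
  by_cases h : ∃ J : List (Fin n), wt J = fun i => (l i : ℤ)
  · obtain ⟨J₀, h₀⟩ := h
    refine ⟨χ.twScalar a J₀, fun p hp => ?_⟩
    refine homog_induction (P := fun p => χ.tw a p = (χ.twScalar a J₀ : k) • p) hp
      (fun J hJ => ?_) (by simp) (fun x y hx hy => ?_) (fun a x hx => ?_)
    · rw [tw_monomial, χ.twScalar_perm a (J := J) (J' := J₀)]
      rw [List.perm_iff_count]
      intro i
      have := congrFun (hJ.trans h₀.symm) i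
      simpa [wt] using this
    · rw [map_add, hx, hy, smul_add]
    · rw [map_smul, hx, smul_comm]
  · refine ⟨1, fun p hp => ?_⟩
    exact homog_induction (P := fun p => χ.tw a p = (1 : k) • p) hp
      (fun J hJ => absurd ⟨J, hJ⟩ h) (by simp)
      (fun x y hx hy => by rw [map_add, hx, hy, smul_add])
      (fun a x hx => by rw [map_smul, hx, smul_comm])

theorem linCoeff_tw (a : Fin n → ℤ) (i : Fin n) (p : NCPoly k n) :
    linCoeff i (χ.tw a p) = (χ.toFun a (Pi.single i 1) : k) * linCoeff i p := by
  have hc : ∀ p, counit (χ.tw a p) = counit p := by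
    intro p
    have : (counit (k := k) (n := n)).comp (χ.tw a) = counit := by
      ext j; simp [tw, counit]
    exact DFunLike.congr_fun this p
  refine linearMap_ext_left (f := linCoeff i ∘ₗ (χ.tw a).toLinearMap)
    (g := (χ.toFun a (Pi.single i 1) : k) • linCoeff i) (by simp [linCoeff_one]) ?_ p
  intro j x _
  simp only [LinearMap.comp_apply, AlgHom.toLinearMap_apply, map_mul, tw_ι, smul_mul_assoc,
    map_smul, linCoeff_ι_mul, LinearMap.smul_apply, hc]
  split_ifs with h
  · rw [h]
  · simp

theorem coproduct_one : χ.coproduct 1 = (1 : NCPoly k n) ⊗ₜ[k] (1 : NCPoly k n) := by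
  simp [coproduct]

theorem coproduct_ι_mul (j : Fin n) (p : NCPoly k n) :
    χ.coproduct (FreeAlgebra.ι k j * p) = χ.primitiveMul j (χ.coproduct p) := by
  simp [coproduct]

theorem primitiveMul_tmul (j : Fin n) (a b : NCPoly k n) :
    χ.primitiveMul j (a ⊗ₜ b) = (FreeAlgebra.ι k j * a) ⊗ₜ b +
      χ.tw (Pi.single j 1) a ⊗ₜ (FreeAlgebra.ι k j * b) := by
  simp [primitiveMul, act_eq_tw]

theorem counit_left (p : NCPoly k n) :
    TensorProduct.lid k _ (TensorProduct.map counit.toLinearMap LinearMap.id (χ.coproduct p)) =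
      p := by
  refine linearMap_ext_left (f := (TensorProduct.lid k _).toLinearMap ∘ₗ
    TensorProduct.map counit.toLinearMap LinearMap.id ∘ₗ χ.coproduct) (g := LinearMap.id)
    (by simp [coproduct_one]) ?_ p
  intro j x hx
  simp only [LinearMap.comp_apply, LinearEquiv.coe_coe, LinearMap.id_apply] at hx ⊢
  rw [coproduct_ι_mul]
  conv_rhs => rw [← hx]
  generalize χ.coproduct x = t
  have hc : ∀ p, counit (χ.tw (Pi.single j 1) p) = counit p := by
    intro p
    have : (counit (k := k) (n := n)).comp (χ.tw (Pi.single j 1)) = counit := by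
      ext j; simp [tw, counit]
    exact DFunLike.congr_fun this p
  induction t with
  | zero => simp
  | tmul a b => simp [primitiveMul_tmul, counit_ι, hc]
  | add a b ha hb => rw [map_add, map_add, map_add, ha, hb, map_add, map_add, mul_add]

theorem counit_right (p : NCPoly k n) :
    TensorProduct.rid k _ (TensorProduct.map LinearMap.id counit.toLinearMap (χ.coproduct p)) =
      p := by
  refine linearMap_ext_left (f := (TensorProduct.rid k _).toLinearMap ∘ₗ
    TensorProduct.map LinearMap.id counit.toLinearMap ∘ₗ χ.coproduct) (g := LinearMap.id)
    (by simp [coproduct_one]) ?_ p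
  intro j x hx
  simp only [LinearMap.comp_apply, LinearEquiv.coe_coe, LinearMap.id_apply] at hx ⊢
  rw [coproduct_ι_mul]
  conv_rhs => rw [← hx]
  generalize χ.coproduct x = t
  induction t with
  | zero => simp
  | tmul a b => simp [primitiveMul_tmul, counit_ι]
  | add a b ha hb => rw [map_add, map_add, map_add, ha, hb, map_add, map_add, mul_add]

/-- The skew derivation `∂ᵢᴸ` of the tensor algebra. -/
noncomputable def dL (i : Fin n) : NCPoly k n →ₗ[k] NCPoly k n :=
  (TensorProduct.lid k _).toLinearMap ∘ₗ
    TensorProduct.map (linCoeff i) LinearMap.id ∘ₗ χ.coproduct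

/-- The skew derivation `∂ᵢᴿ` of the tensor algebra. -/
noncomputable def dR (i : Fin n) : NCPoly k n →ₗ[k] NCPoly k n :=
  (TensorProduct.rid k _).toLinearMap ∘ₗ
    TensorProduct.map LinearMap.id (linCoeff i) ∘ₗ χ.coproduct

theorem dL_one (i : Fin n) : χ.dL i 1 = 0 := by simp [dL, coproduct_one, linCoeff_one]

theorem dR_one (i : Fin n) : χ.dR i 1 = 0 := by simp [dR, coproduct_one, linCoeff_one]

/-- In Δ(xⱼp) = (xⱼ ⊗ 1 + 1 ⊗ xⱼ)Δ(p) the first summand contributes only through the counit of the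
left leg, which restores p; in the second the action of Kⱼ on the left leg becomes the factor q, by
symmetry of q. -/
theorem dL_ι_mul (i j : Fin n) (p : NCPoly k n) :
    χ.dL i (FreeAlgebra.ι k j * p) = (if i = j then p else 0) +
      (χ.q i j : k) • (FreeAlgebra.ι k j * χ.dL i p) := by
  have key : ∀ t, TensorProduct.lid k _ (TensorProduct.map (linCoeff i) LinearMap.id
      (χ.primitiveMul j t)) = (if i = j then TensorProduct.lid k _
        (TensorProduct.map counit.toLinearMap LinearMap.id t) else 0) +
      (χ.q i j : k) • (FreeAlgebra.ι k j * TensorProduct.lid k _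
        (TensorProduct.map (linCoeff i) LinearMap.id t)) := by
    intro t
    induction t with
    | zero => simp
    | tmul a b =>
      have hq : χ.toFun (Pi.single j 1) (Pi.single i 1) = χ.q i j := χ.symm j i
      simp only [primitiveMul_tmul, map_add, TensorProduct.map_tmul, TensorProduct.lid_tmul,
        linCoeff_ι_mul, linCoeff_tw, hq, LinearMap.id_apply, AlgHom.toLinearMap_apply,
        mul_smul_comm, smul_smul, ite_smul, zero_smul]
    | add a b ha hb =>
      rw [map_add, map_add, map_add, ha, hb]
      simp only [map_add, mul_add, smul_add]
      split_ifs
      · abel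
      · abel
  have := key (χ.coproduct p)
  rw [counit_left] at this
  simpa [dL, coproduct_ι_mul] using this

/-- As for `dL_ι_mul`, but now the left leg survives, so the action of Kⱼ remains as a twist of p
instead of becoming a scalar. -/
theorem dR_ι_mul (i j : Fin n) (p : NCPoly k n) :
    χ.dR i (FreeAlgebra.ι k j * p) = FreeAlgebra.ι k j * χ.dR i p +
      (if i = j then χ.tw (Pi.single i 1) p else 0) := by
  have key : ∀ t, TensorProduct.rid k _ (TensorProduct.map LinearMap.id (linCoeff i)
      (χ.primitiveMul j t)) = FreeAlgebra.ι k j * TensorProduct.rid k _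
        (TensorProduct.map LinearMap.id (linCoeff i) t) +
      (if i = j then χ.tw (Pi.single i 1) (TensorProduct.rid k _
        (TensorProduct.map LinearMap.id counit.toLinearMap t)) else 0) := by
    intro t
    induction t with
    | zero => simp
    | tmul a b =>
      simp only [primitiveMul_tmul, map_add, TensorProduct.map_tmul, TensorProduct.rid_tmul,
        linCoeff_ι_mul, LinearMap.id_apply, AlgHom.toLinearMap_apply,
        mul_smul_comm, map_smul, ite_smul, zero_smul]
      split_ifs with h
      · rw [h]
      · rfl
    | add a b ha hb =>
      rw [map_add, map_add, map_add, ha, hb]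
      simp only [map_add, mul_add]
      split_ifs
      · abel
      · abel
  have := key (χ.coproduct p)
  rw [counit_right] at this
  simpa [dR, coproduct_ι_mul] using this

theorem dL_tw (i : Fin n) (a : Fin n → ℤ) (p : NCPoly k n) :
    χ.dL i (χ.tw a p) = (χ.toFun a (Pi.single i 1) : k) • χ.tw a (χ.dL i p) := by
  refine linearMap_ext_left (f := χ.dL i ∘ₗ (χ.tw a).toLinearMap)
    (g := (χ.toFun a (Pi.single i 1) : k) • (χ.tw a).toLinearMap ∘ₗ χ.dL i)
    (by simp [dL_one]) ?_ p
  intro j x hx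
  simp only [LinearMap.comp_apply, AlgHom.toLinearMap_apply, LinearMap.smul_apply] at hx ⊢
  rw [map_mul, tw_ι, smul_mul_assoc, map_smul, dL_ι_mul, dL_ι_mul, hx, map_add, map_smul, map_mul,
    tw_ι]
  simp only [smul_add, smul_mul_assoc, mul_smul_comm, smul_smul]
  congr 1
  · split_ifs with h
    · rw [h]
    · simp
  · congr 1; ring

theorem dR_tw (i : Fin n) (a : Fin n → ℤ) (p : NCPoly k n) :
    χ.dR i (χ.tw a p) = (χ.toFun a (Pi.single i 1) : k) • χ.tw a (χ.dR i p) := by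
  refine linearMap_ext_left (f := χ.dR i ∘ₗ (χ.tw a).toLinearMap)
    (g := (χ.toFun a (Pi.single i 1) : k) • (χ.tw a).toLinearMap ∘ₗ χ.dR i)
    (by simp [dR_one]) ?_ p
  intro j x hx
  simp only [LinearMap.comp_apply, AlgHom.toLinearMap_apply, LinearMap.smul_apply] at hx ⊢
  rw [map_mul, tw_ι, smul_mul_assoc, map_smul, dR_ι_mul, dR_ι_mul, hx, map_add, map_mul,
    tw_ι]
  simp only [smul_add, smul_mul_assoc, mul_smul_comm, smul_smul]
  congr 1
  · rw [mul_comm]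
  · split_ifs with h
    · rw [h, tw_tw, tw_tw, add_comm]
    · simp

/-- The two derivations strip a variable from opposite ends of the coproduct. This is what lets the
raising part of `Bⱼ` pass the summand `xi` of `beta`. -/
theorem dL_dR (i j : Fin n) (p : NCPoly k n) : χ.dL i (χ.dR j p) = χ.dR j (χ.dL i p) := by
  refine linearMap_ext_left (f := χ.dL i ∘ₗ χ.dR j) (g := χ.dR j ∘ₗ χ.dL i)
    (by simp [dL_one, dR_one]) ?_ p
  intro m x hx
  simp only [LinearMap.comp_apply] at hx ⊢
  rw [dR_ι_mul, map_add, dL_ι_mul, dL_ι_mul, map_add, map_smul, dR_ι_mul, hx]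
  by_cases h1 : i = m <;> by_cases h2 : j = m
  · subst h1; subst h2
    simp only [if_true, dL_tw, smul_add, add_assoc]
    rfl
  · simp [h1, h2]
  · subst h2
    have hq : χ.toFun (Pi.single j 1) (Pi.single i 1) = χ.q i j := χ.symm j i
    simp only [h1, if_true, if_false, dL_tw, smul_add, map_zero, zero_add, hq]
  · simp [h1, h2]

theorem coproduct_tw (a : Fin n → ℤ) (p : NCPoly k n) :
    χ.coproduct (χ.tw a p) =
      TensorProduct.map (χ.tw a).toLinearMap (χ.tw a).toLinearMap (χ.coproduct p) := by
  refine linearMap_ext_left (f := χ.coproduct ∘ₗ (χ.tw a).toLinearMap)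
    (g := TensorProduct.map (χ.tw a).toLinearMap (χ.tw a).toLinearMap ∘ₗ χ.coproduct)
    (by simp [coproduct_one]) ?_ p
  intro j x hx
  simp only [LinearMap.comp_apply, AlgHom.toLinearMap_apply] at hx ⊢
  rw [map_mul, tw_ι, smul_mul_assoc, map_smul, coproduct_ι_mul, coproduct_ι_mul, hx]
  generalize χ.coproduct x = t
  induction t with
  | zero => simp
  | tmul b c =>
    simp [primitiveMul_tmul, tw_ι, tw_tw, add_comm, TensorProduct.smul_tmul']
  | add b c hb hc => simp only [map_add, smul_add, hb, hc]

/-- A consequence of coassociativity, obtained here from the recursions alone. It determines how the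
coproduct intertwines the operators `xi`. -/
theorem coproduct_dL (i : Fin n) (p : NCPoly k n) :
    χ.coproduct (χ.dL i p) = TensorProduct.map (χ.dL i) LinearMap.id (χ.coproduct p) := by
  refine linearMap_ext_left (f := χ.coproduct ∘ₗ χ.dL i)
    (g := TensorProduct.map (χ.dL i) LinearMap.id ∘ₗ χ.coproduct)
    (by simp [coproduct_one, dL_one]) ?_ p
  intro j x hx
  simp only [LinearMap.comp_apply] at hx ⊢
  rw [dL_ι_mul, map_add, map_smul, coproduct_ι_mul, coproduct_ι_mul, hx]
  have hq : χ.toFun (Pi.single j 1) (Pi.single i 1) = χ.q i j := χ.symm j i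
  have key : ∀ t, (if i = j then t else 0) +
      (χ.q i j : k) • χ.primitiveMul j (TensorProduct.map (χ.dL i) LinearMap.id t) =
      TensorProduct.map (χ.dL i) LinearMap.id (χ.primitiveMul j t) := by
    intro t
    induction t with
    | zero => simp
    | tmul b c =>
      simp only [primitiveMul_tmul, TensorProduct.map_tmul, map_add, dL_ι_mul, dL_tw, hq,
        TensorProduct.add_tmul, TensorProduct.smul_tmul', LinearMap.id_apply, smul_add]
      split_ifs
      · abel
      · simp
    | add b c hb hc =>
      rw [map_add, map_add, map_add, map_add, ← hb, ← hc, smul_add]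
      split_ifs
      · abel
      · abel
  rw [← key]
  split_ifs <;> simp

end SymmBicharacter

end FreeAlg

end PreNichols

namespace PreNichols

/-! ## Evaluating noncommutative polynomials at skew commuting elements -/

open TensorProduct

section Evaluation

variable {k : Type*} [Field k] {n : ℕ}

open NCPoly

/-! ### Evaluation at products of skew commuting elements. -/

section Twist

variable {R : Type*} [Ring R] [Algebra k R]

/-- The correction factor in the evaluation of a word at the products `aⱼ tⱼ`. -/
def twistFactor (t : Fin n → R) (u : Fin n → Fin n → k) : List (Fin n) → R
  | [] => 1
  | j :: J => (J.map (u j)).prod • (t j * twistFactor t u J)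

theorem twistFactor_perm {t : Fin n → R} {u : Fin n → Fin n → k} (hu : ∀ i j, u i j = u j i)
    (ht : ∀ i j, t i * t j = t j * t i) {J J' : List (Fin n)} (h : J.Perm J') :
    twistFactor t u J = twistFactor t u J' := by
  induction h with
  | nil => rfl
  | cons x h ih => rw [twistFactor, twistFactor, ih, (h.map _).prod_eq]
  | swap x y J =>
    simp only [twistFactor, List.map_cons, List.prod_cons, mul_smul_comm, smul_smul, ← mul_assoc,
      ht y x, hu y x]
    congr 1
    ring
  | trans _ _ h1 h2 => rw [h1, h2]

theorem mul_list_prod_comm {a : Fin n → R} {x : R} {u : Fin n → k}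
    (h : ∀ j, x * a j = u j • (a j * x)) (J : List (Fin n)) :
    x * (J.map a).prod = (J.map u).prod • ((J.map a).prod * x) := by
  induction J with
  | nil => simp
  | cons j J ih =>
    simp only [List.map_cons, List.prod_cons]
    rw [← mul_assoc, h, smul_mul_assoc, mul_assoc, ih, mul_smul_comm, smul_smul, mul_assoc]

theorem lift_mul_monomial {a t : Fin n → R} {u : Fin n → Fin n → k}
    (h : ∀ i j, t i * a j = u i j • (a j * t i)) (J : List (Fin n)) :
    FreeAlgebra.lift k (fun j => a j * t j) (monomial J) =
      FreeAlgebra.lift k a (monomial J) * twistFactor t u J := by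
  induction J with
  | nil => simp [monomial_nil, twistFactor]
  | cons j J ih =>
    rw [monomial_cons, map_mul, map_mul, ih, FreeAlgebra.lift_ι_apply, FreeAlgebra.lift_ι_apply,
      twistFactor, mul_assoc, ← mul_assoc (t j), lift_monomial, mul_list_prod_comm (h j)]
    simp only [smul_mul_assoc, mul_smul_comm, mul_assoc]

/-- Evaluating a homogeneous noncommutative polynomial at products `aⱼ tⱼ`, where the `tⱼ` skew
commute with the `aⱼ`. -/
theorem exists_lift_mul_eq {a t : Fin n → R} {u : Fin n → Fin n → k}
    (hu : ∀ i j, u i j = u j i) (ht : ∀ i j, t i * t j = t j * t i)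
    (h : ∀ i j, t i * a j = u i j • (a j * t i)) (l : Fin n → ℕ) :
    ∃ w : R, ∀ p : NCPoly k n, p ∈ homog l →
      FreeAlgebra.lift k (fun j => a j * t j) p = FreeAlgebra.lift k a p * w := by
  by_cases hl : ∃ J : List (Fin n), wt J = fun i => (l i : ℤ)
  · obtain ⟨J₀, h₀⟩ := hl
    refine ⟨twistFactor t u J₀, fun p hp => ?_⟩
    refine homog_induction (P := fun p => FreeAlgebra.lift k (fun j => a j * t j) p =
      FreeAlgebra.lift k a p * twistFactor t u J₀) hp
      (fun J hJ => ?_) (by simp) (fun x y hx hy => ?_) (fun a x hx => ?_)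
    · rw [lift_mul_monomial h, twistFactor_perm hu ht (J := J) (J' := J₀)]
      rw [List.perm_iff_count]
      intro i
      have := congrFun (hJ.trans h₀.symm) i
      simpa [wt] using this
    · rw [map_add, hx, hy, map_add, add_mul]
    · rw [map_smul, hx, map_smul, smul_mul_assoc]
  · refine ⟨1, fun p hp => ?_⟩
    exact homog_induction (P := fun p => FreeAlgebra.lift k (fun j => a j * t j) p =
      FreeAlgebra.lift k a p * 1) hp (fun J hJ => absurd ⟨J, hJ⟩ hl) (by simp)
      (fun x y hx hy => by rw [map_add, hx, hy, map_add, add_mul])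
      (fun a x hx => by rw [map_smul, hx, map_smul, smul_mul_assoc])

end Twist

/-! ### The braided binomial formula and commutators. -/

namespace SymmBicharacter

variable (χ : SymmBicharacter k n) {R : Type*} [Ring R] [Algebra k R]

theorem mul_lift_comm {a : Fin n → ℤ} {Z : Fin n → R} {x : R}
    (h : ∀ j, x * Z j = (χ.toFun a (Pi.single j 1) : k) • (Z j * x)) (p : NCPoly k n) :
    x * FreeAlgebra.lift k Z p = FreeAlgebra.lift k Z (χ.tw a p) * x := by
  refine induction_left (P := fun p => x * FreeAlgebra.lift k Z p =
    FreeAlgebra.lift k Z (χ.tw a p) * x) (by simp) (by simp) (fun y z hy hz => ?_)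
    (fun s y hy => ?_) (fun j y hy => ?_) p
  · simp only [map_add, mul_add, add_mul, hy, hz]
  · simp only [map_smul, mul_smul_comm, smul_mul_assoc, hy]
  · simp only [map_mul, tw_ι, map_smul, FreeAlgebra.lift_ι_apply, smul_mul_assoc]
    rw [← mul_assoc, h, smul_mul_assoc, mul_assoc, hy, mul_assoc]

/-- The linear map `a ⊗ b ↦ a(Z) b(X)`. -/
noncomputable def evalTensor (Z X : Fin n → R) : NCPoly k n ⊗[k] NCPoly k n →ₗ[k] R :=
  TensorProduct.lift ((LinearMap.mul k R).compl₁₂ (FreeAlgebra.lift k Z).toLinearMap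
    (FreeAlgebra.lift k X).toLinearMap)

theorem evalTensor_tmul (Z X : Fin n → R) (a b : NCPoly k n) :
    evalTensor Z X (a ⊗ₜ b) = FreeAlgebra.lift k Z a * FreeAlgebra.lift k X b := rfl

/-- The braided binomial formula. -/
theorem lift_add_eq {Z X : Fin n → R}
    (h : ∀ i j, X i * Z j = (χ.q i j : k) • (Z j * X i)) (p : NCPoly k n) :
    FreeAlgebra.lift k (fun j => Z j + X j) p = evalTensor Z X (χ.coproduct p) := by
  refine linearMap_ext_left (f := (FreeAlgebra.lift k (fun j => Z j + X j)).toLinearMap)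
    (g := evalTensor Z X ∘ₗ χ.coproduct) (by simp [coproduct_one, evalTensor_tmul]) ?_ p
  intro j x hx
  simp only [LinearMap.comp_apply, AlgHom.toLinearMap_apply] at hx ⊢
  rw [map_mul, hx, FreeAlgebra.lift_ι_apply, coproduct_ι_mul]
  generalize χ.coproduct x = t
  induction t with
  | zero => simp
  | tmul a b =>
    rw [primitiveMul_tmul, map_add, evalTensor_tmul, evalTensor_tmul, evalTensor_tmul, add_mul,
      map_mul, map_mul, FreeAlgebra.lift_ι_apply, FreeAlgebra.lift_ι_apply, mul_assoc,
      ← mul_assoc (X j), χ.mul_lift_comm (a := Pi.single j 1) (h j), mul_assoc]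
  | add a b ha hb => rw [map_add, mul_add, ha, hb, map_add, map_add]

/-- The commutator of `Eᵢ` with a polynomial in the `Fⱼ`. -/
theorem commutator_lift {i : Fin n} {E K L : R} {F : Fin n → R}
    (hK : ∀ j, F j * K = (χ.q i j : k) • (K * F j))
    (hL : ∀ j, L * F j = (χ.q i j : k) • (F j * L))
    (hE : ∀ j, E * F j - F j * E = if i = j then K - L else 0) (p : NCPoly k n) :
    E * FreeAlgebra.lift k F p - FreeAlgebra.lift k F p * E =
      K * FreeAlgebra.lift k F (χ.dL i p) - FreeAlgebra.lift k F (χ.dR i p) * L := by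
  refine induction_left (P := fun p => E * FreeAlgebra.lift k F p - FreeAlgebra.lift k F p * E =
      K * FreeAlgebra.lift k F (χ.dL i p) - FreeAlgebra.lift k F (χ.dR i p) * L)
    (by simp [dL_one, dR_one]) (by simp) (fun y z hy hz => ?_)
    (fun s y hy => ?_) (fun j y hy => ?_) p
  · simp only [map_add, mul_add, add_mul, add_sub_add_comm, hy, hz]
  · simp only [map_smul, mul_smul_comm, smul_mul_assoc, ← smul_sub, hy]
  · have h1 : E * F j = F j * E + if i = j then K - L else 0 := by rw [← hE j]; abel
    have h2 : E * FreeAlgebra.lift k F y = FreeAlgebra.lift k F y * E +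
      (K * FreeAlgebra.lift k F (χ.dL i y) - FreeAlgebra.lift k F (χ.dR i y) * L) := by
      rw [← hy]; abel
    have h3 : L * FreeAlgebra.lift k F y = FreeAlgebra.lift k F (χ.tw (Pi.single i 1) y) * L :=
      χ.mul_lift_comm (fun j => hL j) y
    rw [dL_ι_mul, dR_ι_mul]
    simp only [map_mul, map_add, map_smul, FreeAlgebra.lift_ι_apply]
    rw [← mul_assoc, h1, add_mul, mul_assoc, h2, mul_add, mul_sub, ← mul_assoc (F j) K, hK]
    by_cases hij : i = j
    · subst hij
      simp only [if_true, sub_mul, mul_add, add_mul, h3, smul_mul_assoc, mul_smul_comm, mul_assoc]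
      abel
    · simp only [hij, if_false, map_zero, zero_mul, zero_add, add_zero, smul_mul_assoc,
        mul_smul_comm, mul_assoc]
      abel

/-! ### Leading terms of the coproduct -/

/-- Expanding the product of the primitive factors, each letter goes to one of the two legs; only
the term with all letters on the left has a left leg of full length. -/
theorem coproduct_monomial_left (J : List (Fin n)) :
    χ.coproduct (monomial J) - monomial J ⊗ₜ 1 ∈ Submodule.span k
      {t | ∃ J' b, J'.length < J.length ∧ t = monomial J' ⊗ₜ[k] b} := by
  induction J with
  | nil => simp [monomial_nil, coproduct_one]
  | cons j J ih =>
    have key : ∀ t ∈ Submodule.span k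
        {t | ∃ J' b, J'.length < J.length ∧ t = (monomial J' : NCPoly k n) ⊗ₜ[k] b},
        χ.primitiveMul j t ∈ Submodule.span k
        {t | ∃ J' b, J'.length < (j :: J).length ∧ t = (monomial J' : NCPoly k n) ⊗ₜ[k] b} := by
      intro t ht
      induction ht using Submodule.span_induction with
      | mem x hx =>
        obtain ⟨J', b, hJ', rfl⟩ := hx
        rw [primitiveMul_tmul, tw_monomial, ← monomial_cons, ← TensorProduct.smul_tmul']
        refine add_mem (Submodule.subset_span ⟨_, b, by simpa using hJ', rfl⟩)
          (Submodule.smul_mem _ _ (Submodule.subset_span ⟨_, _, ?_, rfl⟩))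
        exact hJ'.trans (by simp)
      | zero => simp
      | add x y _ _ hx hy => rw [map_add]; exact add_mem hx hy
      | smul a x _ hx => rw [map_smul]; exact Submodule.smul_mem _ _ hx
    have h := key _ ih
    rw [map_sub, ← coproduct_ι_mul, ← monomial_cons, primitiveMul_tmul, ← monomial_cons,
      tw_monomial, ← TensorProduct.smul_tmul', ← sub_sub] at h
    refine (Submodule.sub_mem_iff_left _ ?_).1 h
    exact Submodule.smul_mem _ _ (Submodule.subset_span ⟨J, _, by simp, rfl⟩)

theorem coproduct_monomial_right (J : List (Fin n)) :
    χ.coproduct (monomial J) - 1 ⊗ₜ monomial J ∈ Submodule.span k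
      {t | ∃ b J', J'.length < J.length ∧ t = b ⊗ₜ[k] monomial J'} := by
  induction J with
  | nil => simp [monomial_nil, coproduct_one]
  | cons j J ih =>
    have key : ∀ t ∈ Submodule.span k
        {t | ∃ b J', J'.length < J.length ∧ t = b ⊗ₜ[k] (monomial J' : NCPoly k n)},
        χ.primitiveMul j t ∈ Submodule.span k
        {t | ∃ b J', J'.length < (j :: J).length ∧ t = b ⊗ₜ[k] (monomial J' : NCPoly k n)} := by
      intro t ht
      induction ht using Submodule.span_induction with
      | mem x hx =>
        obtain ⟨b, J', hJ', rfl⟩ := hx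
        rw [primitiveMul_tmul, ← monomial_cons]
        exact add_mem (Submodule.subset_span ⟨_, _, hJ'.trans (by simp), rfl⟩)
          (Submodule.subset_span ⟨_, _, by simpa using hJ', rfl⟩)
      | zero => simp
      | add x y _ _ hx hy => rw [map_add]; exact add_mem hx hy
      | smul a x _ hx => rw [map_smul]; exact Submodule.smul_mem _ _ hx
    have h := key _ ih
    rw [map_sub, ← coproduct_ι_mul, ← monomial_cons, primitiveMul_tmul, ← monomial_cons,
      map_one, add_comm, ← sub_sub] at h
    refine (Submodule.sub_mem_iff_left _ ?_).1 h
    exact Submodule.subset_span ⟨_, J, by simp, rfl⟩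

/-- The remainder is written as a fixed linear map applied to the whole coproduct, not as an
unspecified sum of shorter terms. In this form the coideal property of I still applies to it. -/
theorem coproduct_homog_left {l : Fin n → ℕ} {p : NCPoly k n} (hp : p ∈ homog l) :
    χ.coproduct p = p ⊗ₜ 1 + TensorProduct.map
      (wtProj fun w => ∑ i, w i < ((∑ i, l i : ℕ) : ℤ)) LinearMap.id (χ.coproduct p) := by
  refine homog_induction (P := fun p => χ.coproduct p = p ⊗ₜ 1 + TensorProduct.map
      (wtProj fun w => ∑ i, w i < ((∑ i, l i : ℕ) : ℤ)) LinearMap.id (χ.coproduct p)) hp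
    (fun J hJ => ?_) (by simp) (fun x y hx hy => ?_) (fun a x hx => ?_)
  · have hl : ((∑ i, l i : ℕ) : ℤ) = J.length := by rw [← sum_wt, hJ]; push_cast; rfl
    rw [hl]
    have key : ∀ t ∈ Submodule.span k
        {t | ∃ J' b, J'.length < J.length ∧ t = (monomial J' : NCPoly k n) ⊗ₜ[k] b},
        TensorProduct.map (wtProj fun w => ∑ i, w i < (J.length : ℤ))
          (LinearMap.id : NCPoly k n →ₗ[k] NCPoly k n) t = t := by
      intro t ht
      induction ht using Submodule.span_induction with
      | mem x hx =>
        obtain ⟨J', b, hJ', rfl⟩ := hx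
        rw [TensorProduct.map_tmul, wtProj_monomial, sum_wt, if_pos (by exact_mod_cast hJ')]
        rfl
      | zero => simp
      | add x y _ _ hx hy => rw [map_add, hx, hy]
      | smul a x _ hx => rw [map_smul, hx]
    have h := key _ (χ.coproduct_monomial_left J)
    rw [map_sub, TensorProduct.map_tmul, wtProj_monomial, sum_wt, if_neg (lt_irrefl _),
      TensorProduct.zero_tmul, sub_zero] at h
    rw [h]
    abel
  · conv_lhs => rw [map_add, hx, hy]
    rw [map_add, map_add, TensorProduct.add_tmul]
    abel
  · conv_lhs => rw [map_smul, hx]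
    rw [map_smul, map_smul, smul_add, TensorProduct.smul_tmul']

theorem coproduct_homog_right {l : Fin n → ℕ} {p : NCPoly k n} (hp : p ∈ homog l) :
    χ.coproduct p = 1 ⊗ₜ p + TensorProduct.map LinearMap.id
      (wtProj fun w => ∑ i, w i < ((∑ i, l i : ℕ) : ℤ)) (χ.coproduct p) := by
  refine homog_induction (P := fun p => χ.coproduct p = 1 ⊗ₜ p + TensorProduct.map LinearMap.id
      (wtProj fun w => ∑ i, w i < ((∑ i, l i : ℕ) : ℤ)) (χ.coproduct p)) hp
    (fun J hJ => ?_) (by simp) (fun x y hx hy => ?_) (fun a x hx => ?_)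
  · have hl : ((∑ i, l i : ℕ) : ℤ) = J.length := by rw [← sum_wt, hJ]; push_cast; rfl
    rw [hl]
    have key : ∀ t ∈ Submodule.span k
        {t | ∃ b J', J'.length < J.length ∧ t = b ⊗ₜ[k] (monomial J' : NCPoly k n)},
        TensorProduct.map (LinearMap.id : NCPoly k n →ₗ[k] NCPoly k n)
          (wtProj fun w => ∑ i, w i < (J.length : ℤ)) t = t := by
      intro t ht
      induction ht using Submodule.span_induction with
      | mem x hx =>
        obtain ⟨b, J', hJ', rfl⟩ := hx
        rw [TensorProduct.map_tmul, wtProj_monomial, sum_wt, if_pos (by exact_mod_cast hJ')]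
        rfl
      | zero => simp
      | add x y _ _ hx hy => rw [map_add, hx, hy]
      | smul a x _ hx => rw [map_smul, hx]
    have h := key _ (χ.coproduct_monomial_right J)
    rw [map_sub, TensorProduct.map_tmul, wtProj_monomial, sum_wt, if_neg (lt_irrefl _),
      TensorProduct.tmul_zero, sub_zero] at h
    rw [h]
    abel
  · conv_lhs => rw [map_add, hx, hy]
    rw [map_add, map_add, TensorProduct.tmul_add]
    abel
  · conv_lhs => rw [map_smul, hx]
    rw [map_smul, map_smul, smul_add, TensorProduct.tmul_smul]

end SymmBicharacter

/-! ### Graded biideals -/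

namespace SymmBicharacter.IsPreNicholsIdeal

variable {χ : SymmBicharacter k n} {I : TwoSidedIdeal (NCPoly k n)}

theorem graded_induction (hI : χ.IsPreNicholsIdeal I) {P : NCPoly k n → Prop} {p : NCPoly k n}
    (hp : p ∈ I) (hom : ∀ l, ∀ x ∈ I, x ∈ homog l → P x) (zero : P 0)
    (add : ∀ x y, P x → P y → P (x + y)) : P p := by
  have h : p ∈ ⨆ l : Fin n → ℕ, idealSubmodule I ⊓ homog l :=
    hI.graded (TwoSidedIdeal.mem_asIdeal.2 hp)
  exact Submodule.iSup_induction _ (motive := P) h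
    (fun l x hx => hom l x (TwoSidedIdeal.mem_asIdeal.1 hx.1) hx.2) zero add

theorem smul_mem (a : k) {p : NCPoly k n} (hp : p ∈ I) : a • p ∈ I := by
  rw [Algebra.smul_def]
  exact I.mul_mem_left _ _ hp

theorem tw_mem (hI : χ.IsPreNicholsIdeal I) (a : Fin n → ℤ) {p : NCPoly k n} (hp : p ∈ I) :
    χ.tw a p ∈ I := by
  refine hI.graded_induction (P := fun p => χ.tw a p ∈ I) hp (fun l x hx hl => ?_) ?_
    (fun x y hx hy => ?_)
  · obtain ⟨s, hs⟩ := χ.exists_tw_eq_smul a l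
    rw [hs x hl]
    exact smul_mem s hx
  · rw [map_zero]; exact I.zero_mem
  · rw [map_add]; exact I.add_mem hx hy

theorem wtProj_mem (hI : χ.IsPreNicholsIdeal I) (Q : (Fin n → ℤ) → Prop) {p : NCPoly k n}
    (hp : p ∈ I) : wtProj Q p ∈ I := by
  refine hI.graded_induction (P := fun p => wtProj Q p ∈ I) hp (fun l x hx hl => ?_) ?_
    (fun x y hx hy => ?_)
  · rw [wtProj_of_mem_homog _ hl]
    split_ifs
    · exact hx
    · exact I.zero_mem
  · rw [map_zero]; exact I.zero_mem
  · rw [map_add]; exact I.add_mem hx hy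

/-- The dual form of the coideal condition, in which it is used throughout: a linear map that kills
I ⊗ T and T ⊗ I kills Δ(I). -/
theorem coproduct_eq_zero (hI : χ.IsPreNicholsIdeal I) {W : Type*} [AddCommGroup W] [Module k W]
    {f : NCPoly k n ⊗[k] NCPoly k n →ₗ[k] W} (hl : ∀ a ∈ I, ∀ b, f (a ⊗ₜ b) = 0)
    (hr : ∀ a, ∀ b ∈ I, f (a ⊗ₜ b) = 0) {p : NCPoly k n} (hp : p ∈ I) :
    f (χ.coproduct p) = 0 := by
  have h := hI.coideal p hp
  suffices hle : LinearMap.range (TensorProduct.map (idealSubmodule I).subtype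
      (LinearMap.id : NCPoly k n →ₗ[k] NCPoly k n)) ⊔
      LinearMap.range (TensorProduct.map (LinearMap.id : NCPoly k n →ₗ[k] NCPoly k n)
      (idealSubmodule I).subtype) ≤ LinearMap.ker f from hle h
  refine sup_le ?_ ?_
  · rw [LinearMap.range_le_ker_iff]
    ext a b
    exact hl a.1 (TwoSidedIdeal.mem_asIdeal.1 a.2) b
  · rw [LinearMap.range_le_ker_iff]
    ext a b
    exact hr a b.1 (TwoSidedIdeal.mem_asIdeal.1 b.2)

theorem linCoeff_eq_zero (hI : χ.IsPreNicholsIdeal I) (i : Fin n) {p : NCPoly k n} (hp : p ∈ I) :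
    linCoeff i p = 0 :=
  linCoeff_eq_zero_of_degGeTwo (hI.deg_ge_two (TwoSidedIdeal.mem_asIdeal.2 hp)) i

theorem counit_eq_zero (hI : χ.IsPreNicholsIdeal I) {p : NCPoly k n} (hp : p ∈ I) :
    counit p = 0 :=
  counit_eq_zero_of_degGeTwo (hI.deg_ge_two (TwoSidedIdeal.mem_asIdeal.2 hp))

/-- Linear coefficients vanish on I because I starts in degree two, so after applying `linCoeff` to
the left leg only T ⊗ I contributes, and its contribution lies in I. -/
theorem dL_mem (hI : χ.IsPreNicholsIdeal I) (i : Fin n) {p : NCPoly k n} (hp : p ∈ I) :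
    χ.dL i p ∈ I := by
  have h := hI.coproduct_eq_zero (f := (idealSubmodule I).mkQ ∘ₗ
    (TensorProduct.lid k _).toLinearMap ∘ₗ TensorProduct.map (linCoeff i) LinearMap.id)
    (fun a ha b => by simp [hI.linCoeff_eq_zero i ha]) (fun a b hb => ?_) hp
  · rw [LinearMap.comp_apply, Submodule.mkQ_apply, Submodule.Quotient.mk_eq_zero] at h
    exact TwoSidedIdeal.mem_asIdeal.1 h
  · simp only [LinearMap.comp_apply, TensorProduct.map_tmul, LinearEquiv.coe_coe,
      TensorProduct.lid_tmul, Submodule.mkQ_apply, Submodule.Quotient.mk_eq_zero,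
      LinearMap.id_apply]
    exact Submodule.smul_mem _ _ (TwoSidedIdeal.mem_asIdeal.2 hb)

theorem dR_mem (hI : χ.IsPreNicholsIdeal I) (i : Fin n) {p : NCPoly k n} (hp : p ∈ I) :
    χ.dR i p ∈ I := by
  have h := hI.coproduct_eq_zero (f := (idealSubmodule I).mkQ ∘ₗ
    (TensorProduct.rid k _).toLinearMap ∘ₗ TensorProduct.map LinearMap.id (linCoeff i))
    (fun a ha b => ?_) (fun a b hb => by simp [hI.linCoeff_eq_zero i hb]) hp
  · rw [LinearMap.comp_apply, Submodule.mkQ_apply, Submodule.Quotient.mk_eq_zero] at h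
    exact TwoSidedIdeal.mem_asIdeal.1 h
  · simp only [LinearMap.comp_apply, TensorProduct.map_tmul, LinearEquiv.coe_coe,
      TensorProduct.rid_tmul, Submodule.mkQ_apply, Submodule.Quotient.mk_eq_zero,
      LinearMap.id_apply]
    exact Submodule.smul_mem _ _ (TwoSidedIdeal.mem_asIdeal.2 ha)

variable {R : Type*} [Ring R] [Algebra k R]

/-- In the binomial expansion of p(Z + X) every term has a left leg in I, killed by Z, or a right
leg in I, killed by X. -/
theorem lift_add_eq_zero (hI : χ.IsPreNicholsIdeal I) {Z X : Fin n → R}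
    (h : ∀ i j, X i * Z j = (χ.q i j : k) • (Z j * X i))
    (hZ : ∀ p ∈ I, FreeAlgebra.lift k Z p = 0) (hX : ∀ p ∈ I, FreeAlgebra.lift k X p = 0)
    {p : NCPoly k n} (hp : p ∈ I) : FreeAlgebra.lift k (fun j => Z j + X j) p = 0 := by
  rw [χ.lift_add_eq h]
  exact hI.coproduct_eq_zero (fun a ha b => by rw [evalTensor_tmul, hZ a ha, zero_mul])
    (fun a b hb => by rw [evalTensor_tmul, hX b hb, mul_zero]) hp

theorem lift_wtProj_eq_zero (hI : χ.IsPreNicholsIdeal I) {m : ℕ} {Z : Fin n → R}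
    (hZ : ∀ l : Fin n → ℕ, ∑ i, l i < m → ∀ p ∈ I, p ∈ homog l → FreeAlgebra.lift k Z p = 0)
    {p : NCPoly k n} (hp : p ∈ I) :
    FreeAlgebra.lift k Z (wtProj (fun w => ∑ i, w i < (m : ℤ)) p) = 0 := by
  refine hI.graded_induction (P := fun p =>
    FreeAlgebra.lift k Z (wtProj (fun w => ∑ i, w i < (m : ℤ)) p) = 0) hp
    (fun l x hx hl => ?_) (by simp) (fun x y hx hy => by rw [map_add, map_add, hx, hy, add_zero])
  rw [wtProj_of_mem_homog _ hl]
  split_ifs with hm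
  · dsimp only at hm
    exact hZ l (by exact_mod_cast hm) x hx hl
  · exact map_zero _

/-- The braided binomial formula for an element of the ideal if `X` satisfies all relations and
`Z` satisfies the relations of smaller degree. -/
theorem lift_add_eq_left (hI : χ.IsPreNicholsIdeal I) {Z X : Fin n → R}
    (h : ∀ i j, X i * Z j = (χ.q i j : k) • (Z j * X i)) {l : Fin n → ℕ}
    (hZ : ∀ l' : Fin n → ℕ, ∑ i, l' i < ∑ i, l i → ∀ p ∈ I, p ∈ homog l' →
      FreeAlgebra.lift k Z p = 0)
    (hX : ∀ p ∈ I, FreeAlgebra.lift k X p = 0)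
    {p : NCPoly k n} (hp : p ∈ I) (hl : p ∈ homog l) :
    FreeAlgebra.lift k (fun j => Z j + X j) p = FreeAlgebra.lift k Z p := by
  -- The leading term p ⊗ 1 gives p(Z). In the remainder a left leg in I is truncated to smaller
  -- degree, where Z satisfies the relations, and a right leg in I is killed by X.
  rw [χ.lift_add_eq h, χ.coproduct_homog_left hl, map_add, evalTensor_tmul, map_one, mul_one,
    add_eq_left, ← LinearMap.comp_apply]
  refine hI.coproduct_eq_zero (fun a ha b => ?_) (fun a b hb => ?_) hp
  · rw [LinearMap.comp_apply, TensorProduct.map_tmul, evalTensor_tmul,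
      hI.lift_wtProj_eq_zero hZ ha, zero_mul]
  · rw [LinearMap.comp_apply, TensorProduct.map_tmul, evalTensor_tmul, LinearMap.id_apply, hX b hb,
      mul_zero]

/-- The braided binomial formula for an element of the ideal if `Z` satisfies all relations and
`X` satisfies the relations of smaller degree. -/
theorem lift_add_eq_right (hI : χ.IsPreNicholsIdeal I) {Z X : Fin n → R}
    (h : ∀ i j, X i * Z j = (χ.q i j : k) • (Z j * X i)) {l : Fin n → ℕ}
    (hZ : ∀ p ∈ I, FreeAlgebra.lift k Z p = 0)
    (hX : ∀ l' : Fin n → ℕ, ∑ i, l' i < ∑ i, l i → ∀ p ∈ I, p ∈ homog l' →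
      FreeAlgebra.lift k X p = 0)
    {p : NCPoly k n} (hp : p ∈ I) (hl : p ∈ homog l) :
    FreeAlgebra.lift k (fun j => Z j + X j) p = FreeAlgebra.lift k X p := by
  rw [χ.lift_add_eq h, χ.coproduct_homog_right hl, map_add, evalTensor_tmul, map_one, one_mul,
    add_eq_left, ← LinearMap.comp_apply]
  refine hI.coproduct_eq_zero (fun a ha b => ?_) (fun a b hb => ?_) hp
  · rw [LinearMap.comp_apply, TensorProduct.map_tmul, evalTensor_tmul, LinearMap.id_apply, hZ a ha,
      zero_mul]
  · rw [LinearMap.comp_apply, TensorProduct.map_tmul, evalTensor_tmul,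
      hI.lift_wtProj_eq_zero hX hb, mul_zero]

end SymmBicharacter.IsPreNicholsIdeal

end Evaluation

end PreNichols

namespace PreNichols

/-! ## The pre-Nichols algebra and operators on it -/

open TensorProduct

section Operators

variable {k : Type*} [Field k] {n : ℕ}

open NCPoly

theorem NCPoly.homog_mul {l l' : Fin n → ℕ} {p p' : NCPoly k n} (hp : p ∈ homog l)
    (hp' : p' ∈ homog l') : p * p' ∈ homog (l + l') := by
  induction hp using Submodule.span_induction with
  | mem x hx =>
    obtain ⟨J, hJ, rfl⟩ := hx
    induction hp' using Submodule.span_induction with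
    | mem y hy =>
      obtain ⟨J', hJ', rfl⟩ := hy
      rw [← monomial_append]
      exact Submodule.subset_span ⟨J ++ J', by simp [hJ, hJ'], rfl⟩
    | zero => simp
    | add x y _ _ hx hy => rw [mul_add]; exact add_mem hx hy
    | smul a x _ hx => rw [mul_smul_comm]; exact Submodule.smul_mem _ _ hx
  | zero => simp
  | add x y _ _ hx hy => rw [add_mul]; exact add_mem hx hy
  | smul a x _ hx => rw [smul_mul_assoc]; exact Submodule.smul_mem _ _ hx

/-! ### Noncommutative polynomials in operators on vector spaces and tensor products. -/

section Modules

variable {W W' : Type*} [AddCommGroup W] [Module k W] [AddCommGroup W'] [Module k W']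

theorem lift_apply_of_apply_eq_zero {Z : Fin n → Module.End k W} {v : W} (h : ∀ j, Z j v = 0)
    (p : NCPoly k n) : FreeAlgebra.lift k Z p v = counit p • v := by
  refine induction_left (P := fun p => FreeAlgebra.lift k Z p v = counit p • v)
    (by simp) (by simp) (fun x y hx hy => ?_) (fun a x hx => ?_) (fun j x hx => ?_) p
  · rw [map_add, LinearMap.add_apply, hx, hy, map_add, add_smul]
  · rw [map_smul, LinearMap.smul_apply, hx, map_smul, smul_assoc]
  · rw [map_mul, FreeAlgebra.lift_ι_apply, Module.End.mul_apply, hx, map_smul, h, map_mul,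
      counit_ι, zero_mul, zero_smul, smul_zero]

theorem lift_intertwine {Y : Fin n → Module.End k W} {Y' : Fin n → Module.End k W'}
    {φ : W →ₗ[k] W'} (h : ∀ j w, φ (Y j w) = Y' j (φ w)) (p : NCPoly k n) (w : W) :
    φ (FreeAlgebra.lift k Y p w) = FreeAlgebra.lift k Y' p (φ w) := by
  refine induction_left (P := fun p => φ (FreeAlgebra.lift k Y p w) =
    FreeAlgebra.lift k Y' p (φ w))
    (by simp) (by simp) (fun x y hx hy => ?_) (fun a x hx => ?_) (fun j x hx => ?_) p
  · simp only [map_add, LinearMap.add_apply, hx, hy]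
  · simp only [map_smul, LinearMap.smul_apply, hx]
  · simp only [map_mul, FreeAlgebra.lift_ι_apply, Module.End.mul_apply, h, hx]

theorem lift_map_id (Y : Fin n → Module.End k W) (p : NCPoly k n) :
    FreeAlgebra.lift k (fun j => TensorProduct.map (Y j) (LinearMap.id : Module.End k W')) p =
      TensorProduct.map (FreeAlgebra.lift k Y p) LinearMap.id := by
  have : FreeAlgebra.lift k (fun j => TensorProduct.map (Y j) (LinearMap.id : Module.End k W')) =
      (Module.End.rTensorAlgHom k W W').comp (FreeAlgebra.lift k Y) := by
    ext j; simp only [Function.comp_apply, FreeAlgebra.lift_ι_apply, AlgHom.comp_apply]; rfl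
  rw [this]
  rfl

theorem lift_id_map (Y : Fin n → Module.End k W) (p : NCPoly k n) :
    FreeAlgebra.lift k (fun j => TensorProduct.map (LinearMap.id : Module.End k W') (Y j)) p =
      TensorProduct.map LinearMap.id (FreeAlgebra.lift k Y p) := by
  have : FreeAlgebra.lift k (fun j => TensorProduct.map (LinearMap.id : Module.End k W') (Y j)) =
      (Module.End.lTensorAlgHom k W W').comp (FreeAlgebra.lift k Y) := by
    ext j; simp only [Function.comp_apply, FreeAlgebra.lift_ι_apply, AlgHom.comp_apply]; rfl
  rw [this]
  rfl

/-- Since the κⱼ commute, the second factor of a word depends only on its weight and can be split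
off from a homogeneous polynomial. -/
theorem exists_lift_map_left (Y : Fin n → Module.End k W) {κ : Fin n → Module.End k W'}
    (hκ : ∀ i j, κ i * κ j = κ j * κ i) (l : Fin n → ℕ) :
    ∃ w : Module.End k W', ∀ p : NCPoly k n, p ∈ homog l →
      FreeAlgebra.lift k (fun j => TensorProduct.map (Y j) (κ j)) p =
        TensorProduct.map (FreeAlgebra.lift k Y p) w := by
  by_cases hl : ∃ J : List (Fin n), wt J = fun i => (l i : ℤ)
  · obtain ⟨J₀, h₀⟩ := hl
    refine ⟨(J₀.map κ).prod, fun p hp => ?_⟩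
    refine homog_induction (P := fun p =>
      FreeAlgebra.lift k (fun j => TensorProduct.map (Y j) (κ j)) p =
        TensorProduct.map (FreeAlgebra.lift k Y p) (J₀.map κ).prod) hp
      (fun J hJ => ?_) (by simp) (fun x y hx hy => ?_) (fun a x hx => ?_)
    · have hperm : J.Perm J₀ := by
        rw [List.perm_iff_count]
        intro i
        have := congrFun (hJ.trans h₀.symm) i
        simpa [wt] using this
      have hprod : (J.map κ).prod = (J₀.map κ).prod :=
        (hperm.map κ).prod_eq' (List.pairwise_map.2 (List.pairwise_of_forall fun x y => hκ x y))
      rw [lift_monomial, lift_monomial, ← hprod]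
      clear hprod hperm hJ
      induction J with
      | nil => simp only [List.map_nil, List.prod_nil]; exact TensorProduct.map_one.symm
      | cons j J ih => simp only [List.map_cons, List.prod_cons, ih, ← TensorProduct.map_mul]
    · rw [map_add, hx, hy, map_add, TensorProduct.map_add_left]
    · rw [map_smul, hx, map_smul, TensorProduct.map_smul_left]
  · refine ⟨1, fun p hp => ?_⟩
    exact homog_induction (P := fun p =>
      FreeAlgebra.lift k (fun j => TensorProduct.map (Y j) (κ j)) p =
        TensorProduct.map (FreeAlgebra.lift k Y p) 1) hp (fun J hJ => absurd ⟨J, hJ⟩ hl)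
      (by simp)
      (fun x y hx hy => by rw [map_add, hx, hy, map_add, TensorProduct.map_add_left])
      (fun a x hx => by rw [map_smul, hx, map_smul, TensorProduct.map_smul_left])

theorem SymmBicharacter.IsPreNicholsIdeal.lift_map_right_eq_zero {χ : SymmBicharacter k n}
    {I : TwoSidedIdeal (NCPoly k n)} (hI : χ.IsPreNicholsIdeal I) {Y : Fin n → Module.End k W}
    (hY : ∀ p ∈ I, FreeAlgebra.lift k Y p = 0) {κ : Fin n → Module.End k W'}
    (hκ : ∀ i j, κ i * κ j = κ j * κ i) {p : NCPoly k n} (hp : p ∈ I) :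
    FreeAlgebra.lift k (fun j => TensorProduct.map (κ j) (Y j)) p = 0 := by
  have hom : ∀ l, ∀ x ∈ I, x ∈ homog l →
      FreeAlgebra.lift k (fun j => TensorProduct.map (κ j) (Y j)) x = 0 := by
    intro l x hx hl
    obtain ⟨w, hw⟩ := exists_lift_map_left Y hκ l
    have h := hw x hl
    rw [hY x hx, TensorProduct.map_zero_left] at h
    ext a b
    have h2 := lift_intertwine (φ := (TensorProduct.comm k W' W).toLinearMap)
      (Y := fun j => TensorProduct.map (κ j) (Y j))
      (Y' := fun j => TensorProduct.map (Y j) (κ j)) (fun j t => ?_) x (a ⊗ₜ b)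
    · rw [h, LinearMap.zero_apply] at h2
      simpa using h2
    · induction t with
      | zero => simp
      | tmul a b => simp
      | add a b ha hb => simp only [map_add, ha, hb]
  exact hI.graded_induction hp hom (map_zero _) (fun x y hx hy => by rw [map_add, hx, hy, add_zero])

/-- The vectors annihilated by all relations in the `Fⱼ` are stable under the `Eᵢ`. -/
theorem SymmBicharacter.IsPreNicholsIdeal.lift_apply_apply_eq_zero {χ : SymmBicharacter k n}
    {I : TwoSidedIdeal (NCPoly k n)} (hI : χ.IsPreNicholsIdeal I) {i : Fin n}
    {E K L : Module.End k W} {F : Fin n → Module.End k W}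
    (hK : ∀ j, F j * K = (χ.q i j : k) • (K * F j))
    (hL : ∀ j, L * F j = (χ.q i j : k) • (F j * L))
    (hE : ∀ j, E * F j - F j * E = if i = j then K - L else 0) {v : W}
    (hv : ∀ p ∈ I, FreeAlgebra.lift k F p v = 0) {p : NCPoly k n} (hp : p ∈ I) :
    FreeAlgebra.lift k F p (E v) = 0 := by
  have h := LinearMap.congr_fun (χ.commutator_lift hK hL hE p) v
  -- The term ∂ᴿ(p)(F) L v has L next to v, where the hypothesis on v does not apply. Moving L to
  -- the front replaces ∂ᴿ(p) by an inverse twist of it, which again lies in I.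
  have hLm := LinearMap.congr_fun
    (χ.mul_lift_comm (a := Pi.single i 1) hL (χ.tw (-Pi.single i 1) (χ.dR i p))) v
  rw [χ.tw_tw, add_neg_cancel, χ.tw_zero] at hLm
  simp only [Module.End.mul_apply, LinearMap.sub_apply] at h hLm
  rw [← hLm, hv p hp, hv _ (hI.dL_mem i hp), hv _ (hI.tw_mem _ (hI.dR_mem i hp))] at h
  simpa using h

end Modules

/-! ### The quotient T/I and the structure maps it inherits. -/

namespace Datum

variable (D : Datum k n)

/-- The pre-Nichols algebra `T / I`. -/
def A : Type _ := NCPoly k n ⧸ TwoSidedIdeal.asIdeal D.I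

noncomputable instance : Ring D.A :=
  inferInstanceAs (Ring (NCPoly k n ⧸ TwoSidedIdeal.asIdeal D.I))

noncomputable instance : Algebra k D.A :=
  inferInstanceAs (Algebra k (NCPoly k n ⧸ TwoSidedIdeal.asIdeal D.I))

/-- The quotient map onto the pre-Nichols algebra. -/
noncomputable def toA : NCPoly k n →ₐ[k] D.A :=
  Ideal.Quotient.mkₐ k (TwoSidedIdeal.asIdeal D.I)

theorem toA_surjective : Function.Surjective D.toA := Ideal.Quotient.mkₐ_surjective k _

theorem toA_eq_zero_iff (p : NCPoly k n) : D.toA p = 0 ↔ p ∈ D.I :=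
  Ideal.Quotient.eq_zero_iff_mem.trans TwoSidedIdeal.mem_asIdeal

/-- A linear map on the tensor algebra that vanishes on the ideal, as a map on the quotient. -/
noncomputable def descend {W : Type*} [AddCommGroup W] [Module k W] (f : NCPoly k n →ₗ[k] W)
    (h : ∀ p ∈ D.I, f p = 0) : D.A →ₗ[k] W :=
  (LinearMap.ker D.toA.toLinearMap).liftQ f (fun p hp => h p ((D.toA_eq_zero_iff p).1 hp)) ∘ₗ
    (D.toA.toLinearMap.quotKerEquivOfSurjective D.toA_surjective).symm.toLinearMap

theorem descend_toA {W : Type*} [AddCommGroup W] [Module k W] (f : NCPoly k n →ₗ[k] W)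
    (h : ∀ p ∈ D.I, f p = 0) (p : NCPoly k n) : D.descend f h (D.toA p) = f p := by
  have : (D.toA.toLinearMap.quotKerEquivOfSurjective D.toA_surjective).symm (D.toA p) =
      Submodule.Quotient.mk p := by
    rw [LinearEquiv.symm_apply_eq]
    rfl
  simp only [descend, LinearMap.comp_apply, LinearEquiv.coe_coe, this]
  exact Submodule.liftQ_apply _ _ _

/-- The generators of the pre-Nichols algebra. -/
noncomputable def X (i : Fin n) : D.A := D.toA (FreeAlgebra.ι k i)

theorem toA_ι_mul (i : Fin n) (p : NCPoly k n) :
    D.toA (FreeAlgebra.ι k i * p) = D.X i * D.toA p := map_mul _ _ _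

theorem A_induction {P : D.A → Prop} (one : P 1) (zero : P 0)
    (add : ∀ x y, P x → P y → P (x + y)) (smul : ∀ (a : k) x, P x → P (a • x))
    (mul : ∀ j x, P x → P (D.X j * x)) (x : D.A) : P x := by
  obtain ⟨p, rfl⟩ := D.toA_surjective x
  refine induction_left (P := fun p => P (D.toA p)) ?_ ?_ (fun x y hx hy => ?_)
    (fun a x hx => ?_) (fun j x hx => ?_) p
  · rwa [map_one]
  · rwa [map_zero]
  · rw [map_add]; exact add _ _ hx hy
  · rw [map_smul]; exact smul _ _ hx
  · rw [toA_ι_mul]; exact mul _ _ hx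

/-- Left multiplication with a generator. -/
noncomputable def mulX (i : Fin n) : Module.End k D.A := LinearMap.mulLeft k (D.X i)

theorem mulX_apply (i : Fin n) (x : D.A) : D.mulX i x = D.X i * x := rfl

theorem lift_mulX (p : NCPoly k n) :
    FreeAlgebra.lift k D.mulX p = LinearMap.mulLeft k (D.toA p) := by
  have : FreeAlgebra.lift k D.mulX = (Algebra.lmul k D.A).comp D.toA := by
    ext; simp [mulX, X]
  rw [this]
  rfl

/-- The action of `K_a` on the pre-Nichols algebra. -/
noncomputable def twA (a : Fin n → ℤ) : Module.End k D.A :=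
  D.descend (D.toA.toLinearMap ∘ₗ (D.χ.tw a).toLinearMap)
    fun _ hp => (D.toA_eq_zero_iff _).2 (D.isPreNichols.tw_mem a hp)

theorem twA_toA (a : Fin n → ℤ) (p : NCPoly k n) : D.twA a (D.toA p) = D.toA (D.χ.tw a p) :=
  D.descend_toA _ _ p

/-- The skew derivation `∂ᵢᴸ` of the pre-Nichols algebra. -/
noncomputable def dLA (i : Fin n) : Module.End k D.A :=
  D.descend (D.toA.toLinearMap ∘ₗ D.χ.dL i)
    fun _ hp => (D.toA_eq_zero_iff _).2 (D.isPreNichols.dL_mem i hp)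

theorem dLA_toA (i : Fin n) (p : NCPoly k n) : D.dLA i (D.toA p) = D.toA (D.χ.dL i p) :=
  D.descend_toA _ _ p

/-- The skew derivation `∂ᵢᴿ` of the pre-Nichols algebra. -/
noncomputable def dRA (i : Fin n) : Module.End k D.A :=
  D.descend (D.toA.toLinearMap ∘ₗ D.χ.dR i)
    fun _ hp => (D.toA_eq_zero_iff _).2 (D.isPreNichols.dR_mem i hp)

theorem dRA_toA (i : Fin n) (p : NCPoly k n) : D.dRA i (D.toA p) = D.toA (D.χ.dR i p) :=
  D.descend_toA _ _ p

/-- The projection of the pre-Nichols algebra onto the weights satisfying `Q`. -/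
noncomputable def wtProjA (Q : (Fin n → ℤ) → Prop) : Module.End k D.A :=
  D.descend (D.toA.toLinearMap ∘ₗ wtProj Q)
    fun _ hp => (D.toA_eq_zero_iff _).2 (D.isPreNichols.wtProj_mem Q hp)

theorem wtProjA_toA (Q : (Fin n → ℤ) → Prop) (p : NCPoly k n) :
    D.wtProjA Q (D.toA p) = D.toA (wtProj Q p) :=
  D.descend_toA _ _ p

/-- The augmentation of the pre-Nichols algebra. -/
noncomputable def counitA : D.A →ₗ[k] k :=
  D.descend counit.toLinearMap fun _ hp => D.isPreNichols.counit_eq_zero hp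

theorem counitA_toA (p : NCPoly k n) : D.counitA (D.toA p) = counit p := D.descend_toA _ _ p

/-- The braided coproduct of the pre-Nichols algebra. -/
noncomputable def coproductA : D.A →ₗ[k] D.A ⊗[k] D.A :=
  D.descend (TensorProduct.map D.toA.toLinearMap D.toA.toLinearMap ∘ₗ D.χ.coproduct)
    fun _ hp => D.isPreNichols.coproduct_eq_zero
      (f := TensorProduct.map D.toA.toLinearMap D.toA.toLinearMap) (fun a ha b => by simp [(D.toA_eq_zero_iff a).2 ha])
      (fun a b hb => by simp [(D.toA_eq_zero_iff b).2 hb]) hp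

theorem coproductA_toA (p : NCPoly k n) : D.coproductA (D.toA p) =
    TensorProduct.map D.toA.toLinearMap D.toA.toLinearMap (D.χ.coproduct p) :=
  D.descend_toA _ _ p

theorem toA_one : D.toA 1 = 1 := map_one _

theorem twA_one (a : Fin n → ℤ) : D.twA a 1 = 1 := by
  rw [← toA_one, twA_toA, map_one]

theorem dLA_one (i : Fin n) : D.dLA i 1 = 0 := by
  rw [← toA_one, dLA_toA, SymmBicharacter.dL_one, map_zero]

theorem dRA_one (i : Fin n) : D.dRA i 1 = 0 := by
  rw [← toA_one, dRA_toA, SymmBicharacter.dR_one, map_zero]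

theorem counitA_one : D.counitA 1 = 1 := by rw [← toA_one, counitA_toA, map_one]

theorem counitA_X_mul (i : Fin n) (x : D.A) : D.counitA (D.X i * x) = 0 := by
  obtain ⟨p, rfl⟩ := D.toA_surjective x
  rw [← toA_ι_mul, counitA_toA, map_mul, counit_ι, zero_mul]

theorem A_end_ext {W : Type*} [AddCommGroup W] [Module k W] {f g : D.A →ₗ[k] W}
    (h : ∀ p, f (D.toA p) = g (D.toA p)) : f = g := by
  ext x
  obtain ⟨p, rfl⟩ := D.toA_surjective x
  exact h p

theorem twA_mul (a : Fin n → ℤ) (x y : D.A) : D.twA a (x * y) = D.twA a x * D.twA a y := by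
  obtain ⟨p, rfl⟩ := D.toA_surjective x
  obtain ⟨p', rfl⟩ := D.toA_surjective y
  rw [← map_mul, twA_toA, map_mul, map_mul, twA_toA, twA_toA]

theorem twA_X (a : Fin n → ℤ) (j : Fin n) :
    D.twA a (D.X j) = (D.χ.toFun a (Pi.single j 1) : k) • D.X j := by
  rw [X, twA_toA, SymmBicharacter.tw_ι, map_smul]

theorem twA_mul_twA (a b : Fin n → ℤ) : D.twA a * D.twA b = D.twA (a + b) :=
  D.A_end_ext fun p => by
    rw [Module.End.mul_apply, twA_toA, twA_toA, twA_toA, SymmBicharacter.tw_tw]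

theorem twA_zero : D.twA 0 = 1 :=
  D.A_end_ext fun p => by rw [twA_toA, SymmBicharacter.tw_zero]; rfl

theorem twA_comm (a b : Fin n → ℤ) : D.twA a * D.twA b = D.twA b * D.twA a := by
  rw [twA_mul_twA, twA_mul_twA, add_comm]

theorem twA_mul_mulX (a : Fin n → ℤ) (j : Fin n) :
    D.twA a * D.mulX j = (D.χ.toFun a (Pi.single j 1) : k) • (D.mulX j * D.twA a) := by
  ext x
  simp only [Module.End.mul_apply, LinearMap.smul_apply, mulX_apply, twA_mul, twA_X,
    smul_mul_assoc]

theorem dLA_mul_twA (i : Fin n) (a : Fin n → ℤ) :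
    D.dLA i * D.twA a = (D.χ.toFun a (Pi.single i 1) : k) • (D.twA a * D.dLA i) :=
  D.A_end_ext fun p => by
    simp only [Module.End.mul_apply, LinearMap.smul_apply, twA_toA, dLA_toA,
      SymmBicharacter.dL_tw, map_smul]

theorem dRA_mul_twA (i : Fin n) (a : Fin n → ℤ) :
    D.dRA i * D.twA a = (D.χ.toFun a (Pi.single i 1) : k) • (D.twA a * D.dRA i) :=
  D.A_end_ext fun p => by
    simp only [Module.End.mul_apply, LinearMap.smul_apply, twA_toA, dRA_toA,
      SymmBicharacter.dR_tw, map_smul]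

theorem twA_mul_dLA (i : Fin n) (a : Fin n → ℤ) :
    D.twA a * D.dLA i = (D.χ.toFun (-a) (Pi.single i 1) : k) • (D.dLA i * D.twA a) := by
  rw [dLA_mul_twA, smul_smul, SymmBicharacter.toFun_neg_left, Units.inv_mul, one_smul]

theorem twA_mul_dRA (i : Fin n) (a : Fin n → ℤ) :
    D.twA a * D.dRA i = (D.χ.toFun (-a) (Pi.single i 1) : k) • (D.dRA i * D.twA a) := by
  rw [dRA_mul_twA, smul_smul, SymmBicharacter.toFun_neg_left, Units.inv_mul, one_smul]

theorem dLA_mul_mulX (i j : Fin n) : D.dLA i * D.mulX j =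
    (if i = j then 1 else 0) + (D.χ.q i j : k) • (D.mulX j * D.dLA i) :=
  D.A_end_ext fun p => by
    simp only [Module.End.mul_apply, LinearMap.smul_apply, LinearMap.add_apply, mulX_apply,
      ← toA_ι_mul, dLA_toA, SymmBicharacter.dL_ι_mul, map_add, map_smul]
    split_ifs <;> simp

theorem dRA_mul_mulX (i j : Fin n) : D.dRA i * D.mulX j =
    D.mulX j * D.dRA i + (if i = j then D.twA (Pi.single i 1) else 0) :=
  D.A_end_ext fun p => by
    simp only [Module.End.mul_apply, LinearMap.add_apply, mulX_apply,
      ← toA_ι_mul, dRA_toA, SymmBicharacter.dR_ι_mul, map_add]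
    split_ifs <;> simp [twA_toA]

theorem dLA_mul_dRA (i j : Fin n) : D.dLA i * D.dRA j = D.dRA j * D.dLA i :=
  D.A_end_ext fun p => by
    simp only [Module.End.mul_apply, dLA_toA, dRA_toA, SymmBicharacter.dL_dR]

/-- The recursion for a generator on the left extends to arbitrary left factors; moving ∂ᴸ past x
costs the action of Kᵢ on x. -/
theorem dLA_mul (i : Fin n) (x y : D.A) :
    D.dLA i (x * y) = D.dLA i x * y + D.twA (Pi.single i 1) x * D.dLA i y := by
  refine D.A_induction (P := fun x => D.dLA i (x * y) =
    D.dLA i x * y + D.twA (Pi.single i 1) x * D.dLA i y) ?_ ?_ (fun a b ha hb => ?_)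
    (fun s a ha => ?_) (fun j a ha => ?_) x
  · rw [one_mul, dLA_one, twA_one, zero_mul, zero_add, one_mul]
  · simp
  · simp only [add_mul, map_add, ha, hb]; abel
  · simp only [smul_mul_assoc, map_smul, ha, smul_add]
  · have h := fun z => LinearMap.congr_fun (D.dLA_mul_mulX i j) z
    simp only [Module.End.mul_apply, mulX_apply, LinearMap.add_apply, LinearMap.smul_apply] at h
    have hq : D.χ.toFun (Pi.single i 1) (Pi.single j 1) = D.χ.q i j := rfl
    rw [mul_assoc, h, h, ha, twA_mul, twA_X, hq]
    split_ifs
    · simp only [Module.End.one_apply, mul_add, smul_add, add_mul, smul_mul_assoc, mul_assoc]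
      abel
    · simp only [LinearMap.zero_apply, mul_add, smul_add, zero_add, smul_mul_assoc, mul_assoc]

theorem coproductA_one : D.coproductA 1 = 1 ⊗ₜ 1 := by
  rw [← toA_one, coproductA_toA, SymmBicharacter.coproduct_one]
  rfl

theorem coproductA_twA (a : Fin n → ℤ) (x : D.A) :
    D.coproductA (D.twA a x) = TensorProduct.map (D.twA a) (D.twA a) (D.coproductA x) := by
  obtain ⟨p, rfl⟩ := D.toA_surjective x
  rw [twA_toA, coproductA_toA, coproductA_toA, SymmBicharacter.coproduct_tw]
  generalize D.χ.coproduct p = t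
  induction t with
  | zero => simp
  | tmul a b => simp [twA_toA]
  | add a b ha hb => simp only [map_add, ha, hb]

theorem coproductA_X_mul (j : Fin n) (x : D.A) :
    D.coproductA (D.X j * x) = TensorProduct.map (D.mulX j) LinearMap.id (D.coproductA x) +
      TensorProduct.map (D.twA (Pi.single j 1)) (D.mulX j) (D.coproductA x) := by
  obtain ⟨p, rfl⟩ := D.toA_surjective x
  rw [← toA_ι_mul, coproductA_toA, coproductA_toA, SymmBicharacter.coproduct_ι_mul]
  generalize D.χ.coproduct p = t
  induction t with
  | zero => simp
  | tmul a b => simp [SymmBicharacter.primitiveMul_tmul, twA_toA, mulX_apply, X]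
  | add a b ha hb => simp only [map_add, ha, hb]; abel

theorem coproductA_dLA (i : Fin n) (x : D.A) :
    D.coproductA (D.dLA i x) = TensorProduct.map (D.dLA i) LinearMap.id (D.coproductA x) := by
  obtain ⟨p, rfl⟩ := D.toA_surjective x
  rw [dLA_toA, coproductA_toA, coproductA_toA, SymmBicharacter.coproduct_dL]
  generalize D.χ.coproduct p = t
  induction t with
  | zero => simp
  | tmul a b => simp [dLA_toA]
  | add a b ha hb => simp only [map_add, ha, hb]

theorem counitA_left (x : D.A) : TensorProduct.lid k _ (TensorProduct.map D.counitA LinearMap.id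
    (D.coproductA x)) = x := by
  obtain ⟨p, rfl⟩ := D.toA_surjective x
  rw [coproductA_toA]
  conv_rhs => rw [← D.χ.counit_left p]
  generalize D.χ.coproduct p = t
  induction t with
  | zero => simp
  | tmul a b => simp [counitA_toA]
  | add a b ha hb => simp only [map_add, ha, hb]

end Datum

end Operators

end PreNichols

namespace PreNichols

/-! ## The operators of the coideal subalgebra on the pre-Nichols algebra -/

open TensorProduct

section CoidealOperators

variable {k : Type*} [Field k] {n : ℕ}

open NCPoly

namespace Datum

variable (D : Datum k n)

theorem q_symm_τ (i j : Fin n) : D.χ.q i (D.τ j) = D.χ.q j (D.τ i) := by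
  rw [← D.q_τ i (D.τ j), D.τ_invol, D.χ.q_symm]

theorem toFun_single (i j : Fin n) :
    D.χ.toFun (Pi.single i 1) (Pi.single j 1) = D.χ.q i j := rfl

/-- The operator `K_{-αⱼ} ∂ⱼᴸ`. -/
noncomputable def xi (j : Fin n) : Module.End k D.A := D.twA (-Pi.single j 1) * D.dLA j

/-- Left multiplication with `cⱼ E_{τ(j)} Kⱼ⁻¹`. -/
noncomputable def eta (c : Fin n → k) (j : Fin n) : Module.End k D.A :=
  D.mulX (D.τ j) * (c j • D.twA (-Pi.single j 1))

/-- The operator by which the lowest part of `Bⱼ` acts on the pre-Nichols algebra. -/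
noncomputable def beta (c : Fin n → k) (j : Fin n) : Module.End k D.A := D.xi j + D.eta c j

theorem twA_mul_xi (a : Fin n → ℤ) (j : Fin n) :
    D.twA a * D.xi j = (D.χ.toFun (-a) (Pi.single j 1) : k) • (D.xi j * D.twA a) := by
  rw [xi, ← mul_assoc, twA_comm, mul_assoc, twA_mul_dLA, mul_smul_comm, mul_assoc]

theorem twA_mul_eta (c : Fin n → k) (a : Fin n → ℤ) (j : Fin n) :
    D.twA a * D.eta c j = (D.χ.toFun a (Pi.single (D.τ j) 1) : k) • (D.eta c j * D.twA a) := by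
  rw [eta, ← mul_assoc, twA_mul_mulX, smul_mul_assoc, mul_assoc, mul_assoc, mul_smul_comm,
    smul_mul_assoc, twA_comm]

theorem twA_mul_beta (c : Fin n → k) {a : Fin n → ℤ} {j : Fin n}
    (h : D.χ.toFun a (Pi.single (D.τ j) 1) = D.χ.toFun (-a) (Pi.single j 1)) :
    D.twA a * D.beta c j = (D.χ.toFun (-a) (Pi.single j 1) : k) • (D.beta c j * D.twA a) := by
  rw [beta, mul_add, twA_mul_xi, twA_mul_eta, h, add_mul, smul_add]

/-- By invariance of q under τ, a weight of H_θ pairs equally with α_{τ(j)} and -αⱼ. Hence H_θ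
scales the two summands `xi` and `eta` of `beta` by the same factor. -/
theorem toFun_theta (i j : Fin n) :
    D.χ.toFun (Pi.single (D.τ i) 1 - Pi.single i 1) (Pi.single (D.τ j) 1) =
      D.χ.toFun (-(Pi.single (D.τ i) 1 - Pi.single i 1)) (Pi.single j 1) := by
  rw [neg_sub, sub_eq_add_neg, sub_eq_add_neg, D.χ.map_add_left, D.χ.map_add_left,
    SymmBicharacter.toFun_neg_left, SymmBicharacter.toFun_neg_left, toFun_single, toFun_single,
    toFun_single, toFun_single, D.q_τ, D.q_symm_τ, D.χ.q_symm j]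

/-- The twist in `xi` cancels the factor q of the skew Leibniz rule, so `xi` and left multiplication
commute up to a torus term. -/
theorem xi_mul_mulX (i j : Fin n) :
    D.xi j * D.mulX i = (if i = j then D.twA (-Pi.single i 1) else 0) + D.mulX i * D.xi j := by
  rw [xi, mul_assoc, dLA_mul_mulX, mul_add, mul_smul_comm, ← mul_assoc, twA_mul_mulX,
    smul_mul_assoc, smul_smul, SymmBicharacter.toFun_neg_left, toFun_single, Units.mul_inv,
    one_smul, mul_assoc]
  congr 1
  by_cases hij : i = j
  · subst hij; simp
  · simp [hij, Ne.symm hij]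

/-- The relations kill 1, because each `xi` does, and the vectors they kill are stable under left
multiplication with generators; these exhaust A. -/
theorem lift_xi_eq_zero {p : NCPoly k n} (hp : p ∈ D.I) : FreeAlgebra.lift k D.xi p = 0 := by
  ext x
  rw [LinearMap.zero_apply]
  revert p
  refine D.A_induction (P := fun x => ∀ {p : NCPoly k n}, p ∈ D.I →
    FreeAlgebra.lift k D.xi p x = 0) ?_ ?_ (fun a b ha hb => ?_)
    (fun s a ha => ?_) (fun i a ha => ?_) x
  · intro p hp
    rw [lift_apply_of_apply_eq_zero (fun j => by
      rw [xi, Module.End.mul_apply, dLA_one, map_zero]), D.isPreNichols.counit_eq_zero hp,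
      zero_smul]
  · intro p _
    exact map_zero _
  · intro p hp
    rw [map_add, ha hp, hb hp, add_zero]
  · intro p hp
    rw [map_smul, ha hp, smul_zero]
  · intro p hp
    -- Left multiplication plays the role of Eᵢ against Fⱼ = ξⱼ: the commutator is minus the torus
    -- operator, the degenerate case K = 0 of Kᵢ - Kᵢ⁻¹.
    refine D.isPreNichols.lift_apply_apply_eq_zero (i := i) (E := D.mulX i) (K := 0)
      (L := D.twA (-Pi.single i 1)) (fun j => by simp) (fun j => ?_) (fun j => ?_)
      (fun p hp => ha hp) hp
    · rw [twA_mul_xi, neg_neg]; rfl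
    · rw [xi_mul_mulX]
      split_ifs <;> simp

/-- The torus factors of ηⱼ skew commute with the multiplications by X_{τ(j)} and can be collected
on the right of a homogeneous relation. What remains is left multiplication by τ(p), which lies in I
as τ preserves I. -/
theorem lift_eta_eq_zero (c : Fin n → k) {p : NCPoly k n} (hp : p ∈ D.I) :
    FreeAlgebra.lift k (D.eta c) p = 0 := by
  refine D.isPreNichols.graded_induction (P := fun p => FreeAlgebra.lift k (D.eta c) p = 0) hp
    (fun l x hx hl => ?_) (by simp) (fun x y hx hy => by rw [map_add, hx, hy, add_zero])
  obtain ⟨w, hw⟩ := exists_lift_mul_eq (a := fun j => D.mulX (D.τ j))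
    (t := fun j => c j • D.twA (-Pi.single j 1))
    (u := fun i j => (((D.χ.q i (D.τ j))⁻¹ : kˣ) : k))
    (fun i j => by rw [D.q_symm_τ])
    (fun i j => by
      simp only [smul_mul_assoc, mul_smul_comm]; rw [smul_comm, twA_comm])
    (fun i j => by
      simp only [smul_mul_assoc, mul_smul_comm]
      rw [twA_mul_mulX, smul_comm, SymmBicharacter.toFun_neg_left, toFun_single]) l
  have h : FreeAlgebra.lift k (fun j => D.mulX (D.τ j)) x = 0 := by
    have : FreeAlgebra.lift k (fun j => D.mulX (D.τ j)) =
        (FreeAlgebra.lift k D.mulX).comp (NCPoly.perm D.τ) := by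
      ext; simp [NCPoly.perm]
    rw [this, AlgHom.comp_apply, lift_mulX, (D.toA_eq_zero_iff _).2 ((D.I_τ x).2 hx)]
    ext y
    simp
  have := hw x hl
  rw [h, zero_mul] at this
  exact this

/-- The summand `eta` is a left multiplication and sees only x; for `xi` this is the skew Leibniz
rule with its twist undone. Equivalently, multiplication intertwines 1 ⊗ ξⱼ + βⱼ ⊗ K₋αⱼ with βⱼ. -/
theorem beta_mul (c : Fin n → k) (j : Fin n) (x y : D.A) :
    D.beta c j (x * y) = x * D.xi j y + D.beta c j x * D.twA (-Pi.single j 1) y := by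
  have h : D.twA (-Pi.single j 1) (D.twA (Pi.single j 1) x) = x := by
    have := LinearMap.congr_fun (D.twA_mul_twA (-Pi.single j 1) (Pi.single j 1)) x
    rwa [neg_add_cancel, twA_zero] at this
  simp only [beta, xi, eta, LinearMap.add_apply, Module.End.mul_apply, dLA_mul, map_add, twA_mul,
    h, LinearMap.smul_apply, mulX_apply, add_mul, smul_mul_assoc, mul_smul_comm, mul_assoc]
  abel

/-- The derivation ∂ᴸ touches only the left leg, whereas multiplication with the primitive element
X_{τ(j)} spreads over both legs; this produces the second summand, a torus element of H_θ tensored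
with `eta`. -/
theorem coproductA_beta (c : Fin n → k) (j : Fin n) (x : D.A) :
    D.coproductA (D.beta c j x) =
      (TensorProduct.map (D.beta c j) (D.twA (-Pi.single j 1)) +
        TensorProduct.map (D.twA (Pi.single (D.τ j) 1 - Pi.single j 1)) (D.eta c j))
        (D.coproductA x) := by
  have h1 : D.coproductA (D.xi j x) =
      TensorProduct.map (D.xi j) (D.twA (-Pi.single j 1)) (D.coproductA x) := by
    rw [xi, Module.End.mul_apply, coproductA_twA, coproductA_dLA, ← LinearMap.comp_apply,
      ← TensorProduct.map_comp, LinearMap.comp_id]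
    rfl
  have h2 : D.coproductA (D.eta c j x) =
      TensorProduct.map (D.eta c j) (D.twA (-Pi.single j 1)) (D.coproductA x) +
      TensorProduct.map (D.twA (Pi.single (D.τ j) 1 - Pi.single j 1)) (D.eta c j)
        (D.coproductA x) := by
    have h3 : D.twA (Pi.single (D.τ j) 1 - Pi.single j 1) =
        D.twA (Pi.single (D.τ j) 1) ∘ₗ D.twA (-Pi.single j 1) := by
      rw [sub_eq_add_neg, ← twA_mul_twA]; rfl
    have h4 : D.eta c j = c j • (D.mulX (D.τ j) ∘ₗ D.twA (-Pi.single j 1)) := by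
      rw [eta, mul_smul_comm]; rfl
    rw [h3, h4, TensorProduct.map_smul_left, TensorProduct.map_smul_right,
      LinearMap.smul_apply, LinearMap.comp_apply, mulX_apply, map_smul, coproductA_X_mul,
      coproductA_twA, smul_add]
    conv_rhs => rw [← LinearMap.id_comp (D.twA (-Pi.single j 1))]
    rw [TensorProduct.map_comp, TensorProduct.map_comp]
    simp only [LinearMap.smul_apply, LinearMap.comp_apply, LinearMap.id_comp]
  rw [beta, LinearMap.add_apply, map_add, h1, h2, TensorProduct.map_add_left,
    LinearMap.add_apply, LinearMap.add_apply, add_assoc]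

/-- A homogeneous relation annihilates the pre-Nichols algebra under the operators `βⱼ` if its
value at `1` has no constant term and all relations of smaller degree annihilate. -/
theorem lift_beta_eq_zero_of_counit {c : Fin n → k} {l : Fin n → ℕ}
    (hlt : ∀ l' : Fin n → ℕ, ∑ i, l' i < ∑ i, l i → ∀ p ∈ D.I, p ∈ homog l' →
      FreeAlgebra.lift k (D.beta c) p = 0)
    {p : NCPoly k n} (hp : p ∈ D.I) (hl : p ∈ homog l)
    (h0 : D.counitA (FreeAlgebra.lift k (D.beta c) p 1) = 0) :
    FreeAlgebra.lift k (D.beta c) p = 0 := by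
  have hmap := fun l' => exists_lift_map_left (D.beta c)
    (κ := fun j => D.twA (-Pi.single j 1)) (fun i j => D.twA_comm _ _) l'
  have hlt' : ∀ l' : Fin n → ℕ, ∑ i, l' i < ∑ i, l i → ∀ p ∈ D.I, p ∈ homog l' →
      FreeAlgebra.lift k (fun j => TensorProduct.map (D.beta c j) (D.twA (-Pi.single j 1))) p =
        0 := by
    intro l' hl' p hp hpl
    obtain ⟨w, hw⟩ := hmap l'
    rw [hw p hpl, hlt l' hl' p hp hpl, TensorProduct.map_zero_left]
  obtain ⟨w, hw⟩ := hmap l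
  -- Under the coproduct p(β) becomes p of a sum whose second summand satisfies all relations and
  -- whose first satisfies those of smaller degree. So Δ(p(β)1) = p(β)1 ⊗ w(1), and the counit on
  -- the left leg leaves ε(p(β)1)w(1) = 0.
  have h1 : FreeAlgebra.lift k (D.beta c) p 1 = 0 := by
    have hZ : ∀ p ∈ D.I, FreeAlgebra.lift k (fun j =>
        TensorProduct.map (D.twA (Pi.single (D.τ j) 1 - Pi.single j 1)) (D.eta c j)) p = 0 := by
      exact fun p hp => D.isPreNichols.lift_map_right_eq_zero
        (fun p hp => D.lift_eta_eq_zero c hp) (fun i j => D.twA_comm _ _) hp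
    have h2 := D.isPreNichols.lift_add_eq_left (fun i j => ?_) hlt' hZ hp hl
    · have h3 := lift_intertwine (φ := D.coproductA) (D.coproductA_beta c) p 1
      rw [h2, hw p hl, coproductA_one, TensorProduct.map_tmul] at h3
      rw [← D.counitA_left (FreeAlgebra.lift k (D.beta c) p 1), h3, TensorProduct.map_tmul, h0,
        TensorProduct.zero_tmul, map_zero]
    · rw [← TensorProduct.map_mul, ← TensorProduct.map_mul, D.twA_mul_beta c (D.toFun_theta i j),
        TensorProduct.map_smul_left]
      have h4 : D.twA (-Pi.single j 1) * D.eta c i =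
          (((D.χ.q j (D.τ i))⁻¹ : kˣ) : k) • (D.eta c i * D.twA (-Pi.single j 1)) := by
        rw [twA_mul_eta, SymmBicharacter.toFun_neg_left, toFun_single]
      rw [h4, TensorProduct.map_smul_right, smul_smul]
      congr 1
      rw [neg_sub, sub_eq_add_neg, D.χ.map_add_left, SymmBicharacter.toFun_neg_left, toFun_single,
        toFun_single, D.χ.q_symm j]
      push_cast
      rfl
  -- Now multiplication is the intertwiner. Since the `xi` satisfy all relations, p of the sum
  -- equals p(β) ⊗ w; applied to 1 ⊗ y it vanishes because p(β)1 = 0.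
  have h5 := D.isPreNichols.lift_add_eq_right
    (Z := fun j => TensorProduct.map (LinearMap.id : Module.End k D.A) (D.xi j))
    (fun i j => ?_) (fun p hp => ?_) hlt' hp hl
  · ext y
    have h6 := lift_intertwine (φ := LinearMap.mul' k D.A) (Y' := D.beta c)
      (Y := fun j => TensorProduct.map (LinearMap.id : Module.End k D.A) (D.xi j) +
        TensorProduct.map (D.beta c j) (D.twA (-Pi.single j 1))) (fun j t => ?_) p (1 ⊗ₜ y)
    · rw [h5, hw p hl, TensorProduct.map_tmul, h1, TensorProduct.zero_tmul, map_zero,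
        LinearMap.mul'_apply, one_mul] at h6
      rw [← h6, LinearMap.zero_apply]
    · induction t with
      | zero => simp
      | tmul a b => simp [beta_mul]
      | add a b ha hb => rw [map_add, map_add, ha, hb, map_add, map_add]
  · rw [← TensorProduct.map_mul, ← TensorProduct.map_mul, twA_mul_xi, neg_neg,
      TensorProduct.map_smul_right, toFun_single]
    rfl
  · rw [lift_id_map, D.lift_xi_eq_zero hp, TensorProduct.map_zero_right]

/-- If the generators of the ideal have no constant term when evaluated at the operators `βⱼ`, then
the operators `βⱼ` satisfy all relations of the pre-Nichols algebra. -/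
theorem lift_beta_eq_zero {c : Fin n → k} {S : Set (NCPoly k n)} (hS : TwoSidedIdeal.span S = D.I)
    (h : ∀ p ∈ S, ∃ l, p ∈ homog l ∧ D.counitA (FreeAlgebra.lift k (D.beta c) p 1) = 0)
    {p : NCPoly k n} (hp : p ∈ D.I) : FreeAlgebra.lift k (D.beta c) p = 0 := by
  have hSI : ∀ s ∈ S, s ∈ D.I := fun s hs => hS ▸ TwoSidedIdeal.subset_span hs
  have main : ∀ m : ℕ, ∀ s ∈ S, ∀ l : Fin n → ℕ, s ∈ homog l → ∑ i, l i = m →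
      D.counitA (FreeAlgebra.lift k (D.beta c) s 1) = 0 → FreeAlgebra.lift k (D.beta c) s = 0 := by
    intro m
    induction m using Nat.strong_induction_on with
    | _ m ih =>
    intro s hs l hl hm h0
    refine D.lift_beta_eq_zero_of_counit (l := l) (fun l' hl' x hx hxl => ?_) (hSI s hs) hl h0
    rw [hm] at hl'
    -- The induction over the ideal needs a statement stable under multiplication on both sides, so
    -- it is made for the truncation of a x b to degree below m, for all a and b. For a generator x
    -- in place and words a, b, either the truncation is zero or x has degree below m and the outer
    -- induction applies.
    have key : ∀ a b : NCPoly k n, FreeAlgebra.lift k (D.beta c)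
        (wtProj (fun w => ∑ i, w i < (m : ℤ)) (a * x * b)) = 0 := by
      clear hxl
      rw [← hS] at hx
      induction hx using TwoSidedIdeal.span_induction with
      | mem x hx =>
        intro a b
        obtain ⟨l₁, hl₁, hc⟩ := h x hx
        induction a using induction_monomial with
        | mon J =>
          induction b using induction_monomial with
          | mon J' =>
            rw [wtProj_of_mem_homog _
              (homog_mul (homog_mul (monomial_mem_homog J) hl₁) (monomial_mem_homog J'))]
            split_ifs with hlt
            · have hlt' : ∑ i, l₁ i < m := by
                have : ∑ i, ((J.count i : ℤ) + l₁ i + J'.count i) < (m : ℤ) := by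
                  simpa using hlt
                have h2 : ∑ i, (l₁ i : ℤ) ≤ ∑ i, ((J.count i : ℤ) + l₁ i + J'.count i) :=
                  Finset.sum_le_sum fun i _ => by omega
                exact_mod_cast h2.trans_lt this
              rw [map_mul, map_mul, ih _ hlt' x hx l₁ hl₁ rfl hc, mul_zero, zero_mul]
            · exact map_zero _
          | zero => simp
          | add y z hy hz => rw [mul_add, map_add, map_add, hy, hz, add_zero]
          | smul r y hy => rw [mul_smul_comm, map_smul, map_smul, hy, smul_zero]
        | zero => simp
        | add y z hy hz => rw [add_mul, add_mul, map_add, map_add, hy, hz, add_zero]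
        | smul r y hy => rw [smul_mul_assoc, smul_mul_assoc, map_smul, map_smul, hy, smul_zero]
      | zero => intro a b; simp
      | add x y _ _ hx hy =>
        intro a b
        rw [mul_add, add_mul, map_add, map_add, hx, hy, add_zero]
      | neg x _ hx => intro a b; rw [mul_neg, neg_mul, map_neg, map_neg, hx, neg_zero]
      | left_absorb r x _ hx => intro a b; rw [← mul_assoc, hx]
      | right_absorb r x _ hx => intro a b; rw [← mul_assoc, mul_assoc, hx]
    have h1 := key 1 1
    have h2 : ∑ i, (l' i : ℤ) < (m : ℤ) := by exact_mod_cast hl'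
    rwa [one_mul, mul_one, wtProj_of_mem_homog _ hxl, if_pos h2] at h1
  rw [← hS] at hp
  induction hp using TwoSidedIdeal.span_induction with
  | mem x hx =>
    obtain ⟨l, hl, h0⟩ := h x hx
    exact main _ x hx l hl rfl h0
  | zero => exact map_zero _
  | add x y _ _ hx hy => rw [map_add, hx, hy, add_zero]
  | neg x _ hx => rw [map_neg, hx, neg_zero]
  | left_absorb a x _ hx => rw [map_mul, hx, mul_zero]
  | right_absorb b x _ hx => rw [map_mul, hx, zero_mul]

end Datum

end CoidealOperators

end PreNichols

namespace PreNichols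

/-! ## Modules over the Drinfeld double -/

open TensorProduct

section DoubleModules

variable {k : Type*} [Field k] {n : ℕ}

open NCPoly

namespace Datum

variable (D : Datum k n)

/-! ### Homomorphisms from the Drinfeld double -/

section Lift

variable {R : Type*} [Ring R] [Algebra k R]

/-- Elements of an algebra satisfying the defining relations of `U(χ)`. -/
structure DoubleRelations (e f K L : Fin n → R) : Prop where
  K_mul_L : ∀ i, K i * L i = 1
  L_mul_K : ∀ i, L i * K i = 1
  K_comm : ∀ i j, K i * K j = K j * K i
  K_mul_e : ∀ i j, K i * e j = (D.χ.q i j : k) • (e j * K i)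
  K_mul_f : ∀ i j, K i * f j = (((D.χ.q i j)⁻¹ : kˣ) : k) • (f j * K i)
  commutator : ∀ i j, e i * f j - f j * e i = if i = j then K i - L i else 0
  lift_e : ∀ p ∈ D.I, FreeAlgebra.lift k e p = 0
  lift_f : ∀ p ∈ D.I, FreeAlgebra.lift k f p = 0

/-- The images of the generators. -/
def genImage (e f K L : Fin n → R) : Gen n → R
  | .e i => e i
  | .f i => f i
  | .K i => K i
  | .L i => L i

variable {D} {e f K L : Fin n → R}

theorem lift_lift_gen (g : Gen n → R) (s : Fin n → Gen n) (p : NCPoly k n) :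
    FreeAlgebra.lift k g (FreeAlgebra.lift k (fun i => gen (s i)) p) =
      FreeAlgebra.lift k (fun i => g (s i)) p := by
  have : (FreeAlgebra.lift k g).comp (FreeAlgebra.lift k (fun i => gen (s i))) =
      FreeAlgebra.lift k (fun i => g (s i)) := by
    ext; simp
  exact DFunLike.congr_fun this p

/-- The algebra homomorphism from `U(χ)` determined by the images of the generators. -/
noncomputable def liftU (h : D.DoubleRelations e f K L) : D.U →ₐ[k] R :=
  RingQuot.liftAlgHom k ⟨FreeAlgebra.lift k (genImage e f K L), by
    intro x y hxy
    induction hxy with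
    | KL i => simpa [genImage] using h.K_mul_L i
    | LK i => simpa [genImage] using h.L_mul_K i
    | KK i j => simpa [genImage] using h.K_comm i j
    | KE i j => simpa [genImage] using h.K_mul_e i j
    | KF i j => simpa [genImage] using h.K_mul_f i j
    | EF i j =>
      have := h.commutator i j
      split_ifs with hij
      · simpa [genImage, hij] using this
      · simpa [genImage, hij] using this
    | IE p hp => rw [lift_lift_gen, map_zero]; exact h.lift_e p hp
    | IF p hp => rw [lift_lift_gen, map_zero]; exact h.lift_f p hp⟩

theorem liftU_toU (h : D.DoubleRelations e f K L) (x : Free k n) :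
    liftU h (D.toU x) = FreeAlgebra.lift k (genImage e f K L) x :=
  RingQuot.liftAlgHom_mkAlgHom_apply _ _ _ _

theorem liftU_E (h : D.DoubleRelations e f K L) (i : Fin n) : liftU h (D.E i) = e i := by
  rw [E, liftU_toU, FreeAlgebra.lift_ι_apply]; rfl

theorem liftU_F (h : D.DoubleRelations e f K L) (i : Fin n) : liftU h (D.F i) = f i := by
  rw [F, liftU_toU, FreeAlgebra.lift_ι_apply]; rfl

theorem liftU_K (h : D.DoubleRelations e f K L) (i : Fin n) : liftU h (D.K i) = K i := by
  rw [Datum.K, liftU_toU, FreeAlgebra.lift_ι_apply]; rfl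

theorem liftU_Kinv (h : D.DoubleRelations e f K L) (i : Fin n) : liftU h (D.Kinv i) = L i := by
  rw [Kinv, liftU_toU, FreeAlgebra.lift_ι_apply]; rfl

end Lift

theorem toU_surjective : Function.Surjective D.toU := RingQuot.mkAlgHom_surjective k _

theorem U_induction {P : D.U → Prop} (algebraMap : ∀ r : k, P (algebraMap k D.U r))
    (add : ∀ x y, P x → P y → P (x + y)) (mul : ∀ x y, P x → P y → P (x * y))
    (E : ∀ i, P (D.E i)) (F : ∀ i, P (D.F i)) (K : ∀ i, P (D.K i)) (Kinv : ∀ i, P (D.Kinv i))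
    (x : D.U) : P x := by
  obtain ⟨y, rfl⟩ := D.toU_surjective x
  induction y using FreeAlgebra.induction with
  | grade0 r => rw [AlgHom.commutes]; exact algebraMap r
  | grade1 g =>
    cases g with
    | e i => exact E i
    | f i => exact F i
    | K i => exact K i
    | L i => exact Kinv i
  | mul a b ha hb => rw [map_mul]; exact mul _ _ ha hb
  | add a b ha hb => rw [map_add]; exact add _ _ ha hb

theorem doubleRelations : D.DoubleRelations D.E D.F D.K D.Kinv where
  K_mul_L := D.K_mul_Kinv
  L_mul_K := D.Kinv_mul_K
  K_comm i j := by simpa [Datum.K] using D.toU_rel (Rel.KK i j)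
  K_mul_e i j := by simpa [Datum.K, E] using D.toU_rel (Rel.KE i j)
  K_mul_f i j := by simpa [Datum.K, F] using D.toU_rel (Rel.KF i j)
  commutator i j := by
    have h := D.toU_rel (Rel.EF i j)
    split_ifs at h ⊢ with hij
    · simpa [E, F, Datum.K, Kinv] using h
    · simpa [E, F] using h
  lift_e p hp := by
    have h := D.toU_rel (Rel.IE p hp)
    rw [map_zero] at h
    rw [← h, ← AlgHom.comp_apply]
    congr 1
    ext; simp [E]
  lift_f p hp := by
    have h := D.toU_rel (Rel.IF p hp)
    rw [map_zero] at h
    rw [← h, ← AlgHom.comp_apply]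
    congr 1
    ext; simp [F]

/-! ### The symmetry exchanging E with F and K with its inverse. -/

section Swap

variable {R : Type*} [Ring R] [Algebra k R] {D} {e f K L : Fin n → R}

theorem DoubleRelations.L_comm (h : D.DoubleRelations e f K L) (i j : Fin n) :
    L i * L j = L j * L i := by
  have h1 : L i * L j * (K j * K i) = 1 := by
    rw [mul_assoc, ← mul_assoc (L j), h.L_mul_K, one_mul, h.L_mul_K]
  have h2 : K j * K i * (L j * L i) = 1 := by
    rw [h.K_comm, mul_assoc, ← mul_assoc (K j), h.K_mul_L, one_mul, h.K_mul_L]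
  exact left_inv_eq_right_inv h1 h2

theorem conj_smul_comm {K L x : R} (hKL : K * L = 1) (hLK : L * K = 1) {u : kˣ}
    (h : K * x = (u : k) • (x * K)) : L * x = ((u⁻¹ : kˣ) : k) • (x * L) := by
  have h1 : x * K = ((u⁻¹ : kˣ) : k) • (K * x) := by
    rw [h, smul_smul, Units.inv_mul, one_smul]
  calc L * x = L * (x * K) * L := by rw [mul_assoc, mul_assoc, hKL, mul_one]
    _ = _ := by rw [h1, mul_smul_comm, ← mul_assoc, hLK, one_mul, smul_mul_assoc]

theorem mul_sub_add_comm {K a b c : R} {s : k} (ha : K * a = s • (a * K))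
    (hb : K * b = s • (b * K)) (hc : K * c = s • (c * K)) :
    K * (a - b + c) = s • ((a - b + c) * K) := by
  rw [mul_add, mul_sub, ha, hb, hc, add_mul, sub_mul, smul_add, smul_sub]

theorem commutator_sub_add {e a b c x y : R} (ha : a * e = e * a) (hb : b * e = e * b + x)
    (hc : c * e = y + e * c) : e * (a - b + c) - (a - b + c) * e = x - y := by
  rw [add_mul, sub_mul, ha, hb, hc, mul_add, mul_sub]
  abel

theorem DoubleRelations.L_mul_e (h : D.DoubleRelations e f K L) (i j : Fin n) :
    L i * e j = (((D.χ.q i j)⁻¹ : kˣ) : k) • (e j * L i) :=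
  conj_smul_comm (h.K_mul_L i) (h.L_mul_K i) (h.K_mul_e i j)

theorem DoubleRelations.L_mul_f (h : D.DoubleRelations e f K L) (i j : Fin n) :
    L i * f j = (D.χ.q i j : k) • (f j * L i) := by
  have := conj_smul_comm (h.K_mul_L i) (h.L_mul_K i) (h.K_mul_f i j)
  rwa [inv_inv] at this

/-- The defining relations are invariant under this exchange, so one construction of induced modules
serves both the regular module and the Verma module. -/
theorem DoubleRelations.swap (h : D.DoubleRelations e f K L) : D.DoubleRelations f e L K where
  K_mul_L := h.L_mul_K
  L_mul_K := h.K_mul_L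
  K_comm := h.L_comm
  K_mul_e := h.L_mul_f
  K_mul_f := h.L_mul_e
  commutator i j := by
    have h1 := h.commutator j i
    rw [← neg_sub, h1]
    by_cases hij : i = j
    · subst hij; simp
    · simp [hij, Ne.symm hij]
  lift_e := h.lift_f
  lift_f := h.lift_e

end Swap

/-! ### Induced modules -/

/-- Operators `Fⱼ`, `Kᵢ`, `Kᵢ⁻¹` on a vector space that satisfy the relations of the negative Borel
part of `U(χ)`. -/
structure BorelModule (N : Type*) [AddCommGroup N] [Module k N] where
  F : Fin n → Module.End k N
  K : Fin n → Module.End k N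
  L : Fin n → Module.End k N
  K_mul_L : ∀ i, K i * L i = 1
  L_mul_K : ∀ i, L i * K i = 1
  K_comm : ∀ i j, K i * K j = K j * K i
  L_comm : ∀ i j, L i * L j = L j * L i
  K_mul_F : ∀ i j, K i * F j = (((D.χ.q i j)⁻¹ : kˣ) : k) • (F j * K i)
  lift_F : ∀ p ∈ D.I, FreeAlgebra.lift k F p = 0

namespace BorelModule

variable {D} {N : Type*} [AddCommGroup N] [Module k N] (M : D.BorelModule N)

theorem L_mul_F (i j : Fin n) : M.L i * M.F j = (D.χ.q i j : k) • (M.F j * M.L i) := by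
  have := conj_smul_comm (M.K_mul_L i) (M.L_mul_K i) (M.K_mul_F i j)
  rwa [inv_inv] at this

theorem K_mul_L_comm (i j : Fin n) : M.K i * M.L j = M.L j * M.K i := by
  calc M.K i * M.L j = (M.L j * M.K j) * M.K i * M.L j := by rw [M.L_mul_K, one_mul]
    _ = M.L j * M.K i * (M.K j * M.L j) := by
      rw [mul_assoc (M.L j), M.K_comm, ← mul_assoc, mul_assoc]
    _ = _ := by rw [M.K_mul_L, mul_one]

/-- The operator `Eᵢ` on the induced module `A ⊗ N`. -/
noncomputable def indE (i : Fin n) : Module.End k (D.A ⊗[k] N) :=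
  TensorProduct.map (D.mulX i) (1 : Module.End k N)

/-- The operator `Kᵢ` on the induced module. -/
noncomputable def indK (i : Fin n) : Module.End k (D.A ⊗[k] N) :=
  TensorProduct.map (D.twA (Pi.single i 1)) (M.K i)

/-- The operator `Kᵢ⁻¹` on the induced module. -/
noncomputable def indL (i : Fin n) : Module.End k (D.A ⊗[k] N) :=
  TensorProduct.map (D.twA (-Pi.single i 1)) (M.L i)

/-- The summand `1 ⊗ Fⱼ` of `Fⱼ` on the induced module. -/
noncomputable def indPhi (j : Fin n) : Module.End k (D.A ⊗[k] N) :=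
  TensorProduct.map (1 : Module.End k D.A) (M.F j)

/-- The raising part of `-Fⱼ` on the induced module. -/
noncomputable def indRho (j : Fin n) : Module.End k (D.A ⊗[k] N) :=
  TensorProduct.map (D.dRA j) (M.K j)

/-- The summand `Kⱼ⁻¹ ∂ⱼᴸ` of `Fⱼ` on the induced module. -/
noncomputable def indXi (j : Fin n) : Module.End k (D.A ⊗[k] N) :=
  TensorProduct.map (D.xi j) (M.L j)

/-- The operator `Fⱼ` on the induced module. -/
noncomputable def indF (j : Fin n) : Module.End k (D.A ⊗[k] N) :=
  -- Dictated by the identity Fⱼe = eFⱼ - ∂ⱼᴿ(e)Kⱼ + Kⱼ⁻¹∂ⱼᴸ(e) for e in U⁺.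
  M.indPhi j - M.indRho j + M.indXi j

theorem indF_one_tmul (j : Fin n) (x : N) : M.indF j (1 ⊗ₜ x) = 1 ⊗ₜ M.F j x := by
  simp [indF, indPhi, indRho, indXi, dRA_one, dLA_one, xi]

theorem indPhi_mul_indE (i j : Fin n) :
    M.indPhi j * indE i = indE i * M.indPhi j := by
  simp only [indPhi, indE, ← TensorProduct.map_mul, one_mul, mul_one]

theorem indRho_mul_indE (i j : Fin n) :
    M.indRho j * indE i = indE i * M.indRho j + if i = j then M.indK i else 0 := by
  simp only [indRho, indE, ← TensorProduct.map_mul, one_mul, mul_one, dRA_mul_mulX,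
    TensorProduct.map_add_left]
  by_cases hij : i = j
  · subst hij; simp [indK]
  · simp [hij, Ne.symm hij]

theorem indXi_mul_indE (i j : Fin n) :
    M.indXi j * indE i = (if i = j then M.indL i else 0) + indE i * M.indXi j := by
  simp only [indXi, indE, ← TensorProduct.map_mul, one_mul, mul_one, xi_mul_mulX,
    TensorProduct.map_add_left]
  by_cases hij : i = j
  · subst hij; simp [indL]
  · simp [hij]

theorem indK_mul_indPhi (i j : Fin n) :
    M.indK i * M.indPhi j = (((D.χ.q i j)⁻¹ : kˣ) : k) • (M.indPhi j * M.indK i) := by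
  simp only [indK, indPhi, ← TensorProduct.map_mul, M.K_mul_F, one_mul, mul_one,
    TensorProduct.map_smul_right]

theorem indK_mul_indRho (i j : Fin n) :
    M.indK i * M.indRho j = (((D.χ.q i j)⁻¹ : kˣ) : k) • (M.indRho j * M.indK i) := by
  simp only [indK, indRho, ← TensorProduct.map_mul, twA_mul_dRA, TensorProduct.map_smul_left,
    M.K_comm, SymmBicharacter.toFun_neg_left, toFun_single]

theorem indK_mul_indXi (i j : Fin n) :
    M.indK i * M.indXi j = (((D.χ.q i j)⁻¹ : kˣ) : k) • (M.indXi j * M.indK i) := by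
  simp only [indK, indXi, ← TensorProduct.map_mul, twA_mul_xi, TensorProduct.map_smul_left,
    M.K_mul_L_comm, SymmBicharacter.toFun_neg_left, toFun_single]

theorem indK_mul_indL (i : Fin n) : M.indK i * M.indL i = 1 := by
  simp only [indK, indL, ← TensorProduct.map_mul, twA_mul_twA, add_neg_cancel, twA_zero,
    M.K_mul_L, TensorProduct.map_one]

theorem indL_mul_indK (i : Fin n) : M.indL i * M.indK i = 1 := by
  simp only [indK, indL, ← TensorProduct.map_mul, twA_mul_twA, neg_add_cancel, twA_zero,
    M.L_mul_K, TensorProduct.map_one]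

theorem indK_mul_indF (i j : Fin n) :
    M.indK i * M.indF j = (((D.χ.q i j)⁻¹ : kˣ) : k) • (M.indF j * M.indK i) := by
  exact mul_sub_add_comm (R := Module.End k (D.A ⊗[k] N)) (M.indK_mul_indPhi i j)
    (M.indK_mul_indRho i j) (M.indK_mul_indXi i j)

theorem indE_commutator (i j : Fin n) :
    indE i * M.indF j - M.indF j * indE i = if i = j then M.indK i - M.indL i else 0 := by
  have h := commutator_sub_add (R := Module.End k (D.A ⊗[k] N)) (M.indPhi_mul_indE i j)
    (M.indRho_mul_indE i j) (M.indXi_mul_indE i j)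
  split_ifs at h ⊢
  · exact h
  · exact h.trans (sub_zero (0 : Module.End k (D.A ⊗[k] N)))

theorem lift_indE (p : NCPoly k n) (a : D.A) (x : N) :
    FreeAlgebra.lift k indE p (a ⊗ₜ x) = (D.toA p * a) ⊗ₜ[k] x := by
  have h : FreeAlgebra.lift k (indE (D := D) (N := N)) p =
    TensorProduct.map (FreeAlgebra.lift k D.mulX p) LinearMap.id := lift_map_id D.mulX p
  rw [h, lift_mulX]
  rfl

theorem lift_indF_one_tmul (p : NCPoly k n) (x : N) :
    FreeAlgebra.lift k M.indF p (1 ⊗ₜ x) = 1 ⊗ₜ FreeAlgebra.lift k M.F p x :=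
  (lift_intertwine (φ := TensorProduct.mk k D.A N 1) (Y := M.F) (Y' := M.indF)
    (fun j y => (M.indF_one_tmul j y).symm) p x).symm

/-- On 1 ⊗ x the operators Fⱼ act through N, where the relations hold; the vectors killed by the
relations are stable under the Eᵢ, which reach all of A ⊗ N from there. -/
theorem lift_indF_eq_zero {p : NCPoly k n} (hp : p ∈ D.I) :
    FreeAlgebra.lift k M.indF p = 0 := by
  ext a x
  rw [TensorProduct.AlgebraTensorModule.curry_apply, LinearMap.restrictScalars_self,
    TensorProduct.curry_apply]
  show _ = (0 : D.A ⊗[k] N)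
  revert p
  refine D.A_induction (P := fun a => ∀ {p : NCPoly k n}, p ∈ D.I →
    FreeAlgebra.lift k M.indF p (a ⊗ₜ x) = 0) ?_ ?_ (fun a b ha hb => ?_)
    (fun s a ha => ?_) (fun i a ha => ?_) a
  · intro p hp
    rw [lift_indF_one_tmul, M.lift_F p hp, LinearMap.zero_apply, TensorProduct.tmul_zero]
  · intro p _
    rw [TensorProduct.zero_tmul, map_zero]
  · intro p hp
    rw [TensorProduct.add_tmul, map_add, ha hp, hb hp, add_zero]
  · intro p hp
    rw [← TensorProduct.smul_tmul', map_smul, ha hp, smul_zero]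
  · intro p hp
    refine D.isPreNichols.lift_apply_apply_eq_zero (i := i) (E := indE i) (K := M.indK i)
      (L := M.indL i) (F := M.indF) (v := a ⊗ₜ x) (fun j => ?_) (fun j => ?_)
      (fun j => M.indE_commutator i j) (fun p hp => ha hp) hp
    · rw [indK_mul_indF, smul_smul, Units.mul_inv, one_smul]
    · have := conj_smul_comm (R := Module.End k (D.A ⊗[k] N)) (M.indK_mul_indL i)
        (M.indL_mul_indK i) (M.indK_mul_indF i j)
      rwa [inv_inv] at this

theorem ind_doubleRelations : D.DoubleRelations indE M.indF M.indK M.indL where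
  K_mul_L := M.indK_mul_indL
  L_mul_K := M.indL_mul_indK
  K_comm i j := by
    simp only [indK, ← TensorProduct.map_mul, M.K_comm i j]
    rw [twA_comm]
  K_mul_e i j := by
    simp only [indK, indE, ← TensorProduct.map_mul, twA_mul_mulX, TensorProduct.map_smul_left,
      one_mul, mul_one, toFun_single]
  K_mul_f := M.indK_mul_indF
  commutator := M.indE_commutator
  lift_e p hp := by
    ext a x
    rw [TensorProduct.AlgebraTensorModule.curry_apply, LinearMap.restrictScalars_self,
      TensorProduct.curry_apply, lift_indE, (D.toA_eq_zero_iff p).2 hp, zero_mul,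
      TensorProduct.zero_tmul]
    rfl
  lift_f _ hp := M.lift_indF_eq_zero hp

/-- The action of `U(χ)` on the induced module. -/
noncomputable def action : D.U →ₐ[k] Module.End k (D.A ⊗[k] N) := liftU M.ind_doubleRelations

/-- The action of `U(χ)` on the induced module, with the roles of the `Eᵢ` and the `Fᵢ`
interchanged. -/
noncomputable def swapAction : D.U →ₐ[k] Module.End k (D.A ⊗[k] N) :=
  liftU M.ind_doubleRelations.swap

end BorelModule

/-- The regular module of the negative Borel part; `single μ y` is the vector `y K_μ`. -/
noncomputable def regularModule : D.BorelModule ((Fin n → ℤ) →₀ D.A) where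
  F j := Finsupp.mapRange.linearMap (D.mulX j)
  K i := Finsupp.lsum k fun μ => Finsupp.lsingle (μ + Pi.single i 1) ∘ₗ D.twA (-Pi.single i 1)
  L i := Finsupp.lsum k fun μ => Finsupp.lsingle (μ - Pi.single i 1) ∘ₗ D.twA (Pi.single i 1)
  K_mul_L i := by
    refine Finsupp.lhom_ext fun μ y => ?_
    have h := LinearMap.congr_fun (D.twA_mul_twA (-Pi.single i 1) (Pi.single i 1)) y
    rw [neg_add_cancel, twA_zero, Module.End.mul_apply] at h
    simp [h]
  L_mul_K i := by
    refine Finsupp.lhom_ext fun μ y => ?_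
    have h := LinearMap.congr_fun (D.twA_mul_twA (Pi.single i 1) (-Pi.single i 1)) y
    rw [add_neg_cancel, twA_zero, Module.End.mul_apply] at h
    simp [h]
  K_comm i j := by
    refine Finsupp.lhom_ext fun μ y => ?_
    have h := LinearMap.congr_fun (D.twA_comm (-Pi.single i 1) (-Pi.single j 1)) y
    rw [Module.End.mul_apply, Module.End.mul_apply] at h
    simp [h, add_right_comm]
  L_comm i j := by
    refine Finsupp.lhom_ext fun μ y => ?_
    have h := LinearMap.congr_fun (D.twA_comm (Pi.single i 1) (Pi.single j 1)) y
    rw [Module.End.mul_apply, Module.End.mul_apply] at h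
    simp [h, sub_right_comm]
  K_mul_F i j := by
    refine Finsupp.lhom_ext fun μ y => ?_
    have h := LinearMap.congr_fun (D.twA_mul_mulX (-Pi.single i 1) j) y
    rw [Module.End.mul_apply, SymmBicharacter.toFun_neg_left, toFun_single] at h
    simp [h]
  lift_F p hp := by
    refine Finsupp.lhom_ext fun μ y => ?_
    have h := lift_intertwine (φ := Finsupp.lsingle (R := k) μ) (Y := D.mulX)
      (Y' := fun j => Finsupp.mapRange.linearMap (D.mulX j)) (fun j w => by simp) p y
    rw [lift_mulX, (D.toA_eq_zero_iff p).2 hp] at h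
    simpa using h.symm

/-- The group algebra of `ℤⁿ` as a module of the negative Borel part with trivial action of the
`Fⱼ`. -/
noncomputable def trivialModule : D.BorelModule ((Fin n → ℤ) →₀ k) where
  F _ := 0
  K i := Finsupp.lmapDomain k k fun μ => μ + Pi.single i 1
  L i := Finsupp.lmapDomain k k fun μ => μ - Pi.single i 1
  K_mul_L i := Finsupp.lhom_ext fun μ y => by simp [Finsupp.mapDomain_single]
  L_mul_K i := Finsupp.lhom_ext fun μ y => by simp [Finsupp.mapDomain_single]
  K_comm i j := Finsupp.lhom_ext fun μ y => by
    simp [Finsupp.mapDomain_single, add_right_comm]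
  L_comm i j := Finsupp.lhom_ext fun μ y => by
    simp [Finsupp.mapDomain_single, sub_right_comm]
  K_mul_F i j := by simp
  lift_F p hp := by
    refine LinearMap.ext fun x => ?_
    rw [lift_apply_of_apply_eq_zero (fun j => rfl), D.isPreNichols.counit_eq_zero hp, zero_smul]
    rfl

end Datum

end DoubleModules

end PreNichols

namespace PreNichols

/-! ## The triangular decomposition -/

open TensorProduct

section Triangular

variable {k : Type*} [Field k] {n : ℕ}

open NCPoly

theorem zn_induction {P : (Fin n → ℤ) → Prop} (zero : P 0) (add : ∀ a b, P a → P b → P (a + b))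
    (single : ∀ i, P (Pi.single i 1)) (neg : ∀ i, P (-Pi.single i 1)) (a : Fin n → ℤ) : P a := by
  let S : AddSubmonoid (Fin n → ℤ) :=
    { carrier := {a | P a}, zero_mem' := zero, add_mem' := fun {a b} ha hb => add a b ha hb }
  have h : ∀ i (m : ℤ), m • (Pi.single i 1 : Fin n → ℤ) ∈ S := by
    intro i m
    obtain ⟨m, rfl | rfl⟩ := m.eq_nat_or_neg
    · rw [natCast_zsmul]
      exact S.nsmul_mem (single i) m
    · rw [neg_smul, ← smul_neg, natCast_zsmul]
      exact S.nsmul_mem (neg i) m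
  have h2 : a = ∑ i, a i • (Pi.single i 1 : Fin n → ℤ) := by
    ext j
    simp [Finset.sum_apply, Pi.single_apply]
  rw [h2]
  exact S.sum_mem fun i _ => h i (a i)

namespace Datum

variable (D : Datum k n)

/-! ### The torus part -/

theorem Kunit_commute (i j : Fin n) : Commute (D.Kunit i) (D.Kunit j) :=
  Units.ext (D.doubleRelations.K_comm i j)

theorem Kpow_eq (a : Fin n → ℤ) :
    D.Kpow a = (((List.finRange n).map fun i => D.Kunit i ^ a i).prod : D.Uˣ) := by
  rw [Kpow, List.ofFn_eq_map]

theorem list_prod_map_mul_of_commute {G ι : Type*} [Monoid G] {f g : ι → G}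
    (h : ∀ i j, Commute (f i) (g j)) (l : List ι) :
    (l.map fun i => f i * g i).prod = (l.map f).prod * (l.map g).prod := by
  induction l with
  | nil => simp
  | cons a l ih =>
    have hc : Commute (g a) (l.map f).prod := by
      refine Commute.list_prod_right _ _ fun x hx => ?_
      obtain ⟨i, _, rfl⟩ := List.mem_map.1 hx
      exact (h i a).symm
    simp only [List.map_cons, List.prod_cons, ih]
    rw [mul_assoc, ← mul_assoc (g a), hc.eq]
    simp only [mul_assoc]

theorem Kpow_add (a b : Fin n → ℤ) : D.Kpow (a + b) = D.Kpow a * D.Kpow b := by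
  rw [Kpow_eq, Kpow_eq, Kpow_eq, ← Units.val_mul, ← list_prod_map_mul_of_commute]
  · simp only [Pi.add_apply, zpow_add]
  · exact fun i j => (D.Kunit_commute i j).zpow_zpow _ _

theorem Kpow_zero : D.Kpow 0 = 1 := by
  simp [Kpow_eq]

theorem Kpow_single (i : Fin n) : D.Kpow (Pi.single i 1) = D.K i := by
  rw [Kpow_eq, List.prod_map_eq_pow_single i _ (fun j hj _ => by simp [hj]),
    List.count_eq_one_of_mem (List.nodup_finRange n) (List.mem_finRange i)]
  simp [Kunit]

theorem Kpow_neg_single (i : Fin n) : D.Kpow (-Pi.single i 1) = D.Kinv i := by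
  have h : D.Kpow (-Pi.single i 1) * D.K i = 1 := by
    rw [← Kpow_single, ← Kpow_add, neg_add_cancel, Kpow_zero]
  exact left_inv_eq_right_inv h (D.K_mul_Kinv i)

theorem Kpow_mul_E (a : Fin n → ℤ) (j : Fin n) :
    D.Kpow a * D.E j = (D.χ.toFun a (Pi.single j 1) : k) • (D.E j * D.Kpow a) := by
  refine zn_induction (P := fun a => D.Kpow a * D.E j =
    (D.χ.toFun a (Pi.single j 1) : k) • (D.E j * D.Kpow a)) ?_ (fun a b ha hb => ?_)
    (fun i => ?_) (fun i => ?_) a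
  · simp [Kpow_zero, SymmBicharacter.toFun_zero_left]
  · rw [Kpow_add, mul_assoc, hb, mul_smul_comm, ← mul_assoc, ha, D.χ.map_add_left, smul_mul_assoc,
      smul_smul, mul_assoc, mul_comm, Units.val_mul]
  · rw [Kpow_single]; exact D.doubleRelations.K_mul_e i j
  · rw [Kpow_neg_single, SymmBicharacter.toFun_neg_left]; exact D.doubleRelations.L_mul_e i j

theorem Kpow_mul_F (a : Fin n → ℤ) (j : Fin n) :
    D.Kpow a * D.F j = (D.χ.toFun (-a) (Pi.single j 1) : k) • (D.F j * D.Kpow a) := by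
  refine zn_induction (P := fun a => D.Kpow a * D.F j =
    (D.χ.toFun (-a) (Pi.single j 1) : k) • (D.F j * D.Kpow a)) ?_ (fun a b ha hb => ?_)
    (fun i => ?_) (fun i => ?_) a
  · simp [Kpow_zero, SymmBicharacter.toFun_zero_left]
  · rw [Kpow_add, mul_assoc, hb, mul_smul_comm, ← mul_assoc, ha, neg_add, D.χ.map_add_left,
      smul_mul_assoc, smul_smul, mul_assoc, mul_comm, Units.val_mul]
  · rw [Kpow_single, SymmBicharacter.toFun_neg_left]; exact D.doubleRelations.K_mul_f i j
  · rw [Kpow_neg_single, neg_neg]; exact D.doubleRelations.L_mul_f i j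

theorem adjoin_Kpow_image (G : Set (Fin n → ℤ)) :
    Subalgebra.toSubmodule (Algebra.adjoin k (D.Kpow '' G)) =
      Submodule.span k (D.Kpow '' (AddSubmonoid.closure G : Set (Fin n → ℤ))) := by
  rw [Algebra.adjoin_eq_span]
  congr 1
  apply Set.Subset.antisymm
  · intro x hx
    induction hx using Submonoid.closure_induction with
    | mem x hx =>
      obtain ⟨a, ha, rfl⟩ := hx
      exact ⟨a, AddSubmonoid.subset_closure ha, rfl⟩
    | one => exact ⟨0, zero_mem _, D.Kpow_zero⟩
    | mul x y _ _ hx hy =>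
      obtain ⟨a, ha, rfl⟩ := hx
      obtain ⟨b, hb, rfl⟩ := hy
      exact ⟨a + b, add_mem ha hb, D.Kpow_add a b⟩
  · rintro _ ⟨a, ha, rfl⟩
    induction ha using AddSubmonoid.closure_induction with
    | mem a ha => exact Submonoid.subset_closure ⟨a, ha, rfl⟩
    | zero => rw [Kpow_zero]; exact one_mem _
    | add a b _ _ ha hb => rw [Kpow_add]; exact mul_mem ha hb

theorem toSubmodule_H :
    Subalgebra.toSubmodule D.H = Submodule.span k (Set.range D.Kpow) := by
  have h1 : Set.range D.K ∪ Set.range D.Kinv =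
      D.Kpow '' (Set.range (fun i => Pi.single i 1) ∪ Set.range (fun i => -Pi.single i 1)) := by
    rw [Set.image_union, ← Set.range_comp, ← Set.range_comp]
    congr 2
    · ext i; exact (D.Kpow_single i).symm
    · ext i; exact (D.Kpow_neg_single i).symm
  have h2 : AddSubmonoid.closure (Set.range (fun i : Fin n => (Pi.single i 1 : Fin n → ℤ)) ∪
      Set.range (fun i => -Pi.single i 1)) = ⊤ := by
    rw [eq_top_iff]
    intro a _
    exact zn_induction (zero_mem _) (fun a b ha hb => add_mem ha hb)
      (fun i => AddSubmonoid.subset_closure (Or.inl ⟨i, rfl⟩))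
      (fun i => AddSubmonoid.subset_closure (Or.inr ⟨i, rfl⟩)) a
  rw [H, h1, adjoin_Kpow_image, h2, AddSubmonoid.coe_top, Set.image_univ]

/-- The weights occurring in `H_θ`. -/
def thetaLattice : AddSubmonoid (Fin n → ℤ) :=
  -- Generating as a monoid is enough: τ is an involution, so the generators are closed under
  -- negation.
  AddSubmonoid.closure (Set.range fun i => Pi.single i 1 - Pi.single (D.τ i) 1)

theorem Kpow_single_sub (i j : Fin n) :
    D.Kpow (Pi.single i 1 - Pi.single j 1) = D.K i * D.Kinv j := by
  rw [sub_eq_add_neg, Kpow_add, Kpow_single, Kpow_neg_single]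

theorem toSubmodule_Htheta : Subalgebra.toSubmodule D.Htheta =
    Submodule.span k (D.Kpow '' (D.thetaLattice : Set (Fin n → ℤ))) := by
  have h1 : (Set.range fun i => D.K i * D.Kinv (D.τ i)) =
      D.Kpow '' (Set.range fun i => Pi.single i 1 - Pi.single (D.τ i) 1) := by
    rw [← Set.range_comp]
    congr 1
    ext i
    exact (D.Kpow_single_sub _ _).symm
  rw [Htheta, h1, adjoin_Kpow_image]
  rfl

/-! ### Evaluation maps from the pre-Nichols algebra -/

/-- The map `A → U(χ)` with `Xᵢ ↦ Eᵢ`. -/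
noncomputable def evE : D.A →ₗ[k] D.U :=
  D.descend (FreeAlgebra.lift k D.E).toLinearMap D.doubleRelations.lift_e

/-- The map `A → U(χ)` with `Xᵢ ↦ Fᵢ`. -/
noncomputable def evF : D.A →ₗ[k] D.U :=
  D.descend (FreeAlgebra.lift k D.F).toLinearMap D.doubleRelations.lift_f

theorem evE_toA (p : NCPoly k n) : D.evE (D.toA p) = FreeAlgebra.lift k D.E p :=
  D.descend_toA _ _ p

theorem evF_toA (p : NCPoly k n) : D.evF (D.toA p) = FreeAlgebra.lift k D.F p :=
  D.descend_toA _ _ p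

theorem evE_one : D.evE 1 = 1 := by rw [← toA_one, evE_toA, map_one]

theorem evF_one : D.evF 1 = 1 := by rw [← toA_one, evF_toA, map_one]

theorem evE_X_mul (i : Fin n) (a : D.A) : D.evE (D.X i * a) = D.E i * D.evE a := by
  obtain ⟨p, rfl⟩ := D.toA_surjective a
  rw [← toA_ι_mul, evE_toA, evE_toA, map_mul, FreeAlgebra.lift_ι_apply]

theorem evF_mul (a b : D.A) : D.evF (a * b) = D.evF a * D.evF b := by
  obtain ⟨p, rfl⟩ := D.toA_surjective a
  obtain ⟨p', rfl⟩ := D.toA_surjective b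
  rw [← map_mul, evF_toA, evF_toA, evF_toA, map_mul]

theorem evF_X (i : Fin n) : D.evF (D.X i) = D.F i := by
  rw [X, evF_toA, FreeAlgebra.lift_ι_apply]

theorem Kpow_mul_evE (a : Fin n → ℤ) (x : D.A) :
    D.Kpow a * D.evE x = D.evE (D.twA a x) * D.Kpow a := by
  obtain ⟨p, rfl⟩ := D.toA_surjective x
  rw [twA_toA, evE_toA, evE_toA]
  exact D.χ.mul_lift_comm (D.Kpow_mul_E a) p

theorem Kpow_mul_evF (a : Fin n → ℤ) (x : D.A) :
    D.Kpow a * D.evF x = D.evF (D.twA (-a) x) * D.Kpow a := by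
  obtain ⟨p, rfl⟩ := D.toA_surjective x
  rw [twA_toA, evF_toA, evF_toA]
  exact D.χ.mul_lift_comm (D.Kpow_mul_F a) p

theorem evF_mul_Kpow (a : Fin n → ℤ) (x : D.A) :
    D.evF x * D.Kpow a = D.Kpow a * D.evF (D.twA a x) := by
  have h := LinearMap.congr_fun (D.twA_mul_twA (-a) a) x
  rw [neg_add_cancel, twA_zero, Module.End.mul_apply] at h
  rw [Kpow_mul_evF, h]
  rfl

theorem E_mul_evF (i : Fin n) (x : D.A) : D.E i * D.evF x - D.evF x * D.E i =
    D.K i * D.evF (D.dLA i x) - D.evF (D.dRA i x) * D.Kinv i := by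
  obtain ⟨p, rfl⟩ := D.toA_surjective x
  rw [dLA_toA, dRA_toA, evF_toA, evF_toA, evF_toA]
  refine D.χ.commutator_lift (fun j => ?_) (fun j => D.doubleRelations.L_mul_f i j)
    (fun j => D.doubleRelations.commutator i j) p
  rw [D.doubleRelations.K_mul_f, smul_smul, Units.mul_inv, one_smul]

theorem F_mul_evE (i : Fin n) (x : D.A) : D.F i * D.evE x - D.evE x * D.F i =
    D.Kinv i * D.evE (D.dLA i x) - D.evE (D.dRA i x) * D.K i := by
  obtain ⟨p, rfl⟩ := D.toA_surjective x
  rw [dLA_toA, dRA_toA, evE_toA, evE_toA, evE_toA]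
  refine D.χ.commutator_lift (fun j => ?_) (fun j => D.doubleRelations.swap.L_mul_f i j)
    (fun j => D.doubleRelations.swap.commutator i j) p
  rw [D.doubleRelations.swap.K_mul_f, smul_smul, Units.mul_inv, one_smul]

/-! ### The triangular decomposition -/

/-- The map `single μ y ↦ y(F) K_μ`. -/
noncomputable def borelMap : ((Fin n → ℤ) →₀ D.A) →ₗ[k] D.U :=
  Finsupp.lsum k fun μ => LinearMap.mulRight k (D.Kpow μ) ∘ₗ D.evF

theorem borelMap_single (μ : Fin n → ℤ) (y : D.A) :
    D.borelMap (Finsupp.single μ y) = D.evF y * D.Kpow μ := by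
  simp [borelMap]

/-- The map `e ⊗ single μ y ↦ e(E) y(F) K_μ`. -/
noncomputable def triMap : D.A ⊗[k] ((Fin n → ℤ) →₀ D.A) →ₗ[k] D.U :=
  TensorProduct.lift ((LinearMap.mul k D.U).compl₁₂ D.evE D.borelMap)

theorem triMap_tmul (a : D.A) (f : (Fin n → ℤ) →₀ D.A) :
    D.triMap (a ⊗ₜ f) = D.evE a * D.borelMap f := rfl

theorem regularModule_F_single (j : Fin n) (μ : Fin n → ℤ) (y : D.A) :
    D.regularModule.F j (Finsupp.single μ y) = Finsupp.single μ (D.X j * y) := by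
  simp [regularModule, mulX_apply]

theorem regularModule_K_single (i : Fin n) (μ : Fin n → ℤ) (y : D.A) :
    D.regularModule.K i (Finsupp.single μ y) =
      Finsupp.single (μ + Pi.single i 1) (D.twA (-Pi.single i 1) y) := by
  simp [regularModule]

theorem regularModule_L_single (i : Fin n) (μ : Fin n → ℤ) (y : D.A) :
    D.regularModule.L i (Finsupp.single μ y) =
      Finsupp.single (μ - Pi.single i 1) (D.twA (Pi.single i 1) y) := by
  simp [regularModule]

theorem F_mul_borelMap (j : Fin n) (f : (Fin n → ℤ) →₀ D.A) :
    D.F j * D.borelMap f = D.borelMap (D.regularModule.F j f) := by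
  induction f using Finsupp.induction_linear with
  | zero => simp
  | add f g hf hg => rw [map_add, mul_add, hf, hg, map_add, map_add]
  | single μ y =>
    rw [regularModule_F_single, borelMap_single, borelMap_single, evF_mul, evF_X, mul_assoc]

theorem K_mul_borelMap (j : Fin n) (f : (Fin n → ℤ) →₀ D.A) :
    D.K j * D.borelMap f = D.borelMap (D.regularModule.K j f) := by
  induction f using Finsupp.induction_linear with
  | zero => simp
  | add f g hf hg => rw [map_add, mul_add, hf, hg, map_add, map_add]
  | single μ y =>
    rw [regularModule_K_single, borelMap_single, borelMap_single, ← Kpow_single, ← mul_assoc,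
      Kpow_mul_evF, mul_assoc, add_comm μ, Kpow_add]

theorem Kinv_mul_borelMap (j : Fin n) (f : (Fin n → ℤ) →₀ D.A) :
    D.Kinv j * D.borelMap f = D.borelMap (D.regularModule.L j f) := by
  induction f using Finsupp.induction_linear with
  | zero => simp
  | add f g hf hg => rw [map_add, mul_add, hf, hg, map_add, map_add]
  | single μ y =>
    rw [regularModule_L_single, borelMap_single, borelMap_single, ← Kpow_neg_single, ← mul_assoc,
      Kpow_mul_evF, mul_assoc, sub_eq_neg_add μ, Kpow_add, neg_neg]

/-- The multiplication map to U(χ) is linear over U(χ): the formulas of the induced module are those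
for pushing a generator past e(E) into U⁻H. -/
theorem triMap_action (u : D.U) (m : D.A ⊗[k] ((Fin n → ℤ) →₀ D.A)) :
    D.triMap (D.regularModule.action u m) = u * D.triMap m := by
  revert m
  refine D.U_induction (P := fun u => ∀ m, D.triMap (D.regularModule.action u m) = u * D.triMap m)
    (fun r m => ?_) (fun x y hx hy m => ?_) (fun x y hx hy m => ?_) (fun i m => ?_)
    (fun i m => ?_) (fun i m => ?_) (fun i m => ?_) u
  · rw [AlgHom.commutes, Module.algebraMap_end_apply, map_smul, Algebra.smul_def]
  · rw [map_add, LinearMap.add_apply, map_add, hx, hy, add_mul]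
  · rw [map_mul, Module.End.mul_apply, hx, hy, mul_assoc]
  · rw [BorelModule.action, liftU_E]
    induction m with
    | zero => simp
    | tmul a f =>
      rw [BorelModule.indE, TensorProduct.map_tmul, mulX_apply, triMap_tmul, triMap_tmul,
        evE_X_mul, mul_assoc]
      rfl
    | add a b ha hb => rw [map_add, map_add, ha, hb, map_add, mul_add]
  · rw [BorelModule.action, liftU_F]
    induction m with
    | zero => simp
    | tmul a f =>
      have h := D.F_mul_evE i a
      rw [sub_eq_iff_eq_add] at h
      have h2 : D.regularModule.indF i (a ⊗ₜ f) = a ⊗ₜ (D.regularModule.F i f) -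
          D.dRA i a ⊗ₜ (D.regularModule.K i f) + D.xi i a ⊗ₜ (D.regularModule.L i f) := rfl
      rw [h2, map_add, map_sub, triMap_tmul, triMap_tmul, triMap_tmul, triMap_tmul,
        ← F_mul_borelMap, ← K_mul_borelMap, ← Kinv_mul_borelMap, ← mul_assoc (D.F i), h, xi,
        Module.End.mul_apply, ← Kpow_neg_single, Kpow_mul_evE]
      simp only [add_mul, sub_mul, mul_assoc]
      abel
    | add a b ha hb => rw [map_add, map_add, ha, hb, map_add, mul_add]
  · rw [BorelModule.action, liftU_K]
    induction m with
    | zero => simp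
    | tmul a f =>
      rw [BorelModule.indK, TensorProduct.map_tmul, triMap_tmul, triMap_tmul,
        ← K_mul_borelMap, ← mul_assoc, ← mul_assoc, ← Kpow_single, Kpow_mul_evE]
    | add a b ha hb => rw [map_add, map_add, ha, hb, map_add, mul_add]
  · rw [BorelModule.action, liftU_Kinv]
    induction m with
    | zero => simp
    | tmul a f =>
      rw [BorelModule.indL, TensorProduct.map_tmul, triMap_tmul, triMap_tmul,
        ← Kinv_mul_borelMap, ← mul_assoc, ← mul_assoc, ← Kpow_neg_single, Kpow_mul_evE]
    | add a b ha hb => rw [map_add, map_add, ha, hb, map_add, mul_add]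

/-- The cyclic vector of the regular induced module. -/
noncomputable def cyclicVec : D.A ⊗[k] ((Fin n → ℤ) →₀ D.A) := 1 ⊗ₜ Finsupp.single 0 1

theorem triMap_cyclicVec : D.triMap D.cyclicVec = 1 := by
  rw [cyclicVec, triMap_tmul, borelMap_single, evE_one, evF_one, Kpow_zero, mul_one, mul_one]

theorem triMap_action_cyclicVec (u : D.U) :
    D.triMap (D.regularModule.action u D.cyclicVec) = u := by
  rw [triMap_action, triMap_cyclicVec, mul_one]

theorem action_evE {N : Type*} [AddCommGroup N] [Module k N] (M : D.BorelModule N) (a b : D.A)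
    (x : N) : M.action (D.evE a) (b ⊗ₜ x) = (a * b) ⊗ₜ x := by
  obtain ⟨p, rfl⟩ := D.toA_surjective a
  have h : M.action.comp (FreeAlgebra.lift k D.E) = FreeAlgebra.lift k BorelModule.indE := by
    ext1; ext1 i
    simp only [Function.comp_apply, AlgHom.comp_apply, FreeAlgebra.lift_ι_apply]
    exact liftU_E _ i
  rw [evE_toA, ← AlgHom.comp_apply, h, BorelModule.lift_indE]

theorem action_evF {N : Type*} [AddCommGroup N] [Module k N] (M : D.BorelModule N)
    (p : NCPoly k n) (x : N) :
    M.action (D.evF (D.toA p)) (1 ⊗ₜ x) = 1 ⊗ₜ FreeAlgebra.lift k M.F p x := by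
  have h : M.action.comp (FreeAlgebra.lift k D.F) = FreeAlgebra.lift k M.indF := by
    ext1; ext1 i
    simp only [Function.comp_apply, AlgHom.comp_apply, FreeAlgebra.lift_ι_apply]
    exact liftU_F _ i
  rw [evF_toA, ← AlgHom.comp_apply, h, BorelModule.lift_indF_one_tmul]

theorem action_Kpow_cyclic (a : Fin n → ℤ) (μ : Fin n → ℤ) :
    D.regularModule.action (D.Kpow a) (1 ⊗ₜ Finsupp.single μ 1) = 1 ⊗ₜ Finsupp.single (μ + a) 1 := by
  revert μ
  refine zn_induction (P := fun a => ∀ μ, D.regularModule.action (D.Kpow a)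
    (1 ⊗ₜ Finsupp.single μ 1) = 1 ⊗ₜ Finsupp.single (μ + a) 1) (fun μ => ?_)
    (fun a b ha hb μ => ?_) (fun i μ => ?_) (fun i μ => ?_) a
  · rw [Kpow_zero, map_one, add_zero]; rfl
  · rw [Kpow_add, map_mul, Module.End.mul_apply, hb, ha, add_assoc, add_comm b]
  · rw [Kpow_single, BorelModule.action, liftU_K, BorelModule.indK, TensorProduct.map_tmul,
      regularModule_K_single, twA_one, twA_one]
  · rw [Kpow_neg_single, BorelModule.action, liftU_Kinv, BorelModule.indL, TensorProduct.map_tmul,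
      regularModule_L_single, twA_one, twA_one, sub_eq_add_neg]

/-- Applied to the cyclic vector, the factors of e(E)y(F)K_μ act one after the other without
correction terms: K_μ shifts the index, the Fⱼ act only on N because the first leg is still 1, and
the Eᵢ multiply on A. -/
theorem action_triMap_cyclicVec (m : D.A ⊗[k] ((Fin n → ℤ) →₀ D.A)) :
    D.regularModule.action (D.triMap m) D.cyclicVec = m := by
  induction m with
  | zero => simp
  | add a b ha hb => rw [map_add, map_add, LinearMap.add_apply, ha, hb]
  | tmul a f =>
    induction f using Finsupp.induction_linear with
    | zero => simp
    | add f g hf hg =>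
      rw [TensorProduct.tmul_add, map_add, map_add, LinearMap.add_apply, hf, hg]
    | single μ y =>
      obtain ⟨p, rfl⟩ := D.toA_surjective y
      have h := lift_intertwine (φ := Finsupp.lsingle (R := k) μ) (Y := D.mulX)
        (Y' := D.regularModule.F) (fun j w => (D.regularModule_F_single j μ w).symm) p 1
      rw [lift_mulX, LinearMap.mulLeft_apply, mul_one] at h
      rw [triMap_tmul, borelMap_single, map_mul, map_mul, Module.End.mul_apply,
        Module.End.mul_apply, cyclicVec, action_Kpow_cyclic, action_evF, zero_add, action_evE,
        mul_one, ← Finsupp.lsingle_apply (R := k), ← h]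
      rfl

/-- The triangular decomposition `A ⊗ k[ℤⁿ] ⊗ A ≃ U(χ)`. -/
noncomputable def triEquiv : D.A ⊗[k] ((Fin n → ℤ) →₀ D.A) ≃ₗ[k] D.U :=
  LinearEquiv.ofLinearMap D.triMap
    (LinearMap.applyₗ D.cyclicVec ∘ₗ D.regularModule.action.toLinearMap)
    (LinearMap.ext fun u => D.triMap_action_cyclicVec u)
    (LinearMap.ext fun m => D.action_triMap_cyclicVec m)

theorem triEquiv_apply (m : D.A ⊗[k] ((Fin n → ℤ) →₀ D.A)) : D.triEquiv m = D.triMap m := rfl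

theorem triEquiv_symm_apply (u : D.U) :
    D.triEquiv.symm u = D.regularModule.action u D.cyclicVec := rfl

/-! ### The Verma module -/

/-- The action of `U(χ)` on the Verma module with basis vectors `y(F) K_μ`, which are represented by
`y ⊗ single (-μ) 1`. -/
noncomputable def vermaAction : D.U →ₐ[k] Module.End k (D.A ⊗[k] ((Fin n → ℤ) →₀ k)) :=
  D.trivialModule.swapAction

theorem vermaAction_evF (a b : D.A) (x : (Fin n → ℤ) →₀ k) :
    D.vermaAction (D.evF a) (b ⊗ₜ x) = (a * b) ⊗ₜ x := by
  obtain ⟨p, rfl⟩ := D.toA_surjective a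
  have h : D.vermaAction.comp (FreeAlgebra.lift k D.F) = FreeAlgebra.lift k BorelModule.indE := by
    ext1; ext1 i
    simp only [Function.comp_apply, AlgHom.comp_apply, FreeAlgebra.lift_ι_apply]
    exact liftU_F _ i
  rw [evF_toA, ← AlgHom.comp_apply, h, BorelModule.lift_indE]

theorem vermaAction_K (i : Fin n) (a : D.A) (μ : Fin n → ℤ) (r : k) :
    D.vermaAction (D.K i) (a ⊗ₜ Finsupp.single μ r) =
      D.twA (-Pi.single i 1) a ⊗ₜ Finsupp.single (μ - Pi.single i 1) r := by
  rw [vermaAction, BorelModule.swapAction, liftU_K, BorelModule.indL, TensorProduct.map_tmul]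
  simp [trivialModule, Finsupp.mapDomain_single]

theorem vermaAction_Kinv (i : Fin n) (a : D.A) (μ : Fin n → ℤ) (r : k) :
    D.vermaAction (D.Kinv i) (a ⊗ₜ Finsupp.single μ r) =
      D.twA (Pi.single i 1) a ⊗ₜ Finsupp.single (μ + Pi.single i 1) r := by
  rw [vermaAction, BorelModule.swapAction, liftU_Kinv, BorelModule.indK, TensorProduct.map_tmul]
  simp [trivialModule, Finsupp.mapDomain_single]

theorem vermaAction_E (i : Fin n) (a : D.A) (μ : Fin n → ℤ) (r : k) :
    D.vermaAction (D.E i) (a ⊗ₜ Finsupp.single μ r) =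
      -(D.dRA i a ⊗ₜ Finsupp.single (μ + Pi.single i 1) r) +
        D.xi i a ⊗ₜ Finsupp.single (μ - Pi.single i 1) r := by
  have h : D.trivialModule.indF i (a ⊗ₜ Finsupp.single μ r) =
      a ⊗ₜ (D.trivialModule.F i (Finsupp.single μ r)) -
        D.dRA i a ⊗ₜ (D.trivialModule.K i (Finsupp.single μ r)) +
        D.xi i a ⊗ₜ (D.trivialModule.L i (Finsupp.single μ r)) := rfl
  rw [vermaAction, BorelModule.swapAction, liftU_E, h]
  simp [trivialModule, Finsupp.mapDomain_single]

theorem vermaAction_Kpow (a : Fin n → ℤ) (μ : Fin n → ℤ) (r : k) :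
    D.vermaAction (D.Kpow a) (1 ⊗ₜ Finsupp.single μ r) = 1 ⊗ₜ Finsupp.single (μ - a) r := by
  revert μ
  refine zn_induction (P := fun a => ∀ μ, D.vermaAction (D.Kpow a)
    (1 ⊗ₜ Finsupp.single μ r) = 1 ⊗ₜ Finsupp.single (μ - a) r) (fun μ => ?_)
    (fun a b ha hb μ => ?_) (fun i μ => ?_) (fun i μ => ?_) a
  · rw [Kpow_zero, map_one, sub_zero]; rfl
  · rw [Kpow_add, map_mul, Module.End.mul_apply, hb, ha, sub_sub, add_comm b]
  · rw [Kpow_single, vermaAction_K, twA_one]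
  · rw [Kpow_neg_single, vermaAction_Kinv, twA_one, sub_neg_eq_add]

theorem vermaAction_evF_Kpow (a : D.A) (μ : Fin n → ℤ) :
    D.vermaAction (D.evF a * D.Kpow μ) (1 ⊗ₜ Finsupp.single 0 1) =
      a ⊗ₜ Finsupp.single (-μ) 1 := by
  rw [map_mul, Module.End.mul_apply, vermaAction_Kpow, vermaAction_evF, mul_one, zero_sub]

/-- The element y(F) sends the generating vector of the Verma module to y ⊗ `single 0 1`, from which
y can be read off. -/
theorem evF_injective : Function.Injective D.evF := by
  have h : ∀ a : D.A, (TensorProduct.rid k D.A).toLinearMap (TensorProduct.map LinearMap.id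
      (Finsupp.lapply (R := k) (M := k) (0 : Fin n → ℤ))
      (D.vermaAction (D.evF a) (1 ⊗ₜ Finsupp.single 0 1))) = a := by
    intro a
    simp [vermaAction_evF]
  intro a b hab
  rw [← h a, hab, h b]

theorem lift_F_eq_zero_iff (p : NCPoly k n) : FreeAlgebra.lift k D.F p = 0 ↔ p ∈ D.I := by
  rw [← evF_toA, ← D.toA_eq_zero_iff, map_eq_zero_iff _ D.evF_injective]

end Datum

end Triangular

end PreNichols

namespace PreNichols

/-! ## Direct sum decompositions -/

open TensorProduct

section Projections

variable {k : Type*} [Field k] {ι M M' : Type*} [DecidableEq ι] [AddCommGroup M] [Module k M]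
  [AddCommGroup M'] [Module k M']

/-- The candidate projections take values in a coordinate space M' containing M through φ, so they
can be written down before M itself is known to decompose. -/
theorem isInternal_of_projections {W : ι → Submodule k M} {φ : M →ₗ[k] M'}
    (hφ : Function.Injective φ) {π : ι → M →ₗ[k] M'}
    (h : ∀ i j, ∀ x ∈ W j, π i x = if j = i then φ x else 0) (top : ⨆ i, W i = ⊤) :
    DirectSum.IsInternal W := by
  refine DirectSum.isInternal_submodule_of_iSupIndep_of_iSup_eq_top (fun i => ?_) top
  rw [Submodule.disjoint_def]
  intro x hx hx'
  have h0 : (⨆ j, ⨆ (_ : j ≠ i), W j) ≤ LinearMap.ker (π i) := by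
    refine iSup₂_le fun j hj y hy => ?_
    rw [LinearMap.mem_ker, h i j y hy, if_neg hj]
  have h1 := h i i x hx
  rw [if_pos rfl, LinearMap.mem_ker.1 (h0 hx')] at h1
  exact (map_eq_zero_iff φ hφ).1 h1.symm

theorem apply_summandProj {W : ι → Submodule k M} {φ : M →ₗ[k] M'}
    (hφ : Function.Injective φ) {π : ι → M →ₗ[k] M'}
    (h : ∀ i j, ∀ x ∈ W j, π i x = if j = i then φ x else 0) (top : ⨆ i, W i = ⊤) (i : ι) (x : M) :
    φ (summandProj W i x) = π i x := by
  classical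
  have hW := isInternal_of_projections hφ h top
  have key : ⨆ j, W j ≤ LinearMap.eqLocus (φ ∘ₗ summandProj W i) (π i) := by
    refine iSup_le fun j y hy => ?_
    rw [LinearMap.mem_eqLocus, h i j y hy, LinearMap.comp_apply, summandProj, dif_pos hW]
    have h2 : (LinearEquiv.ofBijective (DirectSum.coeLinearMap W) hW).symm y =
        DirectSum.lof k ι (fun j => W j) j ⟨y, hy⟩ := by
      rw [LinearEquiv.symm_apply_eq]
      exact (DirectSum.coeLinearMap_lof W j ⟨y, hy⟩).symm
    rw [LinearMap.comp_apply, LinearMap.comp_apply, LinearEquiv.coe_coe, h2]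
    by_cases hji : j = i
    · subst hji
      rw [DirectSum.component.lof_self, if_pos rfl]
      rfl
    · rw [DirectSum.component.of, dif_neg hji, if_neg hji, map_zero, map_zero]
  rw [top] at key
  exact key (Submodule.mem_top (x := x))

end Projections

section Decompositions

variable {k : Type*} [Field k] {n : ℕ}

open NCPoly

theorem toSubmodule_adjoin_range {R : Type*} [Ring R] [Algebra k R] (x : Fin n → R) :
    Subalgebra.toSubmodule (Algebra.adjoin k (Set.range x)) =
      Submodule.span k (Set.range fun J : List (Fin n) => (J.map x).prod) := by
  have h : Algebra.adjoin k (Set.range x) = (FreeAlgebra.lift k x).range := by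
    rw [← Algebra.map_top, ← FreeAlgebra.adjoin_range_ι, AlgHom.map_adjoin, ← Set.range_comp]
    congr 2
    ext i
    simp
  rw [h]
  have h2 : Subalgebra.toSubmodule (FreeAlgebra.lift k x).range =
      Submodule.map (FreeAlgebra.lift k x).toLinearMap ⊤ := by
    rw [Submodule.map_top]; rfl
  rw [h2, ← span_range_monomial, Submodule.map_span, ← Set.range_comp]
  congr 2
  ext J
  exact lift_monomial x J

theorem wt_eq_iff (J : List (Fin n)) (a : Fin n → ℕ) :
    wt J = (fun i => (a i : ℤ)) ↔ ∀ i, J.count i = a i := by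
  simp [funext_iff, wt]

namespace Datum

variable (D : Datum k n)

theorem span_range_toA_monomial :
    Submodule.span k (Set.range fun J : List (Fin n) => D.toA (monomial J)) = ⊤ := by
  have h := congrArg (Submodule.map D.toA.toLinearMap) (span_range_monomial (k := k) (n := n))
  rw [Submodule.map_span, ← Set.range_comp, Submodule.map_top,
    LinearMap.range_eq_top.2 D.toA_surjective] at h
  exact h

theorem A_induction_monomial {P : D.A → Prop} (mon : ∀ J, P (D.toA (monomial J))) (zero : P 0)
    (add : ∀ x y, P x → P y → P (x + y)) (smul : ∀ (a : k) x, P x → P (a • x)) (x : D.A) :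
    P x := by
  obtain ⟨p, rfl⟩ := D.toA_surjective x
  refine induction_monomial (P := fun p => P (D.toA p)) mon (by rwa [map_zero]) (fun x y hx hy => ?_)
    (fun a x hx => ?_) p
  · rw [map_add]; exact add _ _ hx hy
  · rw [map_smul]; exact smul _ _ hx

theorem evE_monomial (J : List (Fin n)) : D.evE (D.toA (monomial J)) = (J.map D.E).prod := by
  rw [evE_toA, lift_monomial]

theorem evF_monomial (J : List (Fin n)) : D.evF (D.toA (monomial J)) = (J.map D.F).prod := by
  rw [evF_toA, lift_monomial]

theorem twA_monomial (a : Fin n → ℤ) (J : List (Fin n)) :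
    D.twA a (D.toA (monomial J)) = (D.χ.twScalar a J : k) • D.toA (monomial J) := by
  rw [twA_toA, SymmBicharacter.tw_monomial, map_smul]

theorem wtProjA_monomial (Q : (Fin n → ℤ) → Prop) [DecidablePred Q] (J : List (Fin n)) :
    D.wtProjA Q (D.toA (monomial J)) = if Q (wt J) then D.toA (monomial J) else 0 := by
  rw [wtProjA_toA, wtProj_monomial]
  split_ifs <;> simp

/-- The monomial tensors in `A ⊗ k[ℤⁿ] ⊗ A`. -/
noncomputable def tri (t : List (Fin n) × (Fin n → ℤ) × List (Fin n)) :
    D.A ⊗[k] ((Fin n → ℤ) →₀ D.A) :=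
  D.toA (monomial t.1) ⊗ₜ Finsupp.single t.2.1 (D.toA (monomial t.2.2))

theorem triMap_tri (J : List (Fin n)) (μ : Fin n → ℤ) (J' : List (Fin n)) :
    D.triMap (D.tri (J, μ, J')) = (J.map D.E).prod * (J'.map D.F).prod * D.Kpow μ := by
  rw [tri, triMap_tmul, borelMap_single, evE_monomial, evF_monomial, mul_assoc]

theorem list_prod_F_mul_Kpow (μ : Fin n → ℤ) (J : List (Fin n)) :
    (J.map D.F).prod * D.Kpow μ = (D.χ.twScalar μ J : k) • (D.Kpow μ * (J.map D.F).prod) := by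
  rw [← evF_monomial, evF_mul_Kpow, twA_monomial, map_smul, mul_smul_comm]

theorem span_range_tri : Submodule.span k (Set.range D.tri) = ⊤ := by
  rw [eq_top_iff]
  intro m _
  induction m with
  | zero => exact zero_mem _
  | add x y hx hy => exact add_mem (hx trivial) (hy trivial)
  | tmul a f =>
    induction f using Finsupp.induction_linear with
    | zero => rw [TensorProduct.tmul_zero]; exact zero_mem _
    | add f g hf hg => rw [TensorProduct.tmul_add]; exact add_mem (hf trivial) (hg trivial)
    | single μ y =>
      refine D.A_induction_monomial (P := fun a => a ⊗ₜ Finsupp.single μ y ∈ _) (fun J => ?_)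
        ?_ (fun x y hx hy => ?_) (fun r x hx => ?_) a
      · refine D.A_induction_monomial (P := fun y => _ ⊗ₜ Finsupp.single μ y ∈ _) (fun J' => ?_)
          ?_ (fun x y hx hy => ?_) (fun r x hx => ?_) y
        · exact Submodule.subset_span ⟨(J, μ, J'), rfl⟩
        · rw [Finsupp.single_zero, TensorProduct.tmul_zero]; exact zero_mem _
        · rw [Finsupp.single_add, TensorProduct.tmul_add]; exact add_mem hx hy
        · rw [← Finsupp.smul_single, TensorProduct.tmul_smul]; exact Submodule.smul_mem _ _ hx
      · rw [TensorProduct.zero_tmul]; exact zero_mem _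
      · rw [TensorProduct.add_tmul]; exact add_mem hx hy
      · rw [← TensorProduct.smul_tmul']; exact Submodule.smul_mem _ _ hx

section IndexedFamily

variable {D} {ι : Type*} {W : ι → Submodule k D.U}
  {idx : List (Fin n) × (Fin n → ℤ) × List (Fin n) → ι}
  {π : ι → Module.End k (D.A ⊗[k] ((Fin n → ℤ) →₀ D.A))}

/-- Both decompositions of U(χ) sort the monomials of the triangular decomposition by an index. The
monomials need not be linearly independent; operators that select an index on monomial tensors are
enough. -/
theorem projections_of_index [DecidableEq ι]
    (hW : ∀ i, W i ≤ Submodule.span k ((D.triMap ∘ D.tri) '' {t | idx t = i}))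
    (hπ : ∀ i t, π i (D.tri t) = if idx t = i then D.tri t else 0) (i j : ι) (x : D.U)
    (hx : x ∈ W j) : (π i ∘ₗ D.triEquiv.symm.toLinearMap) x =
      if j = i then D.triEquiv.symm.toLinearMap x else 0 := by
  have h2 : ∀ t, D.triEquiv.symm (D.triMap (D.tri t)) = D.tri t := fun t =>
    D.triEquiv.symm_apply_apply _
  by_cases hji : j = i
  · have h : W j ≤ LinearMap.eqLocus (π i ∘ₗ D.triEquiv.symm.toLinearMap)
        D.triEquiv.symm.toLinearMap := by
      refine (hW j).trans (Submodule.span_le.2 ?_)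
      rintro _ ⟨t, ht, rfl⟩
      simp only [SetLike.mem_coe, LinearMap.mem_eqLocus, Function.comp_apply, LinearMap.comp_apply,
        LinearEquiv.coe_coe, h2, hπ]
      rw [if_pos (Eq.trans ht hji)]
    rw [if_pos hji]
    exact h hx
  · have h : W j ≤ LinearMap.ker (π i ∘ₗ D.triEquiv.symm.toLinearMap) := by
      refine (hW j).trans (Submodule.span_le.2 ?_)
      rintro _ ⟨t, ht, rfl⟩
      simp only [SetLike.mem_coe, LinearMap.mem_ker, Function.comp_apply, LinearMap.comp_apply,
        LinearEquiv.coe_coe, h2, hπ]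
      rw [if_neg fun h => hji (ht.symm.trans h)]
    rw [if_neg hji]
    exact h hx

theorem iSup_eq_top_of_index (hW : ∀ t, D.triMap (D.tri t) ∈ W (idx t)) : ⨆ i, W i = ⊤ := by
  have h := congrArg (Submodule.map D.triEquiv.toLinearMap) D.span_range_tri
  rw [Submodule.map_span, ← Set.range_comp, Submodule.map_top, LinearEquiv.range] at h
  rw [eq_top_iff, ← h, Submodule.span_le]
  rintro _ ⟨t, rfl⟩
  exact Submodule.mem_iSup_of_mem (idx t) (hW t)

end IndexedFamily

/-! ### The decomposition by the degrees of both factors -/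

/-- The degrees of the factors of a monomial tensor. -/
def degIndex (t : List (Fin n) × (Fin n → ℤ) × List (Fin n)) : (Fin n → ℕ) × (Fin n → ℕ) :=
  (fun i => t.1.count i, fun i => t.2.2.count i)

/-- The projection onto the tensors whose factors have degrees `a` and `b`. -/
noncomputable def degProj (ab : (Fin n → ℕ) × (Fin n → ℕ)) :
    Module.End k (D.A ⊗[k] ((Fin n → ℤ) →₀ D.A)) :=
  TensorProduct.map (D.wtProjA fun w => w = fun i => (ab.1 i : ℤ))
    (Finsupp.mapRange.linearMap (D.wtProjA fun w => w = fun i => (ab.2 i : ℤ)))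

theorem degProj_tri (ab : (Fin n → ℕ) × (Fin n → ℕ))
    (t : List (Fin n) × (Fin n → ℤ) × List (Fin n)) :
    D.degProj ab (D.tri t) = if degIndex t = ab then D.tri t else 0 := by
  have h : degIndex t = ab ↔ wt t.1 = (fun i => (ab.1 i : ℤ)) ∧ wt t.2.2 = fun i => (ab.2 i : ℤ) := by
    rw [wt_eq_iff, wt_eq_iff, degIndex, Prod.ext_iff, funext_iff, funext_iff]
  rw [degProj, tri, TensorProduct.map_tmul, Finsupp.mapRange.linearMap_apply,
    Finsupp.mapRange_single, wtProjA_monomial, wtProjA_monomial, if_congr h rfl rfl]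
  by_cases h1 : wt t.1 = fun i => (ab.1 i : ℤ)
  · by_cases h2 : wt t.2.2 = fun i => (ab.2 i : ℤ)
    · simp [h1, h2]
    · simp [h2]
  · simp [h1]

theorem UHU_le (ab : (Fin n → ℕ) × (Fin n → ℕ)) :
    D.UHU ab ≤ Submodule.span k ((D.triMap ∘ D.tri) '' {t | degIndex t = ab}) := by
  rw [UHU, UplusHomog, UminusHomog, toSubmodule_H, Submodule.span_mul_span,
    Submodule.span_mul_span, Submodule.span_le]
  rintro _ ⟨_, ⟨_, ⟨J, hJ, rfl⟩, _, ⟨μ, rfl⟩, rfl⟩, _, ⟨J', hJ', rfl⟩, rfl⟩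
  have h : D.triMap (D.tri (J, μ, J')) = (D.χ.twScalar μ J' : k) •
      ((J.map D.E).prod * D.Kpow μ * (J'.map D.F).prod) := by
    rw [triMap_tri, mul_assoc, list_prod_F_mul_Kpow, mul_smul_comm, mul_assoc]
  have h2 : ((J.map D.E).prod * D.Kpow μ * (J'.map D.F).prod) =
      (((D.χ.twScalar μ J')⁻¹ : kˣ) : k) • D.triMap (D.tri (J, μ, J')) := by
    rw [h, smul_smul, Units.inv_mul, one_smul]
  simp only [SetLike.mem_coe, h2]
  refine Submodule.smul_mem _ _ (Submodule.subset_span ⟨(J, μ, J'), ?_, rfl⟩)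
  exact Prod.ext (funext hJ) (funext hJ')

theorem triMap_tri_mem_UHU (t : List (Fin n) × (Fin n → ℤ) × List (Fin n)) :
    D.triMap (D.tri t) ∈ D.UHU (degIndex t) := by
  obtain ⟨J, μ, J'⟩ := t
  rw [triMap_tri, mul_assoc, list_prod_F_mul_Kpow, mul_smul_comm, ← mul_assoc]
  refine Submodule.smul_mem _ _ (Submodule.mul_mem_mul (Submodule.mul_mem_mul ?_ ?_) ?_)
  · exact Submodule.subset_span ⟨J, fun i => rfl, rfl⟩
  · rw [toSubmodule_H]
    exact Submodule.subset_span ⟨μ, rfl⟩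
  · exact Submodule.subset_span ⟨J', fun i => rfl, rfl⟩

theorem isInternal_UHU : DirectSum.IsInternal D.UHU :=
  isInternal_of_projections D.triEquiv.symm.injective
    (projections_of_index D.UHU_le D.degProj_tri) (iSup_eq_top_of_index D.triMap_tri_mem_UHU)

theorem triEquiv_symm_proj (a b : Fin n → ℕ) (x : D.U) :
    D.triEquiv.symm (D.proj a b x) = D.degProj (a, b) (D.triEquiv.symm x) :=
  apply_summandProj (φ := D.triEquiv.symm.toLinearMap) D.triEquiv.symm.injective
    (projections_of_index D.UHU_le D.degProj_tri) (iSup_eq_top_of_index D.triMap_tri_mem_UHU) _ x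

/-! ### The decomposition by the torus part -/

/-- The index of the summand `U⁺ K_l G⁻` that contains a monomial tensor. -/
def torusIndex (t : List (Fin n) × (Fin n → ℤ) × List (Fin n)) : Fin n → ℤ := t.2.1 - wt t.2.2

/-- The endomorphism of the regular module of the Borel part projecting onto `K_l G⁻`. -/
noncomputable def borelTorusProj (l : Fin n → ℤ) : Module.End k ((Fin n → ℤ) →₀ D.A) :=
  Finsupp.lsum k fun μ => Finsupp.lsingle μ ∘ₗ D.wtProjA fun w => μ - w = l

theorem borelTorusProj_single (l μ : Fin n → ℤ) (y : D.A) :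
    D.borelTorusProj l (Finsupp.single μ y) =
      Finsupp.single μ (D.wtProjA (fun w => μ - w = l) y) := by
  simp [borelTorusProj]

/-- The projection onto the tensors that correspond to elements of `U⁺ K_l G⁻`. -/
noncomputable def torusProj (l : Fin n → ℤ) : Module.End k (D.A ⊗[k] ((Fin n → ℤ) →₀ D.A)) :=
  TensorProduct.map (1 : Module.End k D.A) (D.borelTorusProj l)

theorem torusProj_tri (l : Fin n → ℤ) (t : List (Fin n) × (Fin n → ℤ) × List (Fin n)) :
    D.torusProj l (D.tri t) = if torusIndex t = l then D.tri t else 0 := by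
  rw [torusProj, tri, TensorProduct.map_tmul, borelTorusProj_single, wtProjA_monomial, torusIndex]
  split_ifs <;> simp

/-- Collecting the Kⱼ on the right yields the weight of the word. Hence F_J K_μ lies in K_l G⁻ with
l = μ - wt J, which explains `torusIndex`. -/
theorem list_prod_F_mul_K (J : List (Fin n)) : ∃ s : kˣ,
    (J.map fun i => D.F i * D.K i).prod = (s : k) • ((J.map D.F).prod * D.Kpow (wt J)) := by
  induction J with
  | nil => exact ⟨1, by simp [wt_nil, Kpow_zero]⟩
  | cons j J ih =>
    obtain ⟨s, hs⟩ := ih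
    refine ⟨s * D.χ.twScalar (-Pi.single j 1) J, ?_⟩
    have h : D.K j * (J.map D.F).prod =
        (D.χ.twScalar (-Pi.single j 1) J : k) • ((J.map D.F).prod * D.K j) := by
      rw [← evF_monomial, ← Kpow_single, Kpow_mul_evF, twA_monomial, map_smul, smul_mul_assoc]
    rw [List.map_cons, List.prod_cons, hs, List.map_cons, List.prod_cons, wt_cons, add_comm,
      Kpow_add, Kpow_single, mul_smul_comm, mul_assoc, ← mul_assoc (D.K j), h, smul_mul_assoc,
      mul_smul_comm, smul_smul, Units.val_mul]
    simp only [mul_assoc]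

theorem exists_triMap_tri_eq (J J' : List (Fin n)) (l : Fin n → ℤ) : ∃ s : kˣ,
    (J.map D.E).prod * D.Kpow l * (J'.map fun i => D.F i * D.K i).prod =
      (s : k) • D.triMap (D.tri (J, l + wt J', J')) := by
  obtain ⟨s, hs⟩ := D.list_prod_F_mul_K J'
  refine ⟨s * (D.χ.twScalar l J')⁻¹, ?_⟩
  have h : D.Kpow l * (J'.map D.F).prod =
      (((D.χ.twScalar l J')⁻¹ : kˣ) : k) • ((J'.map D.F).prod * D.Kpow l) := by
    rw [list_prod_F_mul_Kpow, smul_smul, Units.inv_mul, one_smul]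
  rw [hs, mul_smul_comm, mul_assoc, ← mul_assoc (D.Kpow l), h, smul_mul_assoc, mul_smul_comm,
    smul_smul, triMap_tri, Kpow_add, Units.val_mul]
  simp only [mul_assoc]

theorem UKG_le (l : Fin n → ℤ) :
    D.UKG l ≤ Submodule.span k ((D.triMap ∘ D.tri) '' {t | torusIndex t = l}) := by
  rw [UKG, Uplus, Gminus, toSubmodule_adjoin_range, toSubmodule_adjoin_range,
    Submodule.span_mul_span, Submodule.span_mul_span, Submodule.span_le]
  rintro _ ⟨_, ⟨_, ⟨J, rfl⟩, _, rfl, rfl⟩, _, ⟨J', rfl⟩, rfl⟩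
  obtain ⟨s, hs⟩ := D.exists_triMap_tri_eq J J' l
  simp only [SetLike.mem_coe, hs]
  refine Submodule.smul_mem _ _ (Submodule.subset_span ⟨(J, l + wt J', J'), ?_, rfl⟩)
  simp [torusIndex]

theorem triMap_tri_mem_UKG (t : List (Fin n) × (Fin n → ℤ) × List (Fin n)) :
    D.triMap (D.tri t) ∈ D.UKG (torusIndex t) := by
  obtain ⟨J, μ, J'⟩ := t
  obtain ⟨s, hs⟩ := D.exists_triMap_tri_eq J J' (μ - wt J')
  have h : D.triMap (D.tri (J, μ, J')) = ((s⁻¹ : kˣ) : k) • ((J.map D.E).prod *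
      D.Kpow (μ - wt J') * (J'.map fun i => D.F i * D.K i).prod) := by
    rw [hs, smul_smul, Units.inv_mul, one_smul, sub_add_cancel]
  rw [h, UKG, Uplus, Gminus, toSubmodule_adjoin_range, toSubmodule_adjoin_range]
  refine Submodule.smul_mem _ _ (Submodule.mul_mem_mul (Submodule.mul_mem_mul ?_ ?_) ?_)
  · exact Submodule.subset_span ⟨J, rfl⟩
  · exact Submodule.subset_span rfl
  · exact Submodule.subset_span ⟨J', rfl⟩

theorem isInternal_UKG : DirectSum.IsInternal D.UKG :=
  isInternal_of_projections D.triEquiv.symm.injective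
    (projections_of_index D.UKG_le D.torusProj_tri) (iSup_eq_top_of_index D.triMap_tri_mem_UKG)

theorem triEquiv_symm_P (l : Fin n → ℤ) (x : D.U) :
    D.triEquiv.symm (D.P l x) = D.torusProj l (D.triEquiv.symm x) :=
  apply_summandProj (φ := D.triEquiv.symm.toLinearMap) D.triEquiv.symm.injective
    (projections_of_index D.UKG_le D.torusProj_tri) (iSup_eq_top_of_index D.triMap_tri_mem_UKG) _ x

end Datum

end Decompositions

end PreNichols

namespace PreNichols

/-! ## The partial bosonization -/

open TensorProduct

section PartialBosonization

variable {k : Type*} [Field k] {n : ℕ}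

open NCPoly

namespace Datum

variable (D : Datum k n)

/-- The coordinates of an element of `U⁻ H` with respect to `U⁻ H = ⨁ μ, U⁻ K_μ`. -/
noncomputable def borelCoord : D.U →ₗ[k] ((Fin n → ℤ) →₀ D.A) :=
  (TensorProduct.lid k _).toLinearMap ∘ₗ TensorProduct.map D.counitA LinearMap.id ∘ₗ
    D.triEquiv.symm.toLinearMap

theorem borelCoord_borelMap (f : (Fin n → ℤ) →₀ D.A) : D.borelCoord (D.borelMap f) = f := by
  have h : D.triEquiv.symm (D.borelMap f) = 1 ⊗ₜ f := by
    rw [LinearEquiv.symm_apply_eq, triEquiv_apply, triMap_tmul, evE_one, one_mul]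
  rw [borelCoord, LinearMap.comp_apply, LinearMap.comp_apply, LinearEquiv.coe_coe,
    LinearEquiv.coe_coe, h, TensorProduct.map_tmul, counitA_one, TensorProduct.lid_tmul, one_smul,
    LinearMap.id_apply]

theorem borelMap_injective : Function.Injective D.borelMap :=
  Function.LeftInverse.injective D.borelCoord_borelMap

theorem evF_mul_Kpow_mul (y y' : D.A) (μ μ' : Fin n → ℤ) :
    D.evF y * D.Kpow μ * (D.evF y' * D.Kpow μ') =
      D.evF (y * D.twA (-μ) y') * D.Kpow (μ + μ') := by
  rw [evF_mul, Kpow_add, mul_assoc, ← mul_assoc (D.Kpow μ), Kpow_mul_evF]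
  simp only [mul_assoc]

theorem toSubmodule_Uminus : Subalgebra.toSubmodule D.Uminus = LinearMap.range D.evF := by
  rw [Uminus, toSubmodule_adjoin_range, LinearMap.range_eq_map, ← span_range_toA_monomial,
    Submodule.map_span, ← Set.range_comp]
  congr 2
  ext J
  exact (D.evF_monomial J).symm

/-- The map `single λ y ↦ y(F) K_λ` onto the partial bosonization. -/
noncomputable def bosMap : (D.thetaLattice →₀ D.A) →ₗ[k] D.U :=
  D.borelMap ∘ₗ Finsupp.lmapDomain D.A k Subtype.val

theorem bosMap_single (μ : D.thetaLattice) (y : D.A) :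
    D.bosMap (Finsupp.single μ y) = D.evF y * D.Kpow μ := by
  rw [bosMap, LinearMap.comp_apply, Finsupp.lmapDomain_apply, Finsupp.mapDomain_single,
    borelMap_single]

theorem bosMap_injective : Function.Injective D.bosMap :=
  D.borelMap_injective.comp (Finsupp.mapDomain_injective Subtype.val_injective)

theorem range_bosMap : LinearMap.range D.bosMap =
    Submodule.span k {x | ∃ y, ∃ μ ∈ D.thetaLattice, x = D.evF y * D.Kpow μ} := by
  apply le_antisymm
  · rintro _ ⟨f, rfl⟩
    induction f using Finsupp.induction_linear with
    | zero => rw [map_zero]; exact zero_mem _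
    | add f g hf hg => rw [map_add]; exact add_mem hf hg
    | single μ y => rw [bosMap_single]; exact Submodule.subset_span ⟨y, μ, μ.2, rfl⟩
  · rw [Submodule.span_le]
    rintro _ ⟨y, μ, hμ, rfl⟩
    exact ⟨Finsupp.single ⟨μ, hμ⟩ y, D.bosMap_single _ _⟩

theorem Kpow_mem_Htheta {μ : Fin n → ℤ} (hμ : μ ∈ D.thetaLattice) : D.Kpow μ ∈ D.Htheta := by
  rw [← Subalgebra.mem_toSubmodule, toSubmodule_Htheta]
  exact Submodule.subset_span ⟨μ, hμ, rfl⟩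

theorem evF_mem_Uminus (y : D.A) : D.evF y ∈ D.Uminus := by
  rw [← Subalgebra.mem_toSubmodule, toSubmodule_Uminus]
  exact ⟨y, rfl⟩

theorem Kpow_mem_partialBos {μ : Fin n → ℤ} (hμ : μ ∈ D.thetaLattice) :
    D.Kpow μ ∈ D.partialBos :=
  (le_sup_left : D.Htheta ≤ D.partialBos) (D.Kpow_mem_Htheta hμ)

theorem evF_mem_partialBos (y : D.A) : D.evF y ∈ D.partialBos :=
  (le_sup_right : D.Uminus ≤ D.partialBos) (D.evF_mem_Uminus y)

/-- The span of the y(F)K_μ contains both subalgebras and is closed under multiplication, because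
K_μ moves past U⁻ by a twist. -/
theorem toSubmodule_partialBos :
    Subalgebra.toSubmodule D.partialBos = LinearMap.range D.bosMap := by
  apply le_antisymm
  · have hmul : ∀ x y, x ∈ LinearMap.range D.bosMap → y ∈ LinearMap.range D.bosMap →
        x * y ∈ LinearMap.range D.bosMap := by
      intro x y hx hy
      rw [range_bosMap] at hx hy ⊢
      have h := Submodule.mul_mem_mul hx hy
      rw [Submodule.span_mul_span] at h
      refine Submodule.span_mono ?_ h
      rintro _ ⟨_, ⟨y, μ, hμ, rfl⟩, _, ⟨y', μ', hμ', rfl⟩, rfl⟩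
      exact ⟨_, _, add_mem hμ hμ', D.evF_mul_Kpow_mul y y' μ μ'⟩
    have hone : (1 : D.U) ∈ LinearMap.range D.bosMap :=
      ⟨Finsupp.single 0 1, by rw [bosMap_single, evF_one, one_mul]; exact D.Kpow_zero⟩
    have h : D.partialBos ≤ (LinearMap.range D.bosMap).toSubalgebra hone hmul := by
      refine sup_le (fun x hx => ?_) fun x hx => ?_
      · rw [← Subalgebra.mem_toSubmodule, toSubmodule_Htheta] at hx
        show x ∈ LinearMap.range D.bosMap
        refine Submodule.span_le.2 ?_ hx
        rintro _ ⟨μ, hμ, rfl⟩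
        exact ⟨Finsupp.single ⟨μ, hμ⟩ 1, by rw [bosMap_single, evF_one, one_mul]⟩
      · rw [← Subalgebra.mem_toSubmodule, toSubmodule_Uminus] at hx
        obtain ⟨y, rfl⟩ := hx
        exact ⟨Finsupp.single 0 y, by
          rw [bosMap_single]; exact (congrArg _ D.Kpow_zero).trans (mul_one _)⟩
    exact h
  · rw [range_bosMap, Submodule.span_le]
    rintro _ ⟨y, μ, hμ, rfl⟩
    exact D.partialBos.mul_mem (D.evF_mem_partialBos y) (D.Kpow_mem_partialBos hμ)

/-- The linear isomorphism `k[Λ_θ] ⊗ A ≃ H_θ ⋉ U⁻`. -/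
noncomputable def bosEquiv : (D.thetaLattice →₀ D.A) ≃ₗ[k] D.partialBos :=
  (LinearEquiv.ofInjective D.bosMap D.bosMap_injective).trans
    (LinearEquiv.ofEq _ (Subalgebra.toSubmodule D.partialBos) D.toSubmodule_partialBos.symm)

theorem coe_bosEquiv_single (μ : D.thetaLattice) (y : D.A) :
    (D.bosEquiv (Finsupp.single μ y) : D.U) = D.evF y * D.Kpow μ := D.bosMap_single μ y

/-! ### The grading -/

theorem mem_bosGrading {m : ℕ} {x : D.partialBos} : x ∈ D.bosGrading m ↔
    (x : D.U) ∈ Submodule.span k {x | ∃ J : List (Fin n), J.length = m ∧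
      ∃ μ ∈ D.thetaLattice, x = D.Kpow μ * (J.map D.F).prod} := by
  rw [bosGrading, toSubmodule_Htheta, Submodule.span_mul_span]
  open Pointwise in
  have h : (D.Kpow '' (D.thetaLattice : Set (Fin n → ℤ)) *
      {x | ∃ J : List (Fin n), J.length = m ∧ x = (J.map D.F).prod}) =
      {x | ∃ J : List (Fin n), J.length = m ∧
        ∃ μ ∈ D.thetaLattice, x = D.Kpow μ * (J.map D.F).prod} := by
    ext x
    constructor
    · rintro ⟨_, ⟨μ, hμ, rfl⟩, _, ⟨J, hJ, rfl⟩, rfl⟩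
      exact ⟨J, hJ, μ, hμ, rfl⟩
    · rintro ⟨J, hJ, μ, hμ, rfl⟩
      exact ⟨_, ⟨μ, hμ, rfl⟩, _, ⟨J, hJ, rfl⟩, rfl⟩
  rw [h]
  rfl

theorem bosEquiv_single_mem (μ : D.thetaLattice) (J : List (Fin n)) :
    D.bosEquiv (Finsupp.single μ (D.toA (monomial J))) ∈ D.bosGrading J.length := by
  rw [mem_bosGrading, coe_bosEquiv_single, evF_monomial, list_prod_F_mul_Kpow]
  exact Submodule.smul_mem _ _ (Submodule.subset_span ⟨J, rfl, μ, μ.2, rfl⟩)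

instance gradedMonoid_bosGrading : SetLike.GradedMonoid D.bosGrading where
  one_mem := by
    rw [mem_bosGrading]
    refine Submodule.subset_span ⟨[], rfl, 0, zero_mem _, ?_⟩
    rw [Kpow_zero, List.map_nil, List.prod_nil, mul_one]
    rfl
  mul_mem i j x y hx hy := by
    rw [mem_bosGrading] at hx hy ⊢
    have h := Submodule.mul_mem_mul hx hy
    rw [Submodule.span_mul_span] at h
    refine Submodule.span_le.2 ?_ h
    rintro _ ⟨_, ⟨J, hJ, μ, hμ, rfl⟩, _, ⟨J', hJ', μ', hμ', rfl⟩, rfl⟩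
    have h2 : D.Kpow μ * (J.map D.F).prod * (D.Kpow μ' * (J'.map D.F).prod) =
        (D.χ.twScalar μ' J : k) • (D.Kpow (μ + μ') * ((J ++ J').map D.F).prod) := by
      rw [mul_assoc, ← mul_assoc _ (D.Kpow μ'), list_prod_F_mul_Kpow, smul_mul_assoc,
        mul_smul_comm, Kpow_add, List.map_append, List.prod_append]
      simp only [mul_assoc]
    simp only [SetLike.mem_coe, h2]
    exact Submodule.smul_mem _ _ (Submodule.subset_span
      ⟨J ++ J', by rw [List.length_append, hJ, hJ'], _, add_mem hμ hμ', rfl⟩)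

/-- The projection onto the degree `m` component, as a map into the coordinate space. -/
noncomputable def bosGradingProj (m : ℕ) : D.partialBos →ₗ[k] ((Fin n → ℤ) →₀ D.A) :=
  Finsupp.mapRange.linearMap (D.wtProjA fun w => ∑ i, w i = m) ∘ₗ D.borelCoord ∘ₗ
    D.partialBos.val.toLinearMap

theorem borelCoord_val_injective :
    Function.Injective (D.borelCoord ∘ₗ D.partialBos.val.toLinearMap) := by
  rw [← LinearMap.ker_eq_bot, LinearMap.ker_eq_bot']
  intro x hx
  obtain ⟨f, rfl⟩ := D.bosEquiv.surjective x
  have h : D.borelCoord (D.bosMap f) = 0 := hx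
  rw [bosMap, LinearMap.comp_apply, borelCoord_borelMap] at h
  have h0 : f = 0 := Finsupp.mapDomain_injective Subtype.val_injective
    (h.trans Finsupp.mapDomain_zero.symm)
  rw [h0, map_zero]

theorem borelCoord_Kpow_mul (μ : Fin n → ℤ) (J : List (Fin n)) :
    D.borelCoord (D.Kpow μ * (J.map D.F).prod) =
      (D.χ.twScalar (-μ) J : k) • Finsupp.single μ (D.toA (monomial J)) := by
  rw [← evF_monomial, Kpow_mul_evF, ← borelMap_single, borelCoord_borelMap, twA_monomial,
    Finsupp.smul_single]

theorem bosGradingProj_of_mem (i j : ℕ) (x : D.partialBos) (hx : x ∈ D.bosGrading j) :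
    D.bosGradingProj i x =
      if j = i then (D.borelCoord ∘ₗ D.partialBos.val.toLinearMap) x else 0 := by
  rw [mem_bosGrading] at hx
  rw [bosGradingProj, LinearMap.comp_apply, LinearMap.comp_apply]
  show Finsupp.mapRange.linearMap _ (D.borelCoord (x : D.U)) =
    if j = i then D.borelCoord (x : D.U) else 0
  classical
  have h : ∀ (J : List (Fin n)) (μ : Fin n → ℤ), J.length = j →
      Finsupp.mapRange.linearMap (D.wtProjA fun w => ∑ i, w i = (i : ℤ))
      (D.borelCoord (D.Kpow μ * (J.map D.F).prod)) =
        if j = i then D.borelCoord (D.Kpow μ * (J.map D.F).prod) else 0 := by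
    intro J μ hJ
    rw [borelCoord_Kpow_mul, map_smul, Finsupp.mapRange.linearMap_apply, Finsupp.mapRange_single,
      wtProjA_monomial, sum_wt, hJ]
    simp only [Nat.cast_inj]
    split_ifs <;> simp
  generalize (x : D.U) = u at hx
  by_cases hji : j = i
  · simp only [if_pos hji] at h ⊢
    refine Submodule.span_le (p := LinearMap.eqLocus (Finsupp.mapRange.linearMap _ ∘ₗ D.borelCoord)
      D.borelCoord) |>.2 ?_ hx
    rintro _ ⟨J, hJ, μ, hμ, rfl⟩
    exact h J μ hJ
  · simp only [if_neg hji] at h ⊢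
    refine Submodule.span_le (p := LinearMap.ker (Finsupp.mapRange.linearMap _ ∘ₗ D.borelCoord))
      |>.2 ?_ hx
    rintro _ ⟨J, hJ, μ, hμ, rfl⟩
    exact h J μ hJ

theorem iSup_bosGrading : ⨆ m, D.bosGrading m = ⊤ := by
  rw [eq_top_iff]
  intro x _
  obtain ⟨f, rfl⟩ := D.bosEquiv.surjective x
  induction f using Finsupp.induction_linear with
  | zero => rw [map_zero]; exact zero_mem _
  | add f g hf hg => rw [map_add]; exact add_mem (hf trivial) (hg trivial)
  | single μ y =>
    refine D.A_induction_monomial (P := fun y => D.bosEquiv (Finsupp.single μ y) ∈ _) (fun J => ?_)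
      ?_ (fun x y hx hy => ?_) (fun r x hx => ?_) y
    · exact Submodule.mem_iSup_of_mem _ (D.bosEquiv_single_mem μ J)
    · rw [Finsupp.single_zero, map_zero]; exact zero_mem _
    · rw [Finsupp.single_add, map_add]; exact add_mem hx hy
    · rw [← Finsupp.smul_single, map_smul]; exact Submodule.smul_mem _ _ hx

theorem isInternal_bosGrading : DirectSum.IsInternal D.bosGrading :=
  isInternal_of_projections D.borelCoord_val_injective D.bosGradingProj_of_mem D.iSup_bosGrading

/-! ### Skew derivations -/

/-- The linear isomorphism between the pre-Nichols algebra and `U⁻`. -/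
noncomputable def minusEquiv : D.A ≃ₗ[k] D.Uminus :=
  (LinearEquiv.ofInjective D.evF D.evF_injective).trans
    (LinearEquiv.ofEq _ (Subalgebra.toSubmodule D.Uminus) D.toSubmodule_Uminus.symm)

theorem coe_minusEquiv (y : D.A) : (D.minusEquiv y : D.U) = D.evF y := rfl

theorem isSkewPair_conj (i : Fin n) :
    D.IsSkewPair i (D.minusEquiv.conj (D.dLA i), D.minusEquiv.conj (D.dRA i)) := by
  intro f
  obtain ⟨y, rfl⟩ := D.minusEquiv.surjective f
  simp only [LinearEquiv.conj_apply_apply, LinearEquiv.symm_apply_apply, coe_minusEquiv]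
  exact D.E_mul_evF i y

/-- The two terms lie in the components U⁻K_μ for μ = αᵢ and μ = -αᵢ, which are distinct weights in
ℤⁿ. This gives uniqueness of the skew derivations. -/
theorem eq_zero_of_K_mul_evF_sub {i : Fin n} {a b : D.A}
    (h : D.K i * D.evF a - D.evF b * D.Kinv i = 0) : a = 0 ∧ b = 0 := by
  have h1 : D.borelMap (Finsupp.single (Pi.single i 1) (D.twA (-Pi.single i 1) a) -
      Finsupp.single (-Pi.single i 1) b) = 0 := by
    rw [map_sub, borelMap_single, borelMap_single, ← Kpow_mul_evF, Kpow_single, Kpow_neg_single, h]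
  have h2 := D.borelMap_injective (h1.trans (map_zero _).symm)
  have hne : (Pi.single i 1 : Fin n → ℤ) ≠ -Pi.single i 1 := by
    intro h
    have := congrFun h i
    simp at this
  have h3 := DFunLike.congr_fun h2 (Pi.single i 1)
  have h4 := DFunLike.congr_fun h2 (-Pi.single i 1)
  rw [Finsupp.sub_apply, Finsupp.single_eq_same, Finsupp.single_eq_of_ne hne, sub_zero,
    Finsupp.zero_apply] at h3
  rw [Finsupp.sub_apply, Finsupp.single_eq_same, Finsupp.single_eq_of_ne hne.symm, zero_sub,
    Finsupp.zero_apply, neg_eq_zero] at h4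
  refine ⟨?_, h4⟩
  have h5 := LinearMap.congr_fun (D.twA_mul_twA (Pi.single i 1) (-Pi.single i 1)) a
  rw [add_neg_cancel, twA_zero, Module.End.mul_apply, h3, map_zero] at h5
  exact h5.symm

variable {D} in
theorem IsSkewPair.unique {i : Fin n} {d d' : (D.Uminus →ₗ[k] D.Uminus) × (D.Uminus →ₗ[k] D.Uminus)}
    (h : D.IsSkewPair i d) (h' : D.IsSkewPair i d') : d = d' := by
  have key : ∀ f, D.minusEquiv.symm (d.1 f - d'.1 f) = 0 ∧ D.minusEquiv.symm (d.2 f - d'.2 f) = 0 := by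
    intro f
    refine D.eq_zero_of_K_mul_evF_sub (i := i) ?_
    rw [← coe_minusEquiv, ← coe_minusEquiv, LinearEquiv.apply_symm_apply,
      LinearEquiv.apply_symm_apply, AddSubgroupClass.coe_sub, AddSubgroupClass.coe_sub, mul_sub,
      sub_mul]
    have h1 := h f
    rw [h' f] at h1
    rw [sub_sub_sub_comm, ← h1, sub_self]
  refine Prod.ext (LinearMap.ext fun f => ?_) (LinearMap.ext fun f => ?_)
  · exact sub_eq_zero.1 ((map_eq_zero_iff _ D.minusEquiv.symm.injective).1 (key f).1)
  · exact sub_eq_zero.1 ((map_eq_zero_iff _ D.minusEquiv.symm.injective).1 (key f).2)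

theorem existsUnique_isSkewPair (i : Fin n) : ∃! d, D.IsSkewPair i d :=
  ⟨_, D.isSkewPair_conj i, fun _ h => h.unique (D.isSkewPair_conj i)⟩

theorem skewL_eq (i : Fin n) : D.skewL i = D.minusEquiv.conj (D.dLA i) := by
  have h := Classical.epsilon_spec (D.existsUnique_isSkewPair i).exists
  rw [skewL, h.unique (D.isSkewPair_conj i)]

end Datum

end PartialBosonization

end PreNichols

namespace PreNichols

/-! ## The projection onto the partial bosonization -/

open TensorProduct

section Projection

variable {k : Type*} [Field k] {n : ℕ}

open NCPoly

namespace Datum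

variable (D : Datum k n)

/-- The kernel of `ψ` as a subspace of `U(χ)`. -/
noncomputable def kerU : Submodule k D.U := D.psiKer.map D.Upoly.val.toLinearMap

theorem mem_kerU {x : D.U} : x ∈ D.kerU ↔ ∃ h : x ∈ D.Upoly, (⟨x, h⟩ : D.Upoly) ∈ D.psiKer := by
  constructor
  · rintro ⟨y, hy, rfl⟩
    exact ⟨y.2, hy⟩
  · rintro ⟨h, hx⟩
    exact ⟨_, hx, rfl⟩

theorem mul_mem_kerU {x z : D.U} (hx : x ∈ D.Upoly) (hz : z ∈ D.kerU) : x * z ∈ D.kerU := by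
  obtain ⟨z, hz, rfl⟩ := hz
  exact ⟨⟨x, hx⟩ * z, Ideal.mul_mem_left _ _ hz, rfl⟩

theorem E_mul_Kinv_self_mem_kerU (i : Fin n) : D.E i * D.Kinv i ∈ D.kerU :=
  ⟨_, Ideal.subset_span (Or.inl ⟨i, rfl⟩), rfl⟩

theorem Kinv_mem_kerU (i : Fin n) : D.Kinv i ∈ D.kerU :=
  ⟨_, Ideal.subset_span (Or.inr ⟨i, rfl⟩), rfl⟩

theorem kerU_le {V : Submodule k D.U} (hmul : ∀ x ∈ D.Upoly, ∀ z ∈ V, x * z ∈ V)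
    (hE : ∀ i, D.E i * D.Kinv i ∈ V) (hK : ∀ i, D.Kinv i ∈ V) : D.kerU ≤ V := by
  rintro _ ⟨z, hz, rfl⟩
  show (z : D.U) ∈ V
  rw [SetLike.mem_coe, psiKer, Submodule.restrictScalars_mem, Ideal.span] at hz
  induction hz using Submodule.span_induction with
  | mem z hz =>
    obtain ⟨i, rfl⟩ | ⟨i, rfl⟩ := hz
    · exact hE i
    · exact hK i
  | zero => exact zero_mem _
  | add x y _ _ hx hy => exact add_mem hx hy
  | smul a x _ hx => exact hmul _ a.2 _ hx

theorem Upoly_mul_mem {R : Type*} [AddCommGroup R] [Module k R] (ρ : D.U →ₐ[k] Module.End k R)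
    {V : Submodule k R}
    (hF : ∀ i, ∀ z ∈ V, ρ (D.F i) z ∈ V) (hE : ∀ i, ∀ z ∈ V, ρ (D.E i * D.Kinv i) z ∈ V)
    (hL : ∀ i, ∀ z ∈ V, ρ (D.Kinv i) z ∈ V)
    (hK : ∀ i, ∀ z ∈ V, ρ (D.K i * D.Kinv (D.τ i)) z ∈ V) {x : D.U} (hx : x ∈ D.Upoly) {z : R}
    (hz : z ∈ V) : ρ x z ∈ V := by
  induction hx using Algebra.adjoin_induction generalizing z with
  | mem x hx =>
    obtain ((⟨i, rfl⟩ | ⟨i, rfl⟩) | ⟨i, rfl⟩) | ⟨i, rfl⟩ := hx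
    · exact hF i z hz
    · exact hE i z hz
    · exact hL i z hz
    · exact hK i z hz
  | algebraMap r =>
    rw [AlgHom.commutes, Module.algebraMap_end_apply]
    exact V.smul_mem _ hz
  | add x y _ _ hx hy => rw [map_add, LinearMap.add_apply]; exact add_mem (hx hz) (hy hz)
  | mul x y _ _ hx hy => rw [map_mul, Module.End.mul_apply]; exact hx (hy hz)

theorem Kpow_mem_Upoly {μ : Fin n → ℤ} (hμ : μ ∈ D.thetaLattice) : D.Kpow μ ∈ D.Upoly :=
  D.partialBos_le_Upoly (D.Kpow_mem_partialBos hμ)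

theorem Kinv_mul_Kpow (i : Fin n) (μ : Fin n → ℤ) : D.Kinv i * D.Kpow μ = D.Kpow μ * D.Kinv i := by
  rw [← Kpow_neg_single, ← Kpow_add, ← Kpow_add, add_comm]

theorem E_mul_Kpow (i : Fin n) (μ : Fin n → ℤ) : D.E i * D.Kpow μ =
    (((D.χ.toFun μ (Pi.single i 1))⁻¹ : kˣ) : k) • (D.Kpow μ * D.E i) := by
  rw [Kpow_mul_E, smul_smul, Units.inv_mul, one_smul]

/-- A left ideal need not be stable on the right, but K_μ skew commutes with the generators EᵢKᵢ⁻¹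
and Kᵢ⁻¹, and lies in U(χ)ᵖᵒˡʸ when μ is a weight of H_θ. -/
theorem mul_Kpow_mem_kerU {μ : Fin n → ℤ} (hμ : μ ∈ D.thetaLattice) {z : D.U} (hz : z ∈ D.kerU) :
    z * D.Kpow μ ∈ D.kerU := by
  refine D.kerU_le (V := D.kerU.comap (LinearMap.mulRight k (D.Kpow μ))) (fun x hx z hz => ?_)
    (fun i => ?_) (fun i => ?_) hz
  · rw [Submodule.mem_comap, LinearMap.mulRight_apply, mul_assoc]
    exact D.mul_mem_kerU hx hz
  · rw [Submodule.mem_comap, LinearMap.mulRight_apply, mul_assoc, Kinv_mul_Kpow, ← mul_assoc,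
      E_mul_Kpow, smul_mul_assoc, mul_assoc]
    exact Submodule.smul_mem _ _ (D.mul_mem_kerU (D.Kpow_mem_Upoly hμ) (D.E_mul_Kinv_self_mem_kerU i))
  · rw [Submodule.mem_comap, LinearMap.mulRight_apply, Kinv_mul_Kpow]
    exact D.mul_mem_kerU (D.Kpow_mem_Upoly hμ) (D.Kinv_mem_kerU i)

theorem single_sub_mem_thetaLattice (i : Fin n) :
    (Pi.single i 1 - Pi.single (D.τ i) 1 : Fin n → ℤ) ∈ D.thetaLattice :=
  AddSubmonoid.subset_closure ⟨i, rfl⟩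

theorem single_τ_sub_mem_thetaLattice (i : Fin n) :
    (Pi.single (D.τ i) 1 - Pi.single i 1 : Fin n → ℤ) ∈ D.thetaLattice :=
  AddSubmonoid.subset_closure ⟨D.τ i, by simp only [D.τ_invol]⟩

theorem E_mul_Kinv_mem_kerU (i : Fin n) : D.E (D.τ i) * D.Kinv i ∈ D.kerU := by
  have h : D.E (D.τ i) * D.Kinv i =
      D.E (D.τ i) * D.Kinv (D.τ i) * D.Kpow (Pi.single (D.τ i) 1 - Pi.single i 1) := by
    rw [Kpow_single_sub, mul_assoc, ← mul_assoc _ (D.K _), Kinv_mul_K, one_mul]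
  rw [h]
  exact D.mul_Kpow_mem_kerU (D.single_τ_sub_mem_thetaLattice i) (D.E_mul_Kinv_self_mem_kerU _)

/-- The source of every computation of ψ. When i = j or i = τ(j), the first and the last term lie in
the left ideal, so modulo the kernel only the term with ∂ᴸ survives. -/
theorem E_mul_Kinv_mul_evF (i j : Fin n) (y : D.A) :
    D.E i * D.Kinv j * D.evF y = D.evF (D.twA (Pi.single j 1) y) * (D.E i * D.Kinv j) +
      D.evF (D.twA (-Pi.single i 1) (D.dLA i (D.twA (Pi.single j 1) y))) * (D.K i * D.Kinv j) -
        D.evF (D.dRA i (D.twA (Pi.single j 1) y)) * (D.Kinv i * D.Kinv j) := by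
  have h1 : D.Kinv j * D.evF y = D.evF (D.twA (Pi.single j 1) y) * D.Kinv j := by
    rw [← Kpow_neg_single, Kpow_mul_evF, neg_neg]
  have h2 := D.E_mul_evF i (D.twA (Pi.single j 1) y)
  have h3 : D.K i * D.evF (D.dLA i (D.twA (Pi.single j 1) y)) =
      D.evF (D.twA (-Pi.single i 1) (D.dLA i (D.twA (Pi.single j 1) y))) * D.K i := by
    rw [← Kpow_single, Kpow_mul_evF]
  rw [h3, sub_eq_iff_eq_add] at h2
  rw [mul_assoc, h1, ← mul_assoc, h2]
  simp only [add_mul, sub_mul, mul_assoc]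
  abel

theorem evF_mem_Upoly (y : D.A) : D.evF y ∈ D.Upoly :=
  D.partialBos_le_Upoly (D.evF_mem_partialBos y)

theorem evF_mul_Kpow_mem_partialBos (y : D.A) {μ : Fin n → ℤ} (hμ : μ ∈ D.thetaLattice) :
    D.evF y * D.Kpow μ ∈ D.partialBos :=
  D.partialBos.mul_mem (D.evF_mem_partialBos y) (D.Kpow_mem_partialBos hμ)

theorem E_mul_Kinv_self_mul_evF_sub_mem (i : Fin n) (y : D.A) :
    D.E i * D.Kinv i * D.evF y -
      D.evF (D.twA (-Pi.single i 1) (D.dLA i (D.twA (Pi.single i 1) y))) ∈ D.kerU := by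
  rw [E_mul_Kinv_mul_evF, K_mul_Kinv, mul_one, sub_right_comm, add_sub_cancel_right]
  exact sub_mem (D.mul_mem_kerU (D.evF_mem_Upoly _) (D.E_mul_Kinv_self_mem_kerU i))
    (D.mul_mem_kerU (D.evF_mem_Upoly _) (D.mul_mem_kerU (D.Kinv_mem_Upoly i) (D.Kinv_mem_kerU i)))

theorem E_mul_Kinv_mul_evF_sub_mem (i : Fin n) (y : D.A) :
    D.E (D.τ i) * D.Kinv i * D.evF y -
      D.evF (D.twA (-Pi.single (D.τ i) 1) (D.dLA (D.τ i) (D.twA (Pi.single i 1) y))) *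
        D.Kpow (Pi.single (D.τ i) 1 - Pi.single i 1) ∈ D.kerU := by
  rw [E_mul_Kinv_mul_evF, Kpow_single_sub, sub_right_comm, add_sub_cancel_right]
  exact sub_mem (D.mul_mem_kerU (D.evF_mem_Upoly _) (D.E_mul_Kinv_mem_kerU i))
    (D.mul_mem_kerU (D.evF_mem_Upoly _) (D.mul_mem_kerU (D.Kinv_mem_Upoly _) (D.Kinv_mem_kerU i)))

theorem Kinv_mul_evF_mem_kerU (i : Fin n) (y : D.A) : D.Kinv i * D.evF y ∈ D.kerU := by
  rw [← Kpow_neg_single, Kpow_mul_evF, Kpow_neg_single]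
  exact D.mul_mem_kerU (D.evF_mem_Upoly _) (D.Kinv_mem_kerU i)

/-- The right-hand side contains 1 and is stable under left multiplication with the generators of
U(χ)ᵖᵒˡʸ: modulo the kernel EᵢKᵢ⁻¹ acts on U⁻ by a twisted ∂ᴸ, and Kᵢ⁻¹ acts by zero. -/
theorem Upoly_le : Subalgebra.toSubmodule D.Upoly ≤
    Subalgebra.toSubmodule D.partialBos ⊔ D.kerU := by
  set V := Subalgebra.toSubmodule D.partialBos ⊔ D.kerU with hV
  have hbos : ∀ x ∈ D.partialBos, x ∈ V := fun x hx =>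
    (le_sup_left : Subalgebra.toSubmodule D.partialBos ≤ V) hx
  have hker : ∀ x ∈ D.kerU, x ∈ V := fun x hx => (le_sup_right : D.kerU ≤ V) hx
  have key : ∀ x ∈ D.Upoly, (∀ (y : D.A) (μ), μ ∈ D.thetaLattice → x * (D.evF y * D.Kpow μ) ∈ V) →
      ∀ z ∈ V, x * z ∈ V := by
    intro x hx h z hz
    obtain ⟨a, ha, b, hb, rfl⟩ := Submodule.mem_sup.1 hz
    rw [mul_add]
    refine add_mem ?_ (hker _ (D.mul_mem_kerU hx hb))
    rw [toSubmodule_partialBos, range_bosMap] at ha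
    refine Submodule.span_le (p := V.comap (LinearMap.mulLeft k x)) |>.2 ?_ ha
    rintro _ ⟨y, μ, hμ, rfl⟩
    exact h y μ hμ
  have hbos' : ∀ x ∈ D.partialBos, ∀ z ∈ V, x * z ∈ V := fun x hx =>
    key x (D.partialBos_le_Upoly hx) fun y μ hμ =>
      hbos _ (D.partialBos.mul_mem hx (D.evF_mul_Kpow_mem_partialBos y hμ))
  intro x hx
  rw [← mul_one x]
  refine D.Upoly_mul_mem (Algebra.lmul k D.U) (V := V) (fun i => ?_) (fun i => ?_) (fun i => ?_)
    (fun i => ?_) hx (hbos 1 (one_mem _))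
  · exact hbos' _ (evF_X D i ▸ D.evF_mem_partialBos (D.X i))
  · refine key _ (D.EKinv_mem_Upoly i) fun y μ hμ => ?_
    have h1 := D.mul_Kpow_mem_kerU hμ (D.E_mul_Kinv_self_mul_evF_sub_mem i y)
    rw [sub_mul, mul_assoc _ (D.evF y)] at h1
    have h2 := add_mem (hker _ h1) (hbos _ (D.evF_mul_Kpow_mem_partialBos
      (D.twA (-Pi.single i 1) (D.dLA i (D.twA (Pi.single i 1) y))) hμ))
    rwa [sub_add_cancel] at h2
  · refine key _ (D.Kinv_mem_Upoly i) fun y μ hμ => hker _ ?_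
    rw [← mul_assoc]
    exact D.mul_Kpow_mem_kerU hμ (D.Kinv_mul_evF_mem_kerU i y)
  · refine hbos' _ ?_
    rw [← Kpow_single_sub]
    exact D.Kpow_mem_partialBos (D.single_sub_mem_thetaLattice i)

/-! ### The trivial intersection -/

/-- The projection onto the weights of total degree zero in the Verma module. -/
noncomputable def vermaProj : Module.End k (D.A ⊗[k] ((Fin n → ℤ) →₀ k)) :=
  TensorProduct.map (1 : Module.End k D.A)
    (Finsupp.lsum k fun μ => if ∑ i, μ i = 0 then Finsupp.lsingle μ else 0)

theorem vermaProj_tmul (a : D.A) (μ : Fin n → ℤ) (r : k) :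
    D.vermaProj (a ⊗ₜ Finsupp.single μ r) =
      if ∑ i, μ i = 0 then a ⊗ₜ Finsupp.single μ r else 0 := by
  rw [vermaProj, TensorProduct.map_tmul]
  split_ifs with h <;> simp [h]

/-- The part of the Verma module with weights of positive total degree. -/
noncomputable def vermaPos : Submodule k (D.A ⊗[k] ((Fin n → ℤ) →₀ k)) :=
  Submodule.span k {x | ∃ (a : D.A) (μ : Fin n → ℤ) (r : k), 1 ≤ ∑ i, μ i ∧
    x = a ⊗ₜ Finsupp.single μ r}

theorem tmul_mem_vermaPos (a : D.A) {μ : Fin n → ℤ} (h : 1 ≤ ∑ i, μ i) (r : k) :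
    a ⊗ₜ Finsupp.single μ r ∈ D.vermaPos :=
  Submodule.subset_span ⟨a, μ, r, h, rfl⟩

theorem map_mem_vermaPos {f : Module.End k (D.A ⊗[k] ((Fin n → ℤ) →₀ k))}
    (h : ∀ (a : D.A) (μ : Fin n → ℤ) (r : k), 1 ≤ ∑ i, μ i → f (a ⊗ₜ Finsupp.single μ r) ∈ D.vermaPos)
    (z) (hz : z ∈ D.vermaPos) : f z ∈ D.vermaPos := by
  refine Submodule.span_le (p := D.vermaPos.comap f) |>.2 ?_ hz
  rintro _ ⟨a, μ, r, hμ, rfl⟩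
  exact h a μ r hμ

/-- No generator of U(χ)ᵖᵒˡʸ lowers the total degree: Kᵢ⁻¹ raises it by one, Eᵢ changes it by ±1 but
occurs only after Kᵢ⁻¹, and KᵢK_{τ(i)}⁻¹ and Fᵢ preserve it. -/
theorem vermaAction_mem_vermaPos {x : D.U} (hx : x ∈ D.Upoly) {z} (hz : z ∈ D.vermaPos) :
    D.vermaAction x z ∈ D.vermaPos := by
  refine D.Upoly_mul_mem D.vermaAction (fun i => D.map_mem_vermaPos fun a μ r h => ?_)
    (fun i => D.map_mem_vermaPos fun a μ r h => ?_) (fun i => D.map_mem_vermaPos fun a μ r h => ?_)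
    (fun i => D.map_mem_vermaPos fun a μ r h => ?_) hx hz
  · rw [← evF_X, vermaAction_evF]
    exact D.tmul_mem_vermaPos _ h _
  · rw [map_mul, Module.End.mul_apply, vermaAction_Kinv, vermaAction_E]
    refine add_mem (neg_mem (D.tmul_mem_vermaPos _ ?_ _)) (D.tmul_mem_vermaPos _ ?_ _)
    · simp [Finset.sum_add_distrib]; omega
    · simpa [Finset.sum_add_distrib] using h
  · rw [vermaAction_Kinv]
    refine D.tmul_mem_vermaPos _ ?_ _
    simp [Finset.sum_add_distrib]; omega
  · rw [map_mul, Module.End.mul_apply, vermaAction_Kinv, vermaAction_K]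
    refine D.tmul_mem_vermaPos _ ?_ _
    simpa [Finset.sum_add_distrib] using h

/-- On the generating vector EᵢKᵢ⁻¹ acts by zero and Kᵢ⁻¹ moves into positive total degree. The left
ideal they generate therefore stays there, while H_θ ⋉ U⁻ stays in degree zero; this separates the
two. -/
theorem vermaAction_kerU {x : D.U} (hx : x ∈ D.kerU) :
    D.vermaProj (D.vermaAction x (1 ⊗ₜ Finsupp.single 0 1)) = 0 := by
  have h : D.vermaAction x (1 ⊗ₜ Finsupp.single 0 1) ∈ D.vermaPos := by
    refine D.kerU_le (V := D.vermaPos.comap (LinearMap.applyₗ (1 ⊗ₜ Finsupp.single 0 1) ∘ₗ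
      D.vermaAction.toLinearMap)) (fun x hx z hz => ?_) (fun i => ?_) (fun i => ?_) hx
    · have h := D.vermaAction_mem_vermaPos hx hz
      rw [Submodule.mem_comap, LinearMap.comp_apply, AlgHom.toLinearMap_apply, map_mul]
      exact h
    · rw [Submodule.mem_comap, LinearMap.comp_apply, AlgHom.toLinearMap_apply, map_mul]
      show D.vermaAction (D.E i) (D.vermaAction (D.Kinv i) (1 ⊗ₜ Finsupp.single 0 1)) ∈ _
      rw [vermaAction_Kinv, vermaAction_E, twA_one, dRA_one, xi, Module.End.mul_apply, dLA_one]
      simp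
    · show D.vermaAction (D.Kinv i) (1 ⊗ₜ Finsupp.single 0 1) ∈ D.vermaPos
      rw [vermaAction_Kinv]
      exact D.tmul_mem_vermaPos _ (by simp) _
  refine Submodule.span_le (p := LinearMap.ker D.vermaProj) |>.2 ?_ h
  rintro _ ⟨a, μ, r, hμ, rfl⟩
  rw [SetLike.mem_coe, LinearMap.mem_ker, vermaProj_tmul, if_neg (by omega)]

theorem sum_eq_zero_of_mem_thetaLattice {μ : Fin n → ℤ} (hμ : μ ∈ D.thetaLattice) :
    ∑ i, μ i = 0 := by
  induction hμ using AddSubmonoid.closure_induction with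
  | mem μ hμ => obtain ⟨i, rfl⟩ := hμ; simp
  | zero => simp
  | add a b _ _ ha hb => simp [Finset.sum_add_distrib, ha, hb]

theorem vermaAction_partialBos {x : D.U} (hx : x ∈ D.partialBos) :
    D.vermaProj (D.vermaAction x (1 ⊗ₜ Finsupp.single 0 1)) =
      D.vermaAction x (1 ⊗ₜ Finsupp.single 0 1) := by
  rw [← Subalgebra.mem_toSubmodule, toSubmodule_partialBos, range_bosMap] at hx
  refine Submodule.span_le (p := LinearMap.eqLocus (D.vermaProj ∘ₗ LinearMap.applyₗ
    (1 ⊗ₜ Finsupp.single 0 1) ∘ₗ D.vermaAction.toLinearMap) (LinearMap.applyₗ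
    (1 ⊗ₜ Finsupp.single 0 1) ∘ₗ D.vermaAction.toLinearMap)) |>.2 ?_ hx
  rintro _ ⟨y, μ, hμ, rfl⟩
  show D.vermaProj (D.vermaAction (D.evF y * D.Kpow μ) (1 ⊗ₜ Finsupp.single 0 1)) =
    D.vermaAction (D.evF y * D.Kpow μ) (1 ⊗ₜ Finsupp.single 0 1)
  rw [vermaAction_evF_Kpow, vermaProj_tmul, if_pos]
  simp [D.sum_eq_zero_of_mem_thetaLattice hμ]

/-- The inverse of the identification of the Verma module with `U⁻ H`. -/
noncomputable def vermaToU : D.A ⊗[k] ((Fin n → ℤ) →₀ k) →ₗ[k] D.U :=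
  TensorProduct.lift ((LinearMap.mul k D.U).compl₁₂ D.evF
    (Finsupp.linearCombination k fun μ => D.Kpow (-μ)))

theorem vermaToU_vermaAction {x : D.U} (hx : x ∈ D.partialBos) :
    D.vermaToU (D.vermaAction x (1 ⊗ₜ Finsupp.single 0 1)) = x := by
  rw [← Subalgebra.mem_toSubmodule, toSubmodule_partialBos, range_bosMap] at hx
  refine Submodule.span_le (p := LinearMap.eqLocus (D.vermaToU ∘ₗ LinearMap.applyₗ
    (1 ⊗ₜ Finsupp.single 0 1) ∘ₗ D.vermaAction.toLinearMap) LinearMap.id) |>.2 ?_ hx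
  rintro _ ⟨y, μ, hμ, rfl⟩
  show D.vermaToU (D.vermaAction (D.evF y * D.Kpow μ) (1 ⊗ₜ Finsupp.single 0 1)) =
    D.evF y * D.Kpow μ
  rw [vermaAction_evF_Kpow, vermaToU, TensorProduct.lift.tmul]
  simp

theorem coe_bosIncl (y : D.partialBos) : (D.bosIncl y : D.U) = y := by
  rw [bosIncl, AlgHom.toLinearMap_apply, Subalgebra.coe_inclusion]

theorem coe_mem_kerU {x : D.Upoly} : (x : D.U) ∈ D.kerU ↔ x ∈ D.psiKer := by
  rw [mem_kerU]
  exact ⟨fun h => h.2, fun h => ⟨x.2, h⟩⟩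

theorem disjoint_psiKer : Disjoint (LinearMap.range D.bosIncl) D.psiKer := by
  rw [Submodule.disjoint_def]
  rintro _ ⟨y, rfl⟩ hx
  rw [← coe_mem_kerU, coe_bosIncl] at hx
  have h2 := D.vermaAction_partialBos y.2
  rw [D.vermaAction_kerU hx] at h2
  have h3 := D.vermaToU_vermaAction y.2
  rw [← h2, map_zero] at h3
  have h4 : y = 0 := Subtype.ext h3.symm
  rw [h4, map_zero]

theorem exists_bosIncl_add (x : D.Upoly) : ∃ y, ∃ z ∈ D.psiKer, x = D.bosIncl y + z := by
  obtain ⟨a, ha, b, hb, hab⟩ := Submodule.mem_sup.1 (D.Upoly_le x.2)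
  obtain ⟨h, hb⟩ := D.mem_kerU.1 hb
  refine ⟨⟨a, ha⟩, ⟨b, h⟩, hb, Subtype.ext ?_⟩
  rw [Subalgebra.coe_add, coe_bosIncl]
  exact hab.symm

theorem isCompl_psiKer : IsCompl (LinearMap.range D.bosIncl) D.psiKer := by
  refine ⟨D.disjoint_psiKer, ?_⟩
  rw [codisjoint_iff_le_sup]
  intro x _
  obtain ⟨y, z, hz, rfl⟩ := D.exists_bosIncl_add x
  exact Submodule.add_mem_sup ⟨y, rfl⟩ hz

/-! ### Computing the projection -/

theorem psi_of_mem_psiKer {x : D.Upoly} (hx : x ∈ D.psiKer) : D.psi x = 0 := by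
  rw [psi, dif_pos D.isCompl_psiKer]
  exact LinearMap.linearProjOfIsCompl_apply_right' _ _ _ _ _ hx

theorem psi_bosIncl (y : D.partialBos) : D.psi (D.bosIncl y) = y := by
  rw [psi, dif_pos D.isCompl_psiKer]
  exact LinearMap.linearProjOfIsCompl_apply_left D.psiKer D.bosIncl D.bosIncl_injective
    D.isCompl_psiKer y

theorem psi_eq {x : D.Upoly} {y : D.partialBos} (h : (x : D.U) - (y : D.U) ∈ D.kerU) :
    D.psi x = y := by
  rw [← coe_bosIncl, ← Subalgebra.coe_sub, coe_mem_kerU] at h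
  have h2 := D.psi_of_mem_psiKer h
  rwa [map_sub, psi_bosIncl, sub_eq_zero] at h2

theorem sub_psi_mem_kerU (x : D.Upoly) : (x : D.U) - (D.psi x : D.U) ∈ D.kerU := by
  obtain ⟨y, z, hz, rfl⟩ := D.exists_bosIncl_add x
  rw [map_add, psi_bosIncl, D.psi_of_mem_psiKer hz, add_zero, Subalgebra.coe_add, coe_bosIncl,
    add_sub_cancel_left]
  exact D.coe_mem_kerU.2 hz

/-- The kernel is a left ideal, so x(y - ψ(y)) is again in it. -/
theorem psi_mul_psi (x y : D.Upoly) : D.psi (x * D.bosIncl (D.psi y)) = D.psi (x * y) := by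
  refine D.psi_eq ?_
  have h1 := D.sub_psi_mem_kerU (x * y)
  have h2 := D.mul_mem_kerU x.2 (D.sub_psi_mem_kerU y)
  have h3 := sub_mem h1 h2
  rw [Subalgebra.coe_mul, mul_sub] at h3
  rw [Subalgebra.coe_mul, coe_bosIncl]
  have h4 : ∀ a b c : D.U, a - b - (a - c) = c - b := fun a b c => by abel
  rwa [h4] at h3

end Datum

end Projection

end PreNichols

namespace PreNichols

/-! ## The action of the coideal subalgebra on the regular module -/

open TensorProduct

section CoidealAction

variable {k : Type*} [Field k] {n : ℕ}

open NCPoly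

theorem SymmBicharacter.IsPreNicholsIdeal.lift_map_left_eq_zero {χ : SymmBicharacter k n}
    {I : TwoSidedIdeal (NCPoly k n)} (hI : χ.IsPreNicholsIdeal I) {W W' : Type*} [AddCommGroup W]
    [Module k W] [AddCommGroup W'] [Module k W'] {Y : Fin n → Module.End k W}
    (hY : ∀ p ∈ I, FreeAlgebra.lift k Y p = 0) {κ : Fin n → Module.End k W'}
    (hκ : ∀ i j, κ i * κ j = κ j * κ i) {p : NCPoly k n} (hp : p ∈ I) :
    FreeAlgebra.lift k (fun j => TensorProduct.map (Y j) (κ j)) p = 0 := by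
  refine hI.graded_induction
    (P := fun p => FreeAlgebra.lift k (fun j => TensorProduct.map (Y j) (κ j)) p = 0) hp
    (fun l x hx hl => ?_) (map_zero _) (fun x y hx hy => by rw [map_add, hx, hy, add_zero])
  obtain ⟨w, hw⟩ := exists_lift_map_left Y hκ l
  rw [hw x hl, hY x hx, TensorProduct.map_zero_left]

namespace Datum

variable (D : Datum k n)

/-- The operator `K_a` on the regular module of the negative Borel part. -/
noncomputable def borelTorus (a : Fin n → ℤ) : Module.End k ((Fin n → ℤ) →₀ D.A) :=
  Finsupp.lsum k fun μ => Finsupp.lsingle (μ + a) ∘ₗ D.twA (-a)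

theorem borelTorus_single (a μ : Fin n → ℤ) (y : D.A) :
    D.borelTorus a (Finsupp.single μ y) = Finsupp.single (μ + a) (D.twA (-a) y) := by
  simp [borelTorus]

theorem regularModule_K (i : Fin n) : D.regularModule.K i = D.borelTorus (Pi.single i 1) := rfl

theorem regularModule_L (i : Fin n) : D.regularModule.L i = D.borelTorus (-Pi.single i 1) :=
  Finsupp.lhom_ext fun μ y => by
    rw [regularModule_L_single, borelTorus_single, neg_neg, sub_eq_add_neg]

theorem borelTorus_mul (a b : Fin n → ℤ) :
    D.borelTorus a * D.borelTorus b = D.borelTorus (a + b) :=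
  Finsupp.lhom_ext fun μ y => by
    have h := LinearMap.congr_fun (D.twA_mul_twA (-a) (-b)) y
    rw [Module.End.mul_apply] at h
    rw [Module.End.mul_apply, borelTorus_single, borelTorus_single, borelTorus_single, h,
      add_assoc, add_comm b, neg_add]

theorem borelTorus_zero : D.borelTorus 0 = 1 :=
  Finsupp.lhom_ext fun μ y => by
    rw [borelTorus_single, neg_zero, twA_zero, add_zero]
    rfl

theorem borelTorus_mul_F (a : Fin n → ℤ) (j : Fin n) : D.borelTorus a * D.regularModule.F j =
    (D.χ.toFun (-a) (Pi.single j 1) : k) • (D.regularModule.F j * D.borelTorus a) :=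
  Finsupp.lhom_ext fun μ y => by
    have h := LinearMap.congr_fun (D.twA_mul_mulX (-a) j) y
    simp only [Module.End.mul_apply, LinearMap.smul_apply, mulX_apply] at h
    simp only [Module.End.mul_apply, LinearMap.smul_apply, regularModule_F_single,
      borelTorus_single, h, Finsupp.smul_single]

theorem borelTorus_comm (a b : Fin n → ℤ) :
    D.borelTorus a * D.borelTorus b = D.borelTorus b * D.borelTorus a := by
  rw [borelTorus_mul, borelTorus_mul, add_comm]

/-- The operator `K_a` on the regular module. -/
noncomputable def torus (a : Fin n → ℤ) : Module.End k (D.A ⊗[k] ((Fin n → ℤ) →₀ D.A)) :=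
  TensorProduct.map (D.twA a) (D.borelTorus a)

theorem torus_mul (a b : Fin n → ℤ) : D.torus a * D.torus b = D.torus (a + b) := by
  rw [torus, torus, torus, ← TensorProduct.map_mul, twA_mul_twA, borelTorus_mul]

theorem torus_zero : D.torus 0 = 1 := by
  rw [torus, twA_zero, borelTorus_zero, TensorProduct.map_one]

theorem torus_torus (a b : Fin n → ℤ) (m : D.A ⊗[k] ((Fin n → ℤ) →₀ D.A)) :
    D.torus a (D.torus b m) = D.torus (a + b) m := by
  rw [← torus_mul]; rfl

theorem action_Kpow (a : Fin n → ℤ) : D.regularModule.action (D.Kpow a) = D.torus a := by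
  refine zn_induction (P := fun a => D.regularModule.action (D.Kpow a) = D.torus a) ?_
    (fun a b ha hb => ?_) (fun i => ?_) (fun i => ?_) a
  · rw [Kpow_zero, map_one, torus_zero]
  · rw [Kpow_add, map_mul, ha, hb, torus_mul]
  · rw [Kpow_single, BorelModule.action, liftU_K, BorelModule.indK, regularModule_K, torus]
  · rw [Kpow_neg_single, BorelModule.action, liftU_Kinv, BorelModule.indL, regularModule_L, torus]

/-! ### The main part of the operators `Bⱼ` -/

/-- The summand of `Bⱼ` that acts by `βⱼ` on the first tensor factor. -/
noncomputable def indBeta (c : Fin n → k) (j : Fin n) :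
    Module.End k (D.A ⊗[k] ((Fin n → ℤ) →₀ D.A)) :=
  TensorProduct.map (D.beta c j) (D.regularModule.L j)

/-- The operator `Bⱼ` on the regular module without its raising part. -/
noncomputable def mainB (c : Fin n → k) (j : Fin n) :
    Module.End k (D.A ⊗[k] ((Fin n → ℤ) →₀ D.A)) :=
  D.regularModule.indPhi j + D.indBeta c j

/-- The split is by the effect on the torus component: `mainB` collects the two terms that involve
no Kⱼ with positive exponent on N, and `indRho` is the one that does. -/
theorem action_Bgen (c : Fin n → k) (j : Fin n) (m : D.A ⊗[k] ((Fin n → ℤ) →₀ D.A)) :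
    D.regularModule.action (D.Bgen c j) m = D.mainB c j m - D.regularModule.indRho j m := by
  have h1 : D.indBeta c j = D.regularModule.indXi j +
      c j • (BorelModule.indE (D.τ j) * D.regularModule.indL j) := by
    rw [indBeta, beta, TensorProduct.map_add_left, eta, BorelModule.indXi, BorelModule.indE,
      BorelModule.indL, ← TensorProduct.map_mul, one_mul, mul_smul_comm,
      TensorProduct.map_smul_left]
  rw [Bgen, map_add, map_smul, map_mul, mainB, h1, BorelModule.action, liftU_F, liftU_E,
    liftU_Kinv, BorelModule.indF]
  simp only [LinearMap.add_apply, LinearMap.sub_apply]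
  abel

theorem indBeta_mul_indPhi (c : Fin n → k) (i j : Fin n) :
    D.indBeta c i * D.regularModule.indPhi j =
      (D.χ.q i j : k) • (D.regularModule.indPhi j * D.indBeta c i) := by
  rw [indBeta, BorelModule.indPhi, ← TensorProduct.map_mul, ← TensorProduct.map_mul,
    BorelModule.L_mul_F, TensorProduct.map_smul_right, one_mul, mul_one]

/-- The two summands of `mainB` q-commute and satisfy the relations separately, one by the module
structure of N and the other by the hypothesis on β. -/
theorem lift_mainB_eq_zero {c : Fin n → k}
    (hβ : ∀ p ∈ D.I, FreeAlgebra.lift k (D.beta c) p = 0) {p : NCPoly k n} (hp : p ∈ D.I) :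
    FreeAlgebra.lift k (D.mainB c) p = 0 := by
  refine D.isPreNichols.lift_add_eq_zero (X := D.indBeta c) (Z := D.regularModule.indPhi)
    (D.indBeta_mul_indPhi c) (fun p hp => ?_) (fun p hp => ?_) hp
  · have h := lift_id_map (W' := D.A) D.regularModule.F p
    rw [D.regularModule.lift_F p hp, TensorProduct.map_zero_right] at h
    exact h
  · exact D.isPreNichols.lift_map_left_eq_zero hβ D.regularModule.L_comm hp

theorem torus_indPhi (a : Fin n → ℤ) (j : Fin n) (m : D.A ⊗[k] ((Fin n → ℤ) →₀ D.A)) :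
    D.torus a (D.regularModule.indPhi j m) =
      (D.χ.toFun (-a) (Pi.single j 1) : k) • D.regularModule.indPhi j (D.torus a m) := by
  have h : D.torus a * D.regularModule.indPhi j =
      (D.χ.toFun (-a) (Pi.single j 1) : k) • (D.regularModule.indPhi j * D.torus a) := by
    rw [torus, BorelModule.indPhi, ← TensorProduct.map_mul, ← TensorProduct.map_mul,
      borelTorus_mul_F, TensorProduct.map_smul_right, one_mul, mul_one]
  exact LinearMap.congr_fun h m

theorem torus_indRho (a : Fin n → ℤ) (j : Fin n) (m : D.A ⊗[k] ((Fin n → ℤ) →₀ D.A)) :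
    D.torus a (D.regularModule.indRho j m) =
      (D.χ.toFun (-a) (Pi.single j 1) : k) • D.regularModule.indRho j (D.torus a m) := by
  have h : D.torus a * D.regularModule.indRho j =
      (D.χ.toFun (-a) (Pi.single j 1) : k) • (D.regularModule.indRho j * D.torus a) := by
    rw [torus, BorelModule.indRho, ← TensorProduct.map_mul, ← TensorProduct.map_mul,
      regularModule_K, borelTorus_comm, twA_mul_dRA, TensorProduct.map_smul_left]
  exact LinearMap.congr_fun h m

theorem toFun_thetaLattice {a : Fin n → ℤ} (ha : a ∈ D.thetaLattice) (j : Fin n) :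
    D.χ.toFun a (Pi.single (D.τ j) 1) = D.χ.toFun (-a) (Pi.single j 1) := by
  induction ha using AddSubmonoid.closure_induction with
  | mem a ha =>
    obtain ⟨i, rfl⟩ := ha
    have h := D.toFun_theta (D.τ i) j
    rwa [D.τ_invol] at h
  | zero => rw [neg_zero, SymmBicharacter.toFun_zero_left, SymmBicharacter.toFun_zero_left]
  | add a b _ _ ha hb => rw [neg_add, D.χ.map_add_left, D.χ.map_add_left, ha, hb]

theorem torus_mainB (c : Fin n → k) {a : Fin n → ℤ} (ha : a ∈ D.thetaLattice) (j : Fin n)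
    (m : D.A ⊗[k] ((Fin n → ℤ) →₀ D.A)) :
    D.torus a (D.mainB c j m) =
      (D.χ.toFun (-a) (Pi.single j 1) : k) • D.mainB c j (D.torus a m) := by
  have h : D.torus a * D.indBeta c j =
      (D.χ.toFun (-a) (Pi.single j 1) : k) • (D.indBeta c j * D.torus a) := by
    rw [torus, indBeta, ← TensorProduct.map_mul, ← TensorProduct.map_mul,
      regularModule_L, borelTorus_comm, D.twA_mul_beta c (D.toFun_thetaLattice ha j),
      TensorProduct.map_smul_left]
  have h2 := LinearMap.congr_fun h m
  rw [Module.End.mul_apply, LinearMap.smul_apply, Module.End.mul_apply] at h2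
  rw [mainB, LinearMap.add_apply, map_add, torus_indPhi, h2, LinearMap.add_apply, smul_add]

/-- Past `xi` the derivation ∂ᵢᴿ picks up only a scalar, since ∂ᴿ and ∂ᴸ commute. In `eta` it meets
the factor X_{τ(j)}, and for i = τ(j) this leaves a torus element with weight in the lattice of H_θ.
-/
theorem dRA_mul_beta (c : Fin n → k) (i j : Fin n) :
    D.dRA i * D.beta c j = (((D.χ.q i j)⁻¹ : kˣ) : k) • (D.beta c j * D.dRA i) +
      if i = D.τ j then c j • D.twA (Pi.single i 1 - Pi.single j 1) else 0 := by
  have h1 : D.dRA i * D.xi j = (((D.χ.q i j)⁻¹ : kˣ) : k) • (D.xi j * D.dRA i) := by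
    rw [xi, ← mul_assoc, dRA_mul_twA, smul_mul_assoc, mul_assoc, ← dLA_mul_dRA,
      SymmBicharacter.toFun_neg_left, toFun_single, D.χ.q_symm, mul_assoc]
  have h2 : D.dRA i * D.eta c j = (((D.χ.q i j)⁻¹ : kˣ) : k) • (D.eta c j * D.dRA i) +
      if i = D.τ j then c j • D.twA (Pi.single i 1 - Pi.single j 1) else 0 := by
    rw [eta, ← mul_assoc, dRA_mul_mulX, add_mul, mul_assoc, mul_smul_comm (c j), dRA_mul_twA,
      SymmBicharacter.toFun_neg_left, toFun_single, D.χ.q_symm]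
    congr 1
    · simp only [mul_smul_comm, smul_mul_assoc, mul_assoc]
      rw [smul_comm]
    · split_ifs
      · rw [mul_smul_comm, twA_mul_twA, sub_eq_add_neg]
      · rw [zero_mul]
  rw [beta, mul_add, h1, h2, add_mul, smul_add, add_assoc]

theorem indRho_mainB (c : Fin n → k) (i j : Fin n) (m : D.A ⊗[k] ((Fin n → ℤ) →₀ D.A)) :
    D.regularModule.indRho i (D.mainB c j m) =
      (((D.χ.q i j)⁻¹ : kˣ) : k) • D.mainB c j (D.regularModule.indRho i m) +
        if i = D.τ j then c j • D.torus (Pi.single i 1 - Pi.single j 1) m else 0 := by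
  have h1 : D.regularModule.indRho i * D.regularModule.indPhi j = (((D.χ.q i j)⁻¹ : kˣ) : k) •
      (D.regularModule.indPhi j * D.regularModule.indRho i) := by
    rw [BorelModule.indRho, BorelModule.indPhi, ← TensorProduct.map_mul, ← TensorProduct.map_mul,
      D.regularModule.K_mul_F, TensorProduct.map_smul_right, one_mul, mul_one]
  have h2 : D.regularModule.indRho i * D.indBeta c j = (((D.χ.q i j)⁻¹ : kˣ) : k) •
      (D.indBeta c j * D.regularModule.indRho i) +
        if i = D.τ j then c j • D.torus (Pi.single i 1 - Pi.single j 1) else 0 := by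
    rw [BorelModule.indRho, indBeta, ← TensorProduct.map_mul, ← TensorProduct.map_mul,
      dRA_mul_beta, TensorProduct.map_add_left, TensorProduct.map_smul_left, regularModule_K,
      regularModule_L, borelTorus_comm]
    congr 1
    split_ifs
    · rw [TensorProduct.map_smul_left, borelTorus_mul, torus, neg_add_eq_sub]
    · rw [TensorProduct.map_zero_left]
  have h1' := LinearMap.congr_fun h1 m
  have h2' := LinearMap.congr_fun h2 m
  rw [Module.End.mul_apply, LinearMap.smul_apply, Module.End.mul_apply] at h1'
  rw [Module.End.mul_apply, LinearMap.add_apply, LinearMap.smul_apply, Module.End.mul_apply] at h2'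
  rw [mainB, LinearMap.add_apply, map_add, h1', h2', LinearMap.add_apply, smul_add, add_assoc]
  congr 2
  split_ifs <;> rfl

theorem indRho_cyclicVec (j : Fin n) : D.regularModule.indRho j D.cyclicVec = 0 := by
  rw [BorelModule.indRho, cyclicVec, TensorProduct.map_tmul, dRA_one, TensorProduct.zero_tmul]

/-! ### The lowest part of a polynomial in the `Bⱼ` -/

theorem wtProjA_twA (Q : (Fin n → ℤ) → Prop) (a : Fin n → ℤ) (y : D.A) :
    D.wtProjA Q (D.twA a y) = D.twA a (D.wtProjA Q y) := by
  classical
  induction y using D.A_induction_monomial with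
  | mon J =>
    rw [twA_monomial, map_smul, wtProjA_monomial]
    split_ifs
    · rw [twA_monomial]
    · rw [map_zero, smul_zero]
  | zero => simp
  | add x y hx hy => simp only [map_add, hx, hy]
  | smul a x hx => simp only [map_smul, hx]

theorem wtProjA_X_mul (Q : (Fin n → ℤ) → Prop) (j : Fin n) (y : D.A) :
    D.wtProjA Q (D.X j * y) = D.X j * D.wtProjA (fun w => Q (w + Pi.single j 1)) y := by
  obtain ⟨p, rfl⟩ := D.toA_surjective y
  rw [← toA_ι_mul, wtProjA_toA, wtProjA_toA, wtProj_ι_mul, toA_ι_mul]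

theorem borelTorusProj_F (l : Fin n → ℤ) (j : Fin n) :
    D.borelTorusProj l * D.regularModule.F j =
      D.regularModule.F j * D.borelTorusProj (l + Pi.single j 1) :=
  Finsupp.lhom_ext fun μ y => by
    have h : ∀ w : Fin n → ℤ, μ - (w + Pi.single j 1) = l ↔ μ - w = l + Pi.single j 1 :=
      fun w => by rw [← sub_sub, sub_eq_iff_eq_add]
    simp only [Module.End.mul_apply, regularModule_F_single, borelTorusProj_single, wtProjA_X_mul,
      h]

theorem borelTorusProj_borelTorus (l a : Fin n → ℤ) :
    D.borelTorusProj l * D.borelTorus a = D.borelTorus a * D.borelTorusProj (l - a) :=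
  Finsupp.lhom_ext fun μ y => by
    have h : ∀ w : Fin n → ℤ, μ + a - w = l ↔ μ - w = l - a :=
      fun w => by rw [eq_sub_iff_add_eq, sub_add_eq_add_sub]
    simp only [Module.End.mul_apply, borelTorus_single, borelTorusProj_single, wtProjA_twA, h]

theorem torusProj_mainB (c : Fin n → k) (l : Fin n → ℤ) (j : Fin n)
    (m : D.A ⊗[k] ((Fin n → ℤ) →₀ D.A)) :
    D.torusProj l (D.mainB c j m) = D.mainB c j (D.torusProj (l + Pi.single j 1) m) := by
  have h1 : D.torusProj l * D.regularModule.indPhi j =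
      D.regularModule.indPhi j * D.torusProj (l + Pi.single j 1) := by
    rw [torusProj, torusProj, BorelModule.indPhi, ← TensorProduct.map_mul, ← TensorProduct.map_mul,
      borelTorusProj_F]
  have h2 : D.torusProj l * D.indBeta c j = D.indBeta c j * D.torusProj (l + Pi.single j 1) := by
    rw [torusProj, torusProj, indBeta, ← TensorProduct.map_mul, ← TensorProduct.map_mul,
      regularModule_L, borelTorusProj_borelTorus, one_mul, mul_one, sub_neg_eq_add]
  have h1' := LinearMap.congr_fun h1 m
  have h2' := LinearMap.congr_fun h2 m
  rw [Module.End.mul_apply, Module.End.mul_apply] at h1' h2'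
  rw [mainB, LinearMap.add_apply, map_add, h1', h2', LinearMap.add_apply]

theorem torusProj_indRho (l : Fin n → ℤ) (j : Fin n) (m : D.A ⊗[k] ((Fin n → ℤ) →₀ D.A)) :
    D.torusProj l (D.regularModule.indRho j m) =
      D.regularModule.indRho j (D.torusProj (l - Pi.single j 1) m) := by
  have h : D.torusProj l * D.regularModule.indRho j =
      D.regularModule.indRho j * D.torusProj (l - Pi.single j 1) := by
    rw [torusProj, torusProj, BorelModule.indRho, ← TensorProduct.map_mul, ← TensorProduct.map_mul,
      regularModule_K, borelTorusProj_borelTorus, one_mul, mul_one]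
  exact LinearMap.congr_fun h m

theorem torusProj_cyclicVec (l : Fin n → ℤ) :
    D.torusProj l D.cyclicVec = if l = 0 then D.cyclicVec else 0 := by
  have h := D.torusProj_tri l ([], 0, [])
  have h2 : D.tri ([], 0, []) = D.cyclicVec := by rw [tri, monomial_nil, toA_one, cyclicVec]
  rw [h2] at h
  rw [h, torusIndex, wt_nil, sub_zero]
  simp only [eq_comm]

/-- Each factor lowers the torus index by αⱼ through `mainB` or raises it through `indRho`. Total
degree -|J| is the minimum and is reached only if every factor contributes its main part. The bound
on l is an inequality, not an equality, to carry the induction. -/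
theorem torusProj_prod_Bgen (c : Fin n → k) (J : List (Fin n)) (l : Fin n → ℤ)
    (hl : ∑ i, l i ≤ -J.length) :
    D.torusProj l (D.regularModule.action ((J.map (D.Bgen c)).prod) D.cyclicVec) =
      if l = -wt J then (J.map (D.mainB c)).prod D.cyclicVec else 0 := by
  induction J generalizing l with
  | nil =>
    rw [List.map_nil, List.prod_nil, map_one, wt_nil, neg_zero]
    exact D.torusProj_cyclicVec l
  | cons j J ih =>
    have hsum : ∑ i, (Pi.single j 1 : Fin n → ℤ) i = 1 := by simp
    rw [List.length_cons] at hl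
    push_cast at hl
    -- A raising step would have to start at total degree at most -|J| - 2, below the minimum -|J|
    -- for the shorter word.
    have hne : l - Pi.single j 1 ≠ -wt J := by
      intro h
      have h2 := congrArg (fun w => ∑ i, w i) h
      simp only [Pi.sub_apply, Pi.neg_apply, Finset.sum_sub_distrib, Finset.sum_neg_distrib, hsum,
        sum_wt] at h2
      omega
    rw [List.map_cons, List.prod_cons, map_mul, Module.End.mul_apply, action_Bgen, map_sub,
      torusProj_mainB, torusProj_indRho, ih, ih, if_neg hne, map_zero, sub_zero]
    · have h : l + Pi.single j 1 = -wt J ↔ l = -wt (j :: J) := by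
        rw [wt_cons, neg_add, ← sub_eq_add_neg, eq_sub_iff_add_eq]
      simp only [h]
      split_ifs
      · rw [List.map_cons, List.prod_cons, Module.End.mul_apply]
      · rw [map_zero]
    · simp only [Pi.sub_apply, Finset.sum_sub_distrib, hsum]
      omega
    · simp only [Pi.add_apply, Finset.sum_add_distrib, hsum]
      omega

theorem torusProj_lift_Bgen (c : Fin n → k) {l : Fin n → ℕ} {p : NCPoly k n} (hp : p ∈ homog l) :
    D.torusProj (fun i => -(l i : ℤ))
      (D.regularModule.action (FreeAlgebra.lift k (D.Bgen c) p) D.cyclicVec) =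
        FreeAlgebra.lift k (D.mainB c) p D.cyclicVec := by
  refine homog_induction (P := fun p => D.torusProj (fun i => -(l i : ℤ))
      (D.regularModule.action (FreeAlgebra.lift k (D.Bgen c) p) D.cyclicVec) =
        FreeAlgebra.lift k (D.mainB c) p D.cyclicVec) hp
    (fun J hJ => ?_) (by simp) (fun x y hx hy => ?_) (fun a x hx => ?_)
  · have h : (fun i => -(l i : ℤ)) = -wt J := by rw [hJ]; rfl
    rw [lift_monomial, h, torusProj_prod_Bgen, if_pos rfl]
    · exact (LinearMap.congr_fun (lift_monomial (D.mainB c) J) D.cyclicVec).symm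
    simp only [Pi.neg_apply, Finset.sum_neg_distrib, sum_wt, le_refl]
  · rw [map_add, map_add, LinearMap.add_apply, map_add, hx, hy, map_add, LinearMap.add_apply]
  · rw [map_smul, map_smul, LinearMap.smul_apply, map_smul, hx, map_smul, LinearMap.smul_apply]

theorem counitA_monomial (J : List (Fin n)) :
    D.counitA (D.toA (monomial J)) = if J = [] then 1 else 0 := by
  split_ifs with h
  · rw [h, monomial_nil, toA_one, counitA_one]
  · rw [counitA_toA, counit_monomial J h]

theorem counitA_twA (a : Fin n → ℤ) (y : D.A) : D.counitA (D.twA a y) = D.counitA y := by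
  induction y using D.A_induction_monomial with
  | mon J =>
    rw [twA_monomial, map_smul, counitA_monomial]
    split_ifs with h
    · rw [h, SymmBicharacter.twScalar, List.map_nil, List.prod_nil, Units.val_one, one_smul]
    · rw [smul_zero]
  | zero => simp
  | add x y hx hy => simp only [map_add, hx, hy]
  | smul a x hx => simp only [map_smul, hx]

theorem counitA_wtProjA (y : D.A) :
    D.counitA (D.wtProjA (fun w => w = fun _ => ((0 : ℕ) : ℤ)) y) = D.counitA y := by
  classical
  induction y using D.A_induction_monomial with
  | mon J =>
    rw [wtProjA_monomial, counitA_monomial]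
    by_cases h : J = []
    · subst h
      rw [if_pos, counitA_monomial, if_pos rfl]
      exact wt_nil
    · rw [if_neg h]
      split_ifs
      · rw [counitA_monomial, if_neg h]
      · rw [map_zero]
  | zero => simp
  | add x y hx hy => simp only [map_add, hx, hy]
  | smul a x hx => simp only [map_smul, hx]

/-- The augmentation of the regular module of the negative Borel part. -/
noncomputable def borelAug : ((Fin n → ℤ) →₀ D.A) →ₗ[k] k := Finsupp.lsum k fun _ => D.counitA

theorem borelAug_single (μ : Fin n → ℤ) (y : D.A) :
    D.borelAug (Finsupp.single μ y) = D.counitA y := by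
  simp [borelAug]

/-- The map from the regular module to `A` given by the augmentation. -/
noncomputable def augMap : D.A ⊗[k] ((Fin n → ℤ) →₀ D.A) →ₗ[k] D.A :=
  (TensorProduct.rid k D.A).toLinearMap ∘ₗ TensorProduct.map LinearMap.id D.borelAug

theorem augMap_tmul (a : D.A) (f : (Fin n → ℤ) →₀ D.A) :
    D.augMap (a ⊗ₜ f) = D.borelAug f • a := by
  simp [augMap]

/-- The augmentation of N kills the image of Fⱼ and absorbs the torus, so only β remains of b. -/
theorem augMap_mainB (c : Fin n → k) (j : Fin n) (m : D.A ⊗[k] ((Fin n → ℤ) →₀ D.A)) :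
    D.augMap (D.mainB c j m) = D.beta c j (D.augMap m) := by
  induction m with
  | zero => simp
  | add x y hx hy => simp only [map_add, hx, hy]
  | tmul a f =>
    have hF : D.borelAug (D.regularModule.F j f) = 0 := by
      induction f using Finsupp.induction_linear with
      | zero => simp
      | add f g hf hg => rw [map_add, map_add, hf, hg, add_zero]
      | single μ y => rw [regularModule_F_single, borelAug_single, counitA_X_mul]
    have hL : D.borelAug (D.regularModule.L j f) = D.borelAug f := by
      clear hF
      induction f using Finsupp.induction_linear with
      | zero => simp
      | add f g hf hg => simp only [map_add, hf, hg]
      | single μ y => rw [regularModule_L_single, borelAug_single, borelAug_single, counitA_twA]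
    rw [mainB, LinearMap.add_apply, map_add, BorelModule.indPhi, indBeta, TensorProduct.map_tmul,
      TensorProduct.map_tmul, augMap_tmul, augMap_tmul, augMap_tmul, hF, hL, zero_smul, zero_add,
      map_smul]

/-- Augmenting both copies of A sees only the component of degree zero in each, which is what π₀₀
retains. -/
theorem counitA_augMap_degProj (m : D.A ⊗[k] ((Fin n → ℤ) →₀ D.A)) :
    D.counitA (D.augMap (D.degProj (0, 0) m)) = D.counitA (D.augMap m) := by
  induction m with
  | zero => simp
  | add x y hx hy => simp only [map_add, hx, hy]
  | tmul a f =>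
    have hf : D.borelAug (Finsupp.mapRange.linearMap
        (D.wtProjA fun w => w = fun _ => ((0 : ℕ) : ℤ)) f) = D.borelAug f := by
      induction f using Finsupp.induction_linear with
      | zero => simp
      | add f g hf hg => simp only [map_add, hf, hg]
      | single μ y =>
        rw [Finsupp.mapRange.linearMap_apply, Finsupp.mapRange_single, borelAug_single,
          borelAug_single, counitA_wtProjA]
    have h : D.degProj (0, 0) (a ⊗ₜ f) = D.wtProjA (fun w => w = fun _ => ((0 : ℕ) : ℤ)) a ⊗ₜ
        Finsupp.mapRange.linearMap (D.wtProjA fun w => w = fun _ => ((0 : ℕ) : ℤ)) f := rfl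
    rw [h, augMap_tmul, augMap_tmul, hf, map_smul, map_smul, counitA_wtProjA]

/-- The translation of condition (c): in the regular module P₋λ extracts p(b)v from p(B)v, and π₀₀
followed by the augmentations gives the constant term of p(β)1. -/
theorem counitA_lift_beta_eq_zero {c : Fin n → k} {l : Fin n → ℕ} {p : NCPoly k n}
    (hp : p ∈ homog l)
    (h : D.proj 0 0 (D.P (fun i => -(l i : ℤ)) (FreeAlgebra.lift k (D.Bgen c) p)) = 0) :
    D.counitA (FreeAlgebra.lift k (D.beta c) p 1) = 0 := by
  have h1 := congrArg D.triEquiv.symm h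
  rw [triEquiv_symm_proj, triEquiv_symm_P, triEquiv_symm_apply, torusProj_lift_Bgen D c hp,
    map_zero] at h1
  have h2 := D.counitA_augMap_degProj (FreeAlgebra.lift k (D.mainB c) p D.cyclicVec)
  rw [h1, map_zero, map_zero, lift_intertwine (D.augMap_mainB c), cyclicVec, augMap_tmul,
    borelAug_single, counitA_one, one_smul] at h2
  exact h2.symm

theorem ConditionC.lift_mainB_eq_zero {c : Fin n → k} (hc : D.ConditionC c) {p : NCPoly k n}
    (hp : p ∈ D.I) : FreeAlgebra.lift k (D.mainB c) p = 0 := by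
  obtain ⟨S, hS, h⟩ := hc
  refine D.lift_mainB_eq_zero (fun p hp => D.lift_beta_eq_zero hS (fun s hs => ?_) hp) hp
  obtain ⟨l, hl, hs'⟩ := h s hs
  exact ⟨l, hl, D.counitA_lift_beta_eq_zero hl hs'⟩

end Datum

end CoidealAction

end PreNichols

namespace PreNichols

/-! ## The restriction of the projection to the coideal subalgebra -/

open TensorProduct

section Filtration

variable {k : Type*} [Field k] {n : ℕ}

open NCPoly

/-- T is the identity plus a map that lowers an exhaustive filtration starting at zero. In the
application `Fil m` means degree less than m. -/
theorem bijective_of_sub_mem_filtration {V : Type*} [AddCommGroup V] [Module k V] {T : V →ₗ[k] V}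
    {Fil : ℕ → Submodule k V} (zero : Fil 0 = ⊥) (exhaustive : ∀ x, ∃ m, x ∈ Fil m)
    (lower : ∀ m, ∀ x ∈ Fil (m + 1), T x - x ∈ Fil m) : Function.Bijective T := by
  constructor
  · rw [← LinearMap.ker_eq_bot, LinearMap.ker_eq_bot']
    intro x hx
    obtain ⟨m, hm⟩ := exhaustive x
    induction m with
    | zero => rwa [zero, Submodule.mem_bot] at hm
    | succ m ih =>
      have h := lower m x hm
      rw [hx, zero_sub, neg_mem_iff] at h
      exact ih h
  · have h : ∀ m, ∀ x ∈ Fil m, x ∈ LinearMap.range T := by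
      intro m
      induction m with
      | zero =>
        intro x hx
        rw [zero, Submodule.mem_bot] at hx
        rw [hx]; exact zero_mem _
      | succ m ih =>
        intro x hx
        have h2 := sub_mem (LinearMap.mem_range_self T x) (ih _ (lower m x hx))
        rwa [sub_sub_cancel] at h2
    intro x
    obtain ⟨m, hm⟩ := exhaustive x
    exact h m x hm

namespace Datum

variable (D : Datum k n)

/-! ### The degree filtrations -/

/-- The span of the monomials of length less than `m` in the pre-Nichols algebra. -/
noncomputable def filA (m : ℕ) : Submodule k D.A :=
  Submodule.span k {y | ∃ J : List (Fin n), J.length < m ∧ y = D.toA (monomial J)}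

theorem monomial_mem_filA {J : List (Fin n)} {m : ℕ} (h : J.length < m) :
    D.toA (monomial J) ∈ D.filA m :=
  Submodule.subset_span ⟨J, h, rfl⟩

theorem filA_mono {m m' : ℕ} (h : m ≤ m') : D.filA m ≤ D.filA m' :=
  Submodule.span_mono fun _ ⟨J, hJ, hy⟩ => ⟨J, hJ.trans_le h, hy⟩

theorem twA_mem_filA (a : Fin n → ℤ) {m : ℕ} {y : D.A} (hy : y ∈ D.filA m) :
    D.twA a y ∈ D.filA m := by
  refine Submodule.span_le (p := (D.filA m).comap (D.twA a)) |>.2 ?_ hy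
  rintro _ ⟨J, hJ, rfl⟩
  rw [SetLike.mem_coe, Submodule.mem_comap, twA_monomial]
  exact Submodule.smul_mem _ _ (D.monomial_mem_filA hJ)

theorem X_mul_mem_filA (j : Fin n) {m : ℕ} {y : D.A} (hy : y ∈ D.filA m) :
    D.X j * y ∈ D.filA (m + 1) := by
  refine Submodule.span_le (p := (D.filA (m + 1)).comap (D.mulX j)) |>.2 ?_ hy
  rintro _ ⟨J, hJ, rfl⟩
  rw [SetLike.mem_coe, Submodule.mem_comap, mulX_apply, ← toA_ι_mul, ← monomial_cons]
  exact D.monomial_mem_filA (by simpa using hJ)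

theorem dLA_monomial_mem_filA (i : Fin n) (J : List (Fin n)) :
    D.dLA i (D.toA (monomial J)) ∈ D.filA J.length := by
  induction J with
  | nil => rw [monomial_nil, toA_one, dLA_one]; exact zero_mem _
  | cons j J ih =>
    have h := LinearMap.congr_fun (D.dLA_mul_mulX i j) (D.toA (monomial J))
    simp only [Module.End.mul_apply, LinearMap.add_apply, LinearMap.smul_apply, mulX_apply] at h
    rw [monomial_cons, toA_ι_mul, h]
    refine add_mem ?_ (Submodule.smul_mem _ _ (D.X_mul_mem_filA j ih))
    split_ifs
    · exact D.monomial_mem_filA (by simp)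
    · exact zero_mem _

theorem dLA_mem_filA (i : Fin n) {m : ℕ} {y : D.A} (hy : y ∈ D.filA (m + 1)) :
    D.dLA i y ∈ D.filA m := by
  refine Submodule.span_le (p := (D.filA m).comap (D.dLA i)) |>.2 ?_ hy
  rintro _ ⟨J, hJ, rfl⟩
  exact D.filA_mono (Nat.lt_succ_iff.1 hJ) (D.dLA_monomial_mem_filA i J)

/-- The part of degree less than `m` of the partial bosonization. -/
noncomputable def bosFil (m : ℕ) : Submodule k D.partialBos :=
  Submodule.span k {x | ∃ (J : List (Fin n)) (μ : D.thetaLattice), J.length < m ∧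
    x = D.bosEquiv (Finsupp.single μ (D.toA (monomial J)))}

theorem bosFil_zero : D.bosFil 0 = ⊥ := by
  rw [bosFil, Submodule.span_eq_bot]
  rintro _ ⟨J, μ, hJ, _⟩
  exact absurd hJ (Nat.not_lt_zero _)

theorem bosFil_mono {m m' : ℕ} (h : m ≤ m') : D.bosFil m ≤ D.bosFil m' :=
  Submodule.span_mono fun _ ⟨J, μ, hJ, hy⟩ => ⟨J, μ, hJ.trans_le h, hy⟩

theorem exists_mem_bosFil (x : D.partialBos) : ∃ m, x ∈ D.bosFil m := by
  have hadd : ∀ x y, (∃ m, x ∈ D.bosFil m) → (∃ m, y ∈ D.bosFil m) → ∃ m, x + y ∈ D.bosFil m := by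
    rintro x y ⟨m, hm⟩ ⟨m', hm'⟩
    exact ⟨max m m', add_mem (D.bosFil_mono (le_max_left _ _) hm)
      (D.bosFil_mono (le_max_right _ _) hm')⟩
  obtain ⟨f, rfl⟩ := D.bosEquiv.surjective x
  induction f using Finsupp.induction_linear with
  | zero => exact ⟨0, by rw [map_zero]; exact zero_mem _⟩
  | add f g hf hg => rw [map_add]; exact hadd _ _ hf hg
  | single μ y =>
    induction y using D.A_induction_monomial with
    | mon J => exact ⟨J.length + 1, Submodule.subset_span ⟨J, μ, Nat.lt_succ_self _, rfl⟩⟩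
    | zero => exact ⟨0, by rw [Finsupp.single_zero, map_zero]; exact zero_mem _⟩
    | add x y hx hy => rw [Finsupp.single_add, map_add]; exact hadd _ _ hx hy
    | smul a x hx =>
      obtain ⟨m, hm⟩ := hx
      exact ⟨m, by rw [← Finsupp.smul_single, map_smul]; exact Submodule.smul_mem _ _ hm⟩

theorem bosEquiv_single_mem_bosFil (μ : D.thetaLattice) {m : ℕ} {y : D.A} (hy : y ∈ D.filA m) :
    D.bosEquiv (Finsupp.single μ y) ∈ D.bosFil m := by
  refine Submodule.span_le (p := (D.bosFil m).comap
    (D.bosEquiv.toLinearMap ∘ₗ Finsupp.lsingle μ)) |>.2 ?_ hy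
  rintro _ ⟨J, hJ, rfl⟩
  exact Submodule.subset_span ⟨J, μ, hJ, rfl⟩

/-- The elements that `ψ` maps to the part of degree less than `m`. -/
noncomputable def kerFil (m : ℕ) : Submodule k D.U :=
  (D.bosFil m).map D.partialBos.val.toLinearMap ⊔ D.kerU

theorem kerU_le_kerFil (m : ℕ) : D.kerU ≤ D.kerFil m := le_sup_right

theorem coe_mem_kerFil {m : ℕ} {x : D.partialBos} (hx : x ∈ D.bosFil m) : (x : D.U) ∈ D.kerFil m :=
  (le_sup_left : _ ≤ D.kerFil m) ⟨x, hx, rfl⟩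

theorem kerFil_mono {m m' : ℕ} (h : m ≤ m') : D.kerFil m ≤ D.kerFil m' :=
  sup_le_sup_right (Submodule.map_mono (D.bosFil_mono h)) _

theorem evF_mul_Kpow_mem_kerFil {m : ℕ} {y : D.A} (hy : y ∈ D.filA m) {μ : Fin n → ℤ}
    (hμ : μ ∈ D.thetaLattice) : D.evF y * D.Kpow μ ∈ D.kerFil m := by
  have h := D.coe_mem_kerFil (D.bosEquiv_single_mem_bosFil ⟨μ, hμ⟩ hy)
  rwa [coe_bosEquiv_single] at h

theorem kerFil_le {m : ℕ} {V : Submodule k D.U} (hker : D.kerU ≤ V)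
    (h : ∀ y ∈ D.filA m, ∀ μ ∈ D.thetaLattice, D.evF y * D.Kpow μ ∈ V) : D.kerFil m ≤ V := by
  refine sup_le ?_ hker
  rw [bosFil, Submodule.map_span, Submodule.span_le]
  rintro _ ⟨_, ⟨J, μ, hJ, rfl⟩, rfl⟩
  show (D.bosEquiv (Finsupp.single μ (D.toA (monomial J))) : D.U) ∈ V
  rw [coe_bosEquiv_single]
  exact h _ (D.monomial_mem_filA hJ) μ μ.2

theorem psi_mem_bosFil {m : ℕ} {x : D.Upoly} (hx : (x : D.U) ∈ D.kerFil m) :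
    D.psi x ∈ D.bosFil m := by
  obtain ⟨_, ⟨y, hy, rfl⟩, z, hz, hyz⟩ := Submodule.mem_sup.1 hx
  have h : D.psi x = y := by
    refine D.psi_eq ?_
    rw [← hyz]
    have h2 : D.partialBos.val.toLinearMap y + z - (y : D.U) = z := add_sub_cancel_left _ _
    rwa [h2]
  rwa [h]

theorem Kpow_mul_mem_kerFil {m : ℕ} {a : Fin n → ℤ} (ha : a ∈ D.thetaLattice) {x : D.U}
    (hx : x ∈ D.kerFil m) : D.Kpow a * x ∈ D.kerFil m := by
  refine D.kerFil_le (V := (D.kerFil m).comap (LinearMap.mulLeft k (D.Kpow a)))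
    (fun z hz => ?_) (fun y hy μ hμ => ?_) hx
  · exact D.kerU_le_kerFil m (D.mul_mem_kerU (D.Kpow_mem_Upoly ha) hz)
  · rw [Submodule.mem_comap, LinearMap.mulLeft_apply, ← mul_assoc, Kpow_mul_evF, mul_assoc,
      ← Kpow_add]
    exact D.evF_mul_Kpow_mem_kerFil (D.twA_mem_filA _ hy) (add_mem ha hμ)

theorem F_mul_mem_kerFil (j : Fin n) {m : ℕ} {x : D.U} (hx : x ∈ D.kerFil m) :
    D.F j * x ∈ D.kerFil (m + 1) := by
  refine D.kerFil_le (V := (D.kerFil (m + 1)).comap (LinearMap.mulLeft k (D.F j)))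
    (fun z hz => ?_) (fun y hy μ hμ => ?_) hx
  · exact D.kerU_le_kerFil _ (D.mul_mem_kerU (D.F_mem_Upoly j) hz)
  · rw [Submodule.mem_comap, LinearMap.mulLeft_apply, ← mul_assoc, ← evF_X, ← evF_mul]
    exact D.evF_mul_Kpow_mem_kerFil (D.X_mul_mem_filA j hy) hμ

theorem E_mul_Kinv_mem_Upoly (j : Fin n) : D.E (D.τ j) * D.Kinv j ∈ D.Upoly :=
  (D.mem_kerU.1 (D.E_mul_Kinv_mem_kerU j)).1

/-- Modulo the kernel of ψ this element acts by ∂ᴸ up to torus factors, and ∂ᴸ lowers the degree by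
one. Everything that separates Bⱼ from Fⱼ is thus of lower order. -/
theorem E_mul_Kinv_mul_mem_kerFil (j : Fin n) {m : ℕ} {x : D.U} (hx : x ∈ D.kerFil (m + 1)) :
    D.E (D.τ j) * D.Kinv j * x ∈ D.kerFil m := by
  refine D.kerFil_le (V := (D.kerFil m).comap (LinearMap.mulLeft k (D.E (D.τ j) * D.Kinv j)))
    (fun z hz => ?_) (fun y hy μ hμ => ?_) hx
  · exact D.kerU_le_kerFil _ (D.mul_mem_kerU (D.E_mul_Kinv_mem_Upoly j) hz)
  · rw [Submodule.mem_comap, LinearMap.mulLeft_apply, ← mul_assoc]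
    have h1 := D.mul_Kpow_mem_kerU hμ (D.E_mul_Kinv_mul_evF_sub_mem j y)
    rw [sub_mul, mul_assoc (D.evF _), ← Kpow_add] at h1
    have h2 := add_mem (D.kerU_le_kerFil m h1) (D.evF_mul_Kpow_mem_kerFil
      (D.twA_mem_filA (-Pi.single (D.τ j) 1) (D.dLA_mem_filA (D.τ j)
        (D.twA_mem_filA (Pi.single j 1) hy)))
      (add_mem (D.single_τ_sub_mem_thetaLattice j) hμ))
    rwa [sub_add_cancel] at h2

theorem Bgen_mul_sub_mem_kerFil (c : Fin n → k) (j : Fin n) {m : ℕ} {x : D.U}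
    (hx : x ∈ D.kerFil (m + 1)) : D.Bgen c j * x - D.F j * x ∈ D.kerFil m := by
  rw [Bgen, add_mul, add_sub_cancel_left, smul_mul_assoc]
  exact Submodule.smul_mem _ _ (D.E_mul_Kinv_mul_mem_kerFil j hx)

theorem Bgen_mul_mem_kerFil (c : Fin n → k) (j : Fin n) {m : ℕ} {x : D.U}
    (hx : x ∈ D.kerFil m) : D.Bgen c j * x ∈ D.kerFil (m + 1) := by
  have h := add_mem (D.kerFil_mono (Nat.le_add_right m 1) (D.Bgen_mul_sub_mem_kerFil c j
    (D.kerFil_mono (Nat.le_add_right m 1) hx))) (D.F_mul_mem_kerFil j hx)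
  rwa [sub_add_cancel] at h

theorem prod_F_mul_mem_kerFil (J : List (Fin n)) {m : ℕ} {x : D.U} (hx : x ∈ D.kerFil m) :
    (J.map D.F).prod * x ∈ D.kerFil (J.length + m) := by
  induction J with
  | nil => simpa using hx
  | cons j J ih =>
    rw [List.map_cons, List.prod_cons, mul_assoc, List.length_cons, add_right_comm]
    exact D.F_mul_mem_kerFil j ih

/-- Replacing the Bⱼ by Fⱼ one at a time. As `kerFil (m + 1)` means degree at most m, both products
have degree at most |J| + m and the difference has smaller degree. -/
theorem prod_Bgen_mul_sub_mem_kerFil (c : Fin n → k) (J : List (Fin n)) {m : ℕ} {x : D.U}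
    (hx : x ∈ D.kerFil (m + 1)) :
    (J.map (D.Bgen c)).prod * x - (J.map D.F).prod * x ∈ D.kerFil (J.length + m) := by
  induction J with
  | nil => simp
  | cons j J ih =>
    have h1 := D.Bgen_mul_mem_kerFil c j ih
    have hF := D.prod_F_mul_mem_kerFil J hx
    rw [← add_assoc] at hF
    have h2 := D.kerFil_mono (Nat.le_add_right _ 1) (D.Bgen_mul_sub_mem_kerFil c j hF)
    have h3 := add_mem h1 h2
    rw [mul_sub, sub_add_sub_cancel] at h3
    rw [List.map_cons, List.map_cons, List.prod_cons, List.prod_cons, mul_assoc, mul_assoc,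
      List.length_cons, add_right_comm]
    exact h3

theorem one_mem_kerFil : (1 : D.U) ∈ D.kerFil 1 := by
  have h := D.evF_mul_Kpow_mem_kerFil (D.monomial_mem_filA (J := []) Nat.one_pos)
    (zero_mem D.thetaLattice)
  rwa [monomial_nil, toA_one, evF_one, Kpow_zero, mul_one] at h

theorem Kpow_mem_B (c : Fin n → k) {a : Fin n → ℤ} (ha : a ∈ D.thetaLattice) :
    D.Kpow a ∈ D.B c :=
  (le_sup_left : D.Htheta ≤ D.B c) (D.Kpow_mem_Htheta ha)

theorem Bgen_mem_B (c : Fin n → k) (j : Fin n) : D.Bgen c j ∈ D.B c :=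
  (le_sup_right : Algebra.adjoin k (Set.range (D.Bgen c)) ≤ D.B c)
    (Algebra.subset_adjoin ⟨j, rfl⟩)

theorem prod_Bgen_mem_B (c : Fin n → k) (J : List (Fin n)) : (J.map (D.Bgen c)).prod ∈ D.B c := by
  refine Subalgebra.list_prod_mem _ fun x hx => ?_
  obtain ⟨j, _, rfl⟩ := List.mem_map.1 hx
  exact D.Bgen_mem_B c j

/-! ### The orbit of the cyclic vector -/

/-- The vector `b_J v` in the regular module, where `b` is the main part of the operators `Bⱼ`. -/
noncomputable def mainVec (c : Fin n → k) (J : List (Fin n)) :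
    D.A ⊗[k] ((Fin n → ℤ) →₀ D.A) := (J.map (D.mainB c)).prod D.cyclicVec

theorem mainVec_nil (c : Fin n → k) : D.mainVec c [] = D.cyclicVec := rfl

theorem mainVec_cons (c : Fin n → k) (j : Fin n) (J : List (Fin n)) :
    D.mainVec c (j :: J) = D.mainB c j (D.mainVec c J) := by
  rw [mainVec, List.map_cons, List.prod_cons, Module.End.mul_apply, mainVec]

/-- The degree filtration of the orbit of the cyclic vector under the coideal subalgebra. -/
noncomputable def mainFil (c : Fin n → k) (m : ℕ) :
    Submodule k (D.A ⊗[k] ((Fin n → ℤ) →₀ D.A)) :=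
  Submodule.span k {x | ∃ J : List (Fin n), J.length < m ∧
    ∃ μ ∈ D.thetaLattice, x = D.torus μ (D.mainVec c J)}

variable {D} in
theorem map_mem_mainFil {c : Fin n → k} {m : ℕ} {W : Type*} [AddCommGroup W] [Module k W]
    {f : D.A ⊗[k] ((Fin n → ℤ) →₀ D.A) →ₗ[k] W} {V : Submodule k W}
    (h : ∀ J : List (Fin n), J.length < m → ∀ μ ∈ D.thetaLattice,
      f (D.torus μ (D.mainVec c J)) ∈ V) {x} (hx : x ∈ D.mainFil c m) : f x ∈ V := by
  refine Submodule.span_le (p := V.comap f) |>.2 ?_ hx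
  rintro _ ⟨J, hJ, μ, hμ, rfl⟩
  exact h J hJ μ hμ

theorem torus_mainVec_mem (c : Fin n → k) {m : ℕ} {J : List (Fin n)} (hJ : J.length < m)
    {μ : Fin n → ℤ} (hμ : μ ∈ D.thetaLattice) : D.torus μ (D.mainVec c J) ∈ D.mainFil c m :=
  Submodule.subset_span ⟨J, hJ, μ, hμ, rfl⟩

theorem mainVec_mem (c : Fin n → k) {m : ℕ} {J : List (Fin n)} (hJ : J.length < m) :
    D.mainVec c J ∈ D.mainFil c m := by
  have h := D.torus_mainVec_mem c hJ (zero_mem _)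
  rwa [torus_zero, Module.End.one_apply] at h

theorem mainFil_mono (c : Fin n → k) {m m' : ℕ} (h : m ≤ m') : D.mainFil c m ≤ D.mainFil c m' :=
  Submodule.span_mono fun _ ⟨J, hJ, hy⟩ => ⟨J, hJ.trans_le h, hy⟩

theorem torus_mem_mainFil {c : Fin n → k} {m : ℕ} {a : Fin n → ℤ} (ha : a ∈ D.thetaLattice)
    {x} (hx : x ∈ D.mainFil c m) : D.torus a x ∈ D.mainFil c m := by
  refine map_mem_mainFil (f := D.torus a) (fun J hJ μ hμ => ?_) hx
  rw [torus_torus]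
  exact D.torus_mainVec_mem c hJ (add_mem ha hμ)

theorem mainB_torus (c : Fin n → k) {a : Fin n → ℤ} (ha : a ∈ D.thetaLattice) (j : Fin n) (m) :
    D.mainB c j (D.torus a m) =
      (((D.χ.toFun (-a) (Pi.single j 1))⁻¹ : kˣ) : k) • D.torus a (D.mainB c j m) := by
  rw [D.torus_mainB c ha, smul_smul, Units.inv_mul, one_smul]

theorem indRho_torus (a : Fin n → ℤ) (j : Fin n) (m) : D.regularModule.indRho j (D.torus a m) =
      (((D.χ.toFun (-a) (Pi.single j 1))⁻¹ : kˣ) : k) •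
        D.torus a (D.regularModule.indRho j m) := by
  rw [torus_indRho, smul_smul, Units.inv_mul, one_smul]

theorem mainB_mem_mainFil {c : Fin n → k} {m : ℕ} (j : Fin n) {x} (hx : x ∈ D.mainFil c m) :
    D.mainB c j x ∈ D.mainFil c (m + 1) := by
  refine map_mem_mainFil (f := D.mainB c j) (fun J hJ μ hμ => ?_) hx
  rw [D.mainB_torus c hμ, ← mainVec_cons]
  exact Submodule.smul_mem _ _ (D.torus_mainVec_mem c (by simpa using hJ) hμ)

/-- The raising operator is pushed to the right through the word until it reaches the cyclic vector,
which it kills; on the way it can only delete a letter, leaving a torus element of H_θ. -/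
theorem indRho_mainVec_mem (c : Fin n → k) (i : Fin n) (J : List (Fin n)) :
    D.regularModule.indRho i (D.mainVec c J) ∈ D.mainFil c J.length := by
  induction J with
  | nil => rw [mainVec_nil, indRho_cyclicVec]; exact zero_mem _
  | cons j J ih =>
    rw [mainVec_cons, indRho_mainB]
    refine add_mem (Submodule.smul_mem _ _ (D.mainB_mem_mainFil j ih)) ?_
    split_ifs with h
    · rw [h]
      exact Submodule.smul_mem _ _ (D.torus_mainVec_mem c (by simp)
        (D.single_τ_sub_mem_thetaLattice j))
    · exact zero_mem _

theorem indRho_mem_mainFil {c : Fin n → k} {m : ℕ} (i : Fin n) {x} (hx : x ∈ D.mainFil c (m + 1)) :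
    D.regularModule.indRho i x ∈ D.mainFil c m := by
  refine map_mem_mainFil (f := D.regularModule.indRho i) (fun J hJ μ hμ => ?_) hx
  rw [indRho_torus]
  exact Submodule.smul_mem _ _ (D.torus_mem_mainFil hμ
    (D.mainFil_mono c (Nat.lt_succ_iff.1 hJ) (D.indRho_mainVec_mem c i J)))

theorem action_Bgen_mem_mainFil {c : Fin n → k} {m : ℕ} (j : Fin n) {x}
    (hx : x ∈ D.mainFil c m) :
    D.regularModule.action (D.Bgen c j) x ∈ D.mainFil c (m + 1) := by
  rw [action_Bgen]
  exact sub_mem (D.mainB_mem_mainFil j hx) (D.mainFil_mono c (Nat.le_add_right m 1)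
    (D.indRho_mem_mainFil j (D.mainFil_mono c (Nat.le_add_right m 1) hx)))

theorem action_prod_Bgen_sub_mem (c : Fin n → k) (J : List (Fin n)) :
    D.regularModule.action (J.map (D.Bgen c)).prod D.cyclicVec - D.mainVec c J ∈
      D.mainFil c J.length := by
  induction J with
  | nil => rw [List.map_nil, List.prod_nil, map_one, mainVec_nil, Module.End.one_apply, sub_self]
           exact zero_mem _
  | cons j J ih =>
    have h1 := D.action_Bgen_mem_mainFil j ih
    have h2 := D.mainFil_mono c (Nat.le_add_right _ 1) (D.indRho_mainVec_mem c j J)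
    have h3 := sub_mem h1 h2
    rw [map_sub, D.action_Bgen c j (D.mainVec c J), ← mainVec_cons] at h3
    rw [List.map_cons, List.prod_cons, map_mul, Module.End.mul_apply]
    have h4 : ∀ a b r : D.A ⊗[k] ((Fin n → ℤ) →₀ D.A), a - (b - r) - r = a - b :=
      fun a b r => by abel
    rwa [h4] at h3

theorem triMap_torus (a : Fin n → ℤ) (m) : D.triMap (D.torus a m) = D.Kpow a * D.triMap m := by
  rw [← action_Kpow, triMap_action]

theorem triMap_mainVec (c : Fin n → k) (J : List (Fin n)) : D.triMap (D.mainVec c J) =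
    (J.map (D.Bgen c)).prod - D.triMap (D.regularModule.action (J.map (D.Bgen c)).prod
      D.cyclicVec - D.mainVec c J) := by
  rw [map_sub, triMap_action_cyclicVec, sub_sub_cancel]

theorem prod_Bgen_sub_mem_kerFil (c : Fin n → k) (J : List (Fin n)) :
    (J.map (D.Bgen c)).prod - (J.map D.F).prod ∈ D.kerFil J.length := by
  have h := D.prod_Bgen_mul_sub_mem_kerFil c J D.one_mem_kerFil
  rwa [mul_one, mul_one, add_zero] at h

theorem prod_Bgen_mem_kerFil (c : Fin n → k) (J : List (Fin n)) :
    (J.map (D.Bgen c)).prod ∈ D.kerFil (J.length + 1) := by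
  have h1 := D.kerFil_mono (Nat.le_add_right _ 1) (D.prod_Bgen_sub_mem_kerFil c J)
  have h := add_mem h1 (D.prod_F_mul_mem_kerFil J D.one_mem_kerFil)
  rwa [mul_one, sub_add_cancel] at h

/-- Under the triangular decomposition b_J v is B_J minus terms with shorter words, and these are
already in B_c by induction. -/
theorem triMap_mem_of_mem_mainFil {c : Fin n → k} {m : ℕ} {x} (hx : x ∈ D.mainFil c m) :
    D.triMap x ∈ Subalgebra.toSubmodule (D.B c) ⊓ D.kerFil m := by
  induction m generalizing x with
  | zero =>
    refine map_mem_mainFil (fun J hJ => absurd hJ (Nat.not_lt_zero _)) hx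
  | succ m ih =>
    refine map_mem_mainFil (fun J hJ μ hμ => ?_) hx
    have h1 := ih (D.mainFil_mono c (Nat.lt_succ_iff.1 hJ) (D.action_prod_Bgen_sub_mem c J))
    rw [triMap_torus]
    refine ⟨(D.B c).mul_mem (D.Kpow_mem_B c hμ) ?_, D.Kpow_mul_mem_kerFil hμ ?_⟩
    · rw [triMap_mainVec]
      exact (D.B c).sub_mem (D.prod_Bgen_mem_B c J) h1.1
    · rw [triMap_mainVec]
      exact sub_mem (D.kerFil_mono hJ (D.prod_Bgen_mem_kerFil c J))
        (D.kerFil_mono (Nat.le_add_right m 1) h1.2)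

theorem triMap_mainVec_sub_mem (c : Fin n → k) (J : List (Fin n)) :
    D.triMap (D.mainVec c J) - (J.map D.F).prod ∈ D.kerFil J.length := by
  rw [triMap_mainVec, sub_right_comm]
  exact sub_mem (D.prod_Bgen_sub_mem_kerFil c J)
    (D.triMap_mem_of_mem_mainFil (D.action_prod_Bgen_sub_mem c J)).2

/-- Stability under the generators of B_c: torus elements of H_θ permute the spanning vectors up to
regrouping, and each Bⱼ adds a letter by `mainB` or removes one by `indRho`. -/
theorem action_mem_iSup_mainFil (c : Fin n → k) {u : D.U} (hu : u ∈ D.B c) {x}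
    (hx : x ∈ ⨆ m, D.mainFil c m) : D.regularModule.action u x ∈ ⨆ m, D.mainFil c m := by
  have hstable : ∀ f : Module.End k (D.A ⊗[k] ((Fin n → ℤ) →₀ D.A)),
      (∀ m, ∀ x ∈ D.mainFil c m, f x ∈ ⨆ m, D.mainFil c m) → ∀ x ∈ ⨆ m, D.mainFil c m,
        f x ∈ ⨆ m, D.mainFil c m := fun f hf x hx =>
    (iSup_le hf : _ ≤ (⨆ m, D.mainFil c m).comap f) hx
  rw [B, Htheta, ← Algebra.adjoin_union] at hu
  induction hu using Algebra.adjoin_induction generalizing x with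
  | mem u hu =>
    obtain ⟨i, rfl⟩ | ⟨i, rfl⟩ := hu
    · simp only [← Kpow_single_sub, action_Kpow]
      exact hstable _ (fun m x hx => Submodule.mem_iSup_of_mem m
        (D.torus_mem_mainFil (D.single_sub_mem_thetaLattice i) hx)) x hx
    · exact hstable _ (fun m x hx => Submodule.mem_iSup_of_mem (m + 1)
        (D.action_Bgen_mem_mainFil i hx)) x hx
  | algebraMap r =>
    rw [AlgHom.commutes, Module.algebraMap_end_apply]
    exact Submodule.smul_mem _ _ hx
  | add u u' _ _ hu hu' => rw [map_add, LinearMap.add_apply]; exact add_mem (hu hx) (hu' hx)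
  | mul u u' _ _ hu hu' => rw [map_mul, Module.End.mul_apply]; exact hu (hu' hx)

/-! ### The lift of the partial bosonization -/

section Section

variable {D} {c : Fin n → k} (hb : ∀ p ∈ D.I, FreeAlgebra.lift k (D.mainB c) p = 0)

/-- The map `y ↦ y(b) v`. -/
noncomputable def mainEval : D.A →ₗ[k] D.A ⊗[k] ((Fin n → ℤ) →₀ D.A) :=
  -- Here the relations for b are indispensable: the elements Bⱼ themselves need not satisfy them,
  -- so y(B) would not be defined.
  D.descend (LinearMap.applyₗ D.cyclicVec ∘ₗ (FreeAlgebra.lift k (D.mainB c)).toLinearMap)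
    fun p hp => by
      rw [LinearMap.comp_apply, AlgHom.toLinearMap_apply, hb p hp, map_zero]

theorem mainEval_monomial (J : List (Fin n)) :
    mainEval hb (D.toA (monomial J)) = D.mainVec c J := by
  rw [mainEval, descend_toA, mainVec]
  exact LinearMap.congr_fun (lift_monomial (D.mainB c) J) D.cyclicVec

/-- The linear map with `y(F) K_λ = K_λ y'(F) ↦ K_λ y'(b) v`. -/
noncomputable def bosLiftVec :
    (D.thetaLattice →₀ D.A) →ₗ[k] D.A ⊗[k] ((Fin n → ℤ) →₀ D.A) :=
  Finsupp.lsum k fun μ => D.torus μ ∘ₗ mainEval hb ∘ₗ D.twA μ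

theorem bosLiftVec_single (μ : D.thetaLattice) (J : List (Fin n)) :
    bosLiftVec hb (Finsupp.single μ (D.toA (monomial J))) =
      (D.χ.twScalar μ J : k) • D.torus μ (D.mainVec c J) := by
  rw [bosLiftVec, Finsupp.lsum_single, LinearMap.comp_apply, LinearMap.comp_apply, twA_monomial,
    map_smul, map_smul, mainEval_monomial]

theorem iSup_mainFil_le : ⨆ m, D.mainFil c m ≤ LinearMap.range (bosLiftVec hb) := by
  refine iSup_le fun m => Submodule.span_le.2 ?_
  rintro _ ⟨J, _, μ, hμ, rfl⟩
  refine ⟨(((D.χ.twScalar μ J)⁻¹ : kˣ) : k) • Finsupp.single ⟨μ, hμ⟩ (D.toA (monomial J)), ?_⟩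
  rw [map_smul, bosLiftVec_single, smul_smul, Units.inv_mul, one_smul]

theorem triMap_bosLiftVec_mem (f : D.thetaLattice →₀ D.A) :
    D.triMap (bosLiftVec hb f) ∈ Subalgebra.toSubmodule (D.B c) := by
  induction f using Finsupp.induction_linear with
  | zero => rw [map_zero, map_zero]; exact zero_mem _
  | add f g hf hg => rw [map_add, map_add]; exact add_mem hf hg
  | single μ y =>
    induction y using D.A_induction_monomial with
    | mon J =>
      rw [bosLiftVec_single, map_smul]
      exact Submodule.smul_mem _ _ (D.triMap_mem_of_mem_mainFil
        (D.torus_mainVec_mem c (Nat.lt_succ_self J.length) μ.2)).1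
    | zero => rw [Finsupp.single_zero, map_zero, map_zero]; exact zero_mem _
    | add x y hx hy => rw [Finsupp.single_add, map_add, map_add]; exact add_mem hx hy
    | smul a x hx => rw [← Finsupp.smul_single, map_smul, map_smul]; exact Submodule.smul_mem _ _ hx

/-- The lift of the partial bosonization to the coideal subalgebra. -/
noncomputable def bosLift : D.partialBos →ₗ[k] D.B c :=
  LinearMap.codRestrict (Subalgebra.toSubmodule (D.B c))
    (D.triMap ∘ₗ bosLiftVec hb ∘ₗ D.bosEquiv.symm.toLinearMap)
    fun _ => triMap_bosLiftVec_mem hb _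

theorem coe_bosLift (x : D.partialBos) :
    (bosLift hb x : D.U) = D.triMap (bosLiftVec hb (D.bosEquiv.symm x)) := rfl

/-- An element u of B_c is recovered from uv by the triangular decomposition, and uv lies in the
span of the vectors K_μ b_J v. -/
theorem bosLift_surjective : Function.Surjective (bosLift hb) := by
  intro u
  have h1 : D.cyclicVec ∈ ⨆ m, D.mainFil c m :=
    Submodule.mem_iSup_of_mem 1 (D.mainVec_mem c (J := []) Nat.one_pos)
  obtain ⟨f, hf⟩ := iSup_mainFil_le hb (D.action_mem_iSup_mainFil c u.2 h1)
  refine ⟨D.bosEquiv f, Subtype.ext ?_⟩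
  rw [coe_bosLift, LinearEquiv.symm_apply_apply, hf, triMap_action_cyclicVec]

/-- The lift of K_μF_J corresponds to K_μ b_J v, which agrees with K_μF_J up to the kernel of ψ and
terms of lower degree. -/
theorem psiB_bosLift_sub_mem (m : ℕ) (x : D.partialBos) (hx : x ∈ D.bosFil (m + 1)) :
    D.psiB c (bosLift hb x) - x ∈ D.bosFil m := by
  refine Submodule.span_le (p := (D.bosFil m).comap (D.psiB c ∘ₗ bosLift hb - LinearMap.id)) |>.2
    ?_ hx
  rintro _ ⟨J, μ, hJ, rfl⟩
  rw [SetLike.mem_coe, Submodule.mem_comap, LinearMap.sub_apply, LinearMap.comp_apply,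
    LinearMap.id_apply]
  set x := D.bosEquiv (Finsupp.single μ (D.toA (monomial J))) with hx
  have h1 : (bosLift hb x : D.U) - (x : D.U) ∈ D.kerFil m := by
    rw [coe_bosLift, hx, LinearEquiv.symm_apply_apply, bosLiftVec_single, map_smul,
      coe_bosEquiv_single, evF_monomial, list_prod_F_mul_Kpow, triMap_torus, ← smul_sub, ← mul_sub]
    exact Submodule.smul_mem _ _ (D.Kpow_mul_mem_kerFil μ.2
      (D.kerFil_mono (Nat.lt_succ_iff.1 hJ) (D.triMap_mainVec_sub_mem c J)))
  have h2 := D.psi_mem_bosFil (x := Subalgebra.inclusion (D.B_le_Upoly c) (bosLift hb x) -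
    D.bosIncl x) (by rwa [Subalgebra.coe_sub, coe_bosIncl, Subalgebra.coe_inclusion])
  rw [map_sub, psi_bosIncl] at h2
  exact h2

/-- The composite with the lift is bijective by the filtration argument; this makes the lift
injective, and it is surjective, so ψ on B_c is a composition of bijections. -/
theorem psiB_bijective (hb : ∀ p ∈ D.I, FreeAlgebra.lift k (D.mainB c) p = 0) :
    Function.Bijective (D.psiB c) := by
  have h : Function.Bijective (D.psiB c ∘ₗ bosLift hb) :=
    bijective_of_sub_mem_filtration D.bosFil_zero D.exists_mem_bosFil (psiB_bosLift_sub_mem hb)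
  rw [LinearMap.coe_comp] at h
  have h2 : Function.Bijective (bosLift hb) := ⟨h.1.of_comp, bosLift_surjective hb⟩
  exact (Function.Bijective.of_comp_iff _ h2).1 h

end Section

end Datum

end Filtration

end PreNichols

namespace PreNichols

/-! ## The star product -/

open TensorProduct

section Star

variable {k : Type*} [Field k] {n : ℕ}

open NCPoly

namespace Datum

variable (D : Datum k n)

theorem bosGrading_eq_span (m : ℕ) : D.bosGrading m =
    Submodule.span k {x | ∃ (J : List (Fin n)) (μ : D.thetaLattice), J.length = m ∧
      x = D.bosEquiv (Finsupp.single μ (D.toA (monomial J)))} := by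
  apply le_antisymm
  · intro x hx
    rw [mem_bosGrading] at hx
    have h : (x : D.U) ∈ Submodule.map D.partialBos.val.toLinearMap (Submodule.span k
        {x | ∃ (J : List (Fin n)) (μ : D.thetaLattice), J.length = m ∧
          x = D.bosEquiv (Finsupp.single μ (D.toA (monomial J)))}) := by
      refine Submodule.span_le.2 ?_ hx
      rintro _ ⟨J, hJ, μ, hμ, rfl⟩
      refine ⟨(((D.χ.twScalar μ J)⁻¹ : kˣ) : k) •
        D.bosEquiv (Finsupp.single ⟨μ, hμ⟩ (D.toA (monomial J))),
        Submodule.smul_mem _ _ (Submodule.subset_span ⟨J, _, hJ, rfl⟩), ?_⟩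
      rw [map_smul]
      show _ • (D.bosEquiv (Finsupp.single ⟨μ, hμ⟩ (D.toA (monomial J))) : D.U) = _
      rw [coe_bosEquiv_single, evF_monomial, list_prod_F_mul_Kpow, smul_smul, Units.inv_mul,
        one_smul]
    obtain ⟨y, hy, hyx⟩ := h
    rwa [← (Subtype.ext hyx : y = x)]
  · rw [Submodule.span_le]
    rintro _ ⟨J, μ, rfl, rfl⟩
    exact D.bosEquiv_single_mem μ J

theorem bosFil_eq_iSup (m : ℕ) : D.bosFil m = ⨆ l : Fin m, D.bosGrading l := by
  apply le_antisymm
  · rw [bosFil, Submodule.span_le]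
    rintro _ ⟨J, μ, hJ, rfl⟩
    exact Submodule.mem_iSup_of_mem (⟨J.length, hJ⟩ : Fin m) (D.bosEquiv_single_mem μ J)
  · refine iSup_le fun l => ?_
    rw [bosGrading_eq_span, Submodule.span_le]
    rintro _ ⟨J, μ, hJ, rfl⟩
    exact Submodule.subset_span ⟨J, μ, hJ ▸ l.2, rfl⟩

theorem bosGrading_le_bosFil {l m : ℕ} (h : l < m) : D.bosGrading l ≤ D.bosFil m := by
  rw [bosFil_eq_iSup]
  exact le_iSup (fun l : Fin m => D.bosGrading l) ⟨l, h⟩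

theorem coe_mem_Htheta_of_mem_bosGrading_zero {h : D.partialBos} (hh : h ∈ D.bosGrading 0) :
    (h : D.U) ∈ D.Htheta := by
  rw [mem_bosGrading] at hh
  rw [← Subalgebra.mem_toSubmodule]
  refine Submodule.span_le.2 ?_ hh
  rintro _ ⟨J, hJ, μ, hμ, rfl⟩
  rw [List.eq_nil_of_length_eq_zero hJ, List.map_nil, List.prod_nil, mul_one]
  exact D.Kpow_mem_Htheta hμ

theorem mul_Htheta_mem_kerU {z h : D.U} (hz : z ∈ D.kerU) (hh : h ∈ D.Htheta) :
    z * h ∈ D.kerU := by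
  rw [← Subalgebra.mem_toSubmodule, toSubmodule_Htheta] at hh
  refine Submodule.span_le (p := D.kerU.comap (LinearMap.mulLeft k z)) |>.2 ?_ hh
  rintro _ ⟨μ, hμ, rfl⟩
  exact D.mul_Kpow_mem_kerU hμ hz

theorem psi_sub_mem_bosFil {m : ℕ} {x : D.Upoly} {y : D.partialBos}
    (h : (x : D.U) - (y : D.U) ∈ D.kerFil m) : D.psi x - y ∈ D.bosFil m := by
  have h2 := D.psi_mem_bosFil (x := x - D.bosIncl y) (by rwa [Subalgebra.coe_sub, coe_bosIncl])
  rwa [map_sub, psi_bosIncl] at h2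

/-- `Fⱼ` as an element of the partial bosonization. -/
noncomputable def Fbos (j : Fin n) : D.partialBos := D.minusIncl (D.Fminus j)

theorem coe_minusIncl (u : D.Uminus) : (D.minusIncl u : D.U) = u :=
  Subalgebra.coe_inclusion (le_sup_right : D.Uminus ≤ D.partialBos) u

theorem coe_Fbos (j : Fin n) : (D.Fbos j : D.U) = D.F j := D.coe_minusIncl _

/-- `K_μ` as an element of the partial bosonization. -/
noncomputable def Kbos (μ : D.thetaLattice) : D.partialBos := ⟨D.Kpow μ, D.Kpow_mem_partialBos μ.2⟩

theorem coe_Kbos (μ : D.thetaLattice) : (D.Kbos μ : D.U) = D.Kpow μ := rfl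

theorem Kbos_eq (μ : D.thetaLattice) :
    D.Kbos μ = D.bosEquiv (Finsupp.single μ (D.toA (monomial []))) := by
  refine Subtype.ext ?_
  rw [coe_bosEquiv_single, monomial_nil, toA_one, evF_one, one_mul, coe_Kbos]

theorem Kbos_mem (μ : D.thetaLattice) : D.Kbos μ ∈ D.bosGrading 0 := by
  rw [Kbos_eq]
  exact D.bosEquiv_single_mem μ []

theorem bosEquiv_single_cons (μ : D.thetaLattice) (j : Fin n) (J : List (Fin n)) :
    D.bosEquiv (Finsupp.single μ (D.toA (monomial (j :: J)))) =
      D.Fbos j * D.bosEquiv (Finsupp.single μ (D.toA (monomial J))) := by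
  refine Subtype.ext ?_
  rw [Subalgebra.coe_mul, coe_bosEquiv_single, coe_bosEquiv_single, monomial_cons, toA_ι_mul,
    evF_mul, evF_X, coe_Fbos, mul_assoc]

theorem Fbos_mem (j : Fin n) : D.Fbos j ∈ D.bosGrading 1 := by
  have h : D.Fbos j = D.bosEquiv (Finsupp.single 0 (D.toA (monomial [j]))) := by
    have hK : D.bosEquiv (Finsupp.single 0 (D.toA (monomial []))) = 1 := by
      rw [← Kbos_eq]
      exact Subtype.ext D.Kpow_zero
    rw [bosEquiv_single_cons, hK, mul_one]
  rw [h]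
  exact D.bosEquiv_single_mem 0 [j]

theorem Fbos_mul_Kbos (j : Fin n) (μ : D.thetaLattice) : D.Fbos j * D.Kbos μ =
    (((D.χ.toFun (-μ) (Pi.single j 1))⁻¹ : kˣ) : k) • (D.Kbos μ * D.Fbos j) := by
  refine Subtype.ext ?_
  rw [Subalgebra.coe_smul, Subalgebra.coe_mul, Subalgebra.coe_mul, coe_Fbos, coe_Kbos, Kpow_mul_F,
    smul_smul, Units.inv_mul, one_smul]

theorem bosEquiv_single_eq (μ : D.thetaLattice) (y : D.A) : D.bosEquiv (Finsupp.single μ y) =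
    D.Kbos μ * D.minusIncl (D.minusEquiv (D.twA μ y)) := by
  refine Subtype.ext ?_
  rw [Subalgebra.coe_mul, coe_bosEquiv_single, coe_Kbos, coe_minusIncl, coe_minusEquiv,
    evF_mul_Kpow]

/-! ### Uniqueness -/

section Uniqueness

variable {D} {m m' : D.partialBos →ₗ[k] D.partialBos →ₗ[k] D.partialBos}

/-- Equivariance allows K_μu to be read as K_μ * u; then associativity, the commutation of Fⱼ with
K_μ, and equivariance again pull K_μ out. So the formula on U⁻ determines Fⱼ * y for all y. -/
theorem star_Fbos_Kbos_mul (hm : IsStarProduct D.bosGrading m)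
    (h0 : IsZeroEquivariant D.bosGrading m) (j : Fin n) (μ : D.thetaLattice) (u : D.partialBos) :
    m (D.Fbos j) (D.Kbos μ * u) = (((D.χ.toFun (-μ) (Pi.single j 1))⁻¹ : kˣ) : k) •
      (D.Kbos μ * m (D.Fbos j) u) := by
  have hK := h0 _ (D.Kbos_mem μ)
  rw [← (hK u).2, ← hm.assoc, (hK _).1, Fbos_mul_Kbos, map_smul, LinearMap.smul_apply, ← (hK _).2,
    hm.assoc, (hK _).2]

theorem star_Fbos_eq {c : Fin n → k} (hm : IsStarProduct D.bosGrading m)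
    (h0 : IsZeroEquivariant D.bosGrading m) (h1 : D.HasFirstOrderFormula c m)
    (hm' : IsStarProduct D.bosGrading m') (h0' : IsZeroEquivariant D.bosGrading m')
    (h1' : D.HasFirstOrderFormula c m') (j : Fin n) : m (D.Fbos j) = m' (D.Fbos j) := by
  refine LinearMap.ext fun y => ?_
  obtain ⟨f, rfl⟩ := D.bosEquiv.surjective y
  induction f using Finsupp.induction_linear with
  | zero => simp
  | add f g hf hg => simp only [map_add, hf, hg]
  | single μ y =>
    rw [bosEquiv_single_eq, star_Fbos_Kbos_mul hm h0, star_Fbos_Kbos_mul hm' h0', Fbos, h1, h1']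

/-- Induction on the degree of the left factor. In degree zero equivariance decides; in positive
degree a monomial Fⱼa is Fⱼ * a up to lower terms, and (Fⱼ * a) * b = Fⱼ * (a * b). -/
theorem star_unique {c : Fin n → k} (hm : IsStarProduct D.bosGrading m)
    (h0 : IsZeroEquivariant D.bosGrading m) (h1 : D.HasFirstOrderFormula c m)
    (hm' : IsStarProduct D.bosGrading m') (h0' : IsZeroEquivariant D.bosGrading m')
    (h1' : D.HasFirstOrderFormula c m') : m = m' := by
  have key : ∀ i, D.bosGrading i ≤ LinearMap.eqLocus m m' := by
    intro i
    induction i using Nat.strong_induction_on with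
    | _ i ih =>
      have ihFil : D.bosFil i ≤ LinearMap.eqLocus m m' := by
        rw [bosFil_eq_iSup]
        exact iSup_le fun l => ih l l.2
      rw [bosGrading_eq_span, Submodule.span_le]
      rintro _ ⟨J, μ, hJ, rfl⟩
      cases J with
      | nil =>
        refine LinearMap.ext fun b => ?_
        have h := D.bosEquiv_single_mem μ []
        rw [(h0 _ h b).2, (h0' _ h b).2]
      | cons j J =>
        have ha := D.bosEquiv_single_mem μ J
        -- The star property gives Fⱼ * a - Fⱼa in lower degree, where the products agree by
        -- induction; it remains to compare them on Fⱼ * a.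
        have hlow := hm.sub_mem 1 _ _ (D.Fbos_mem j) _ ha
        rw [← bosFil_eq_iSup, ← bosEquiv_single_cons, add_comm 1] at hlow
        rw [List.length_cons] at hJ
        rw [hJ] at hlow
        have h3 := ihFil hlow
        rw [LinearMap.mem_eqLocus, map_sub, map_sub] at h3
        have h4 : m (m (D.Fbos j) (D.bosEquiv (Finsupp.single μ (D.toA (monomial J))))) =
            m' (m (D.Fbos j) (D.bosEquiv (Finsupp.single μ (D.toA (monomial J))))) := by
          refine LinearMap.ext fun b => ?_
          have h5 := ih _ (by omega) ha
          rw [LinearMap.mem_eqLocus] at h5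
          rw [hm.assoc, star_Fbos_eq hm h0 h1 hm' h0' h1', hm'.assoc, h5]
        rw [h4] at h3
        exact sub_right_injective h3
  refine LinearMap.ext fun a => ?_
  have h : ⨆ i, D.bosGrading i ≤ LinearMap.eqLocus m m' := iSup_le key
  rw [iSup_bosGrading] at h
  exact h (Submodule.mem_top (x := a))

end Uniqueness

/-! ### The transported product -/

section Transport

variable {D} {c : Fin n → k} {e : D.B c ≃ₗ[k] D.partialBos} (he : ∀ b, e b = D.psiB c b)

include he

theorem psi_inclusion_eq (u : D.B c) :
    D.psi (Subalgebra.inclusion (D.B_le_Upoly c) u) = e u := by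
  rw [he]
  rfl

/-- Because the kernel of ψ is a left ideal, only the left factor has to be lifted to B_c; the right
one may stay in H_θ ⋉ U⁻. -/
theorem transportMul_eq_psi (u : D.B c) (y : D.partialBos) : transportMul e (e u) y =
    D.psi (Subalgebra.inclusion (D.B_le_Upoly c) u * D.bosIncl y) := by
  have h := D.psi_mul_psi (Subalgebra.inclusion (D.B_le_Upoly c) u)
    (Subalgebra.inclusion (D.B_le_Upoly c) (e.symm y))
  rw [psi_inclusion_eq he, e.apply_symm_apply] at h
  rw [transportMul_apply, e.symm_apply_apply, h, ← map_mul, psi_inclusion_eq he]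

theorem transportMul_eq {u : D.B c} {y z : D.partialBos}
    (h : (u : D.U) * (y : D.U) - (z : D.U) ∈ D.kerU) : transportMul e (e u) y = z := by
  rw [transportMul_eq_psi he]
  refine D.psi_eq ?_
  rwa [Subalgebra.coe_mul, coe_bosIncl, Subalgebra.coe_inclusion]

theorem equiv_eq {u : D.B c} {z : D.partialBos} (h : (u : D.U) - (z : D.U) ∈ D.kerU) : e u = z := by
  rw [← psi_inclusion_eq he]
  refine D.psi_eq ?_
  rwa [Subalgebra.coe_inclusion]

theorem sub_equiv_mem_kerU (u : D.B c) : (u : D.U) - (e u : D.U) ∈ D.kerU := by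
  have h := D.sub_psi_mem_kerU (Subalgebra.inclusion (D.B_le_Upoly c) u)
  rwa [psi_inclusion_eq he, Subalgebra.coe_inclusion] at h

/-- Elements of H_θ lie in B_c and are fixed by ψ, which settles multiplication from the left; from
the right it holds because the kernel of ψ is stable under right multiplication with H_θ. -/
theorem isZeroEquivariant_transportMul :
    IsZeroEquivariant D.bosGrading (transportMul e) := by
  intro h hh a
  have hθ := D.coe_mem_Htheta_of_mem_bosGrading_zero hh
  constructor
  · obtain ⟨u, rfl⟩ := e.surjective a
    refine transportMul_eq he ?_
    rw [Subalgebra.coe_mul, ← sub_mul]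
    exact D.mul_Htheta_mem_kerU (sub_equiv_mem_kerU he u) hθ
  · have hu : e ⟨h, (le_sup_left : D.Htheta ≤ D.B c) hθ⟩ = h :=
      equiv_eq he (by rw [sub_self]; exact zero_mem _)
    have h2 := transportMul_eq he (u := ⟨h, (le_sup_left : D.Htheta ≤ D.B c) hθ⟩) (y := a)
      (z := h * a) (by rw [Subalgebra.coe_mul, sub_self]; exact zero_mem _)
    rwa [hu] at h2

theorem equiv_Bgen (i : Fin n) : e ⟨D.Bgen c i, D.Bgen_mem_B c i⟩ = D.Fbos i := by
  refine equiv_eq he ?_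
  show D.Bgen c i - (D.Fbos i : D.U) ∈ D.kerU
  rw [coe_Fbos, Bgen, add_sub_cancel_left]
  exact Submodule.smul_mem _ _ (D.E_mul_Kinv_mem_kerU i)

/-- The lift of Fᵢ is Bᵢ, so the product is ψ(Bᵢu), and the surviving term of E_{τ(i)}Kᵢ⁻¹u gives
the correction. -/
theorem hasFirstOrderFormula_transportMul : D.HasFirstOrderFormula c (transportMul e) := by
  intro i u
  obtain ⟨y, rfl⟩ := D.minusEquiv.surjective u
  have h1 := D.E_mul_Kinv_mul_evF_sub_mem i y
  -- The constant q_{iτ(i)} comes from moving ∂ᴸ_{τ(i)} past the action of Kᵢ; the remaining twists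
  -- are absorbed when K_{τ(i)}Kᵢ⁻¹ is brought to the left.
  have h2 : D.evF (D.twA (-Pi.single (D.τ i) 1) (D.dLA (D.τ i) (D.twA (Pi.single i 1) y))) *
      D.Kpow (Pi.single (D.τ i) 1 - Pi.single i 1) = (D.χ.q i (D.τ i) : k) •
        (D.K (D.τ i) * D.Kinv i * D.evF (D.dLA (D.τ i) y)) := by
    have h3 := LinearMap.congr_fun (D.dLA_mul_twA (D.τ i) (Pi.single i 1)) y
    have h4 := LinearMap.congr_fun (D.twA_mul_twA (-Pi.single (D.τ i) 1) (Pi.single i 1))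
      (D.dLA (D.τ i) y)
    simp only [Module.End.mul_apply, LinearMap.smul_apply] at h3 h4
    rw [h3, map_smul, h4, ← Kpow_single_sub, Kpow_mul_evF, neg_sub, map_smul, smul_mul_assoc,
      toFun_single, sub_eq_neg_add (Pi.single i 1 : Fin n → ℤ)]
  rw [h2] at h1
  rw [← Fbos, ← equiv_Bgen he i]
  refine transportMul_eq he ?_
  show D.Bgen c i * (D.minusIncl (D.minusEquiv y) : D.U) - _ ∈ D.kerU
  rw [equiv_Bgen he i, skewL_eq, LinearEquiv.conj_apply_apply, LinearEquiv.symm_apply_apply,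
    Subalgebra.coe_add, Subalgebra.coe_mul, Subalgebra.coe_smul, Subalgebra.coe_mul, coe_Fbos,
    coe_minusIncl, coe_minusIncl, coe_minusEquiv, coe_minusEquiv, Bgen, add_mul,
    add_sub_add_left_eq_sub, smul_mul_assoc, mul_smul, ← smul_sub]
  exact Submodule.smul_mem _ _ h1

/-- For a = K_μF_J take u = K_μB_J in B_c. Then ψ(u) * b = ψ(ub) agrees with ab to leading order,
and the error (ψ(u) - a) * b is controlled by induction, as ψ(u) - a has degree below i. -/
theorem transportMul_sub_mem (i : ℕ) : ∀ j : ℕ, ∀ a ∈ D.bosGrading i, ∀ b ∈ D.bosGrading j,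
    transportMul e a b - a * b ∈ D.bosFil (i + j) := by
  induction i using Nat.strong_induction_on with
  | _ i ih =>
    intro j a ha b hb
    -- Left factors of degree below i, times b, give products of degree below i + j: by induction
    -- these differ from the ordinary products only in still lower degree.
    have low : D.bosFil i ≤ (D.bosFil (i + j)).comap ((transportMul e).flip b) := by
      rw [bosFil_eq_iSup]
      refine iSup_le fun l x hx => ?_
      rw [Submodule.mem_comap, LinearMap.flip_apply]
      have h1 := D.bosFil_mono (show (l : ℕ) + j ≤ i + j by omega) (ih l l.2 j x hx b hb)
      have h2 := D.bosGrading_le_bosFil (show (l : ℕ) + j < i + j by omega)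
        (SetLike.mul_mem_graded hx hb)
      have h3 := add_mem h1 h2
      rwa [sub_add_cancel] at h3
    have hbker : (b : D.U) ∈ D.kerFil (j + 1) :=
      D.coe_mem_kerFil (D.bosGrading_le_bosFil (Nat.lt_succ_self j) hb)
    rw [bosGrading_eq_span] at ha
    refine Submodule.span_le (p := (D.bosFil (i + j)).comap
      ((transportMul e).flip b - LinearMap.mulRight k b)) |>.2 ?_ ha
    rintro _ ⟨J, μ, hJ, rfl⟩
    set a := D.bosEquiv (Finsupp.single μ (D.toA (monomial J))) with ha'
    have hacoe : (a : D.U) = (D.χ.twScalar μ J : k) • (D.Kpow μ * (J.map D.F).prod) := by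
      rw [ha', coe_bosEquiv_single, evF_monomial, list_prod_F_mul_Kpow]
    set u : D.B c := ⟨(D.χ.twScalar μ J : k) • (D.Kpow μ * (J.map (D.Bgen c)).prod),
      (D.B c).smul_mem ((D.B c).mul_mem (D.Kpow_mem_B c μ.2) (D.prod_Bgen_mem_B c J)) _⟩ with hu
    have hucoe : (u : D.U) = (D.χ.twScalar μ J : k) • (D.Kpow μ * (J.map (D.Bgen c)).prod) := rfl
    have h1 : e u - a ∈ D.bosFil i := by
      rw [← psi_inclusion_eq he]
      refine D.psi_sub_mem_bosFil ?_
      rw [Subalgebra.coe_inclusion, hucoe, hacoe, ← smul_sub, ← mul_sub, ← hJ]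
      exact Submodule.smul_mem _ _ (D.Kpow_mul_mem_kerFil μ.2 (D.prod_Bgen_sub_mem_kerFil c J))
    have h2 : transportMul e (e u) b - a * b ∈ D.bosFil (i + j) := by
      rw [transportMul_eq_psi he]
      refine D.psi_sub_mem_bosFil ?_
      rw [Subalgebra.coe_mul, coe_bosIncl, Subalgebra.coe_inclusion, Subalgebra.coe_mul, hucoe,
        hacoe, smul_mul_assoc, smul_mul_assoc, mul_assoc, mul_assoc, ← smul_sub, ← mul_sub, ← hJ]
      exact Submodule.smul_mem _ _ (D.Kpow_mul_mem_kerFil μ.2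
        (D.prod_Bgen_mul_sub_mem_kerFil c J hbker))
    have h3 := low h1
    rw [Submodule.mem_comap, LinearMap.flip_apply, map_sub, LinearMap.sub_apply] at h3
    have h4 := sub_mem h2 h3
    have h5 : ∀ x y z : D.partialBos, x - y - (x - z) = z - y := fun x y z => by abel
    rw [h5] at h4
    exact h4

theorem isStarProduct_transportMul : IsStarProduct D.bosGrading (transportMul e) where
  assoc a b c := by
    simp only [transportMul_apply, LinearEquiv.symm_apply_apply, mul_assoc]
  sub_mem i j a ha b hb := by
    rw [← bosFil_eq_iSup]
    exact transportMul_sub_mem he i j a ha b hb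

end Transport

end Datum

end Star

end PreNichols

/-! ### The theorem. -/

theorem theorem4p2 {k : Type*} [Field k] {n : ℕ} (D : PreNichols.Datum k n) (c : Fin n → k)
    (hc : D.ConditionC c) :
    -- `U⁻` is the pre-Nichols algebra defined by `I`, and the projections, skew derivations and
    -- the grading in the statement are well defined
    (∀ p : PreNichols.NCPoly k n, FreeAlgebra.lift k D.F p = 0 ↔ p ∈ D.I) ∧
    DirectSum.IsInternal D.UKG ∧ DirectSum.IsInternal D.UHU ∧
    IsCompl (LinearMap.range D.bosIncl) D.psiKer ∧
    (∀ i : Fin n, ∃! d, D.IsSkewPair i d) ∧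
    (SetLike.GradedMonoid D.bosGrading ∧ DirectSum.IsInternal D.bosGrading) ∧
    -- the restriction of `ψ` to `B_c` is a linear isomorphism, and the transported product is
    -- the unique `0`-equivariant star product satisfying the formula
    ∃ e : D.B c ≃ₗ[k] D.partialBos,
      (∀ b, e b = D.psiB c b) ∧
      PreNichols.IsStarProduct D.bosGrading (PreNichols.transportMul e) ∧
      PreNichols.IsZeroEquivariant D.bosGrading (PreNichols.transportMul e) ∧
      D.HasFirstOrderFormula c (PreNichols.transportMul e) ∧
      ∀ m : D.partialBos →ₗ[k] D.partialBos →ₗ[k] D.partialBos,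
        PreNichols.IsStarProduct D.bosGrading m → PreNichols.IsZeroEquivariant D.bosGrading m →
        D.HasFirstOrderFormula c m → m = PreNichols.transportMul e := by
  have hb : ∀ p ∈ D.I, FreeAlgebra.lift k (D.mainB c) p = 0 := fun _ hp =>
    hc.lift_mainB_eq_zero D hp
  have he : ∀ b, LinearEquiv.ofBijective (D.psiB c) (D.psiB_bijective hb) b = D.psiB c b :=
    fun _ => rfl
  exact ⟨D.lift_F_eq_zero_iff, D.isInternal_UKG, D.isInternal_UHU, D.isCompl_psiKer,
    D.existsUnique_isSkewPair, ⟨D.gradedMonoid_bosGrading, D.isInternal_bosGrading⟩,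
    LinearEquiv.ofBijective (D.psiB c) (D.psiB_bijective hb), he,
    PreNichols.Datum.isStarProduct_transportMul he,
    PreNichols.Datum.isZeroEquivariant_transportMul he,
    PreNichols.Datum.hasFirstOrderFormula_transportMul he,
    fun m hm h0 h1 => PreNichols.Datum.star_unique hm h0 h1
      (PreNichols.Datum.isStarProduct_transportMul he)
      (PreNichols.Datum.isZeroEquivariant_transportMul he)
      (PreNichols.Datum.hasFirstOrderFormula_transportMul he)⟩
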